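/- Let $p$ be a prime and let $E$ be a complete discretely valued field with valuation ring $\mathfrak{o}_E$, uniformizer $\varpi$ and finite residue field $\mathbb{F}_q$ of characteristic $p$ ($E$ may have characteristic $0$ or $p$). Let $L$ be a perfect field containing $\mathbb{F}_q$ that is complete with respect to a nontrivial multiplicative nonarchimedean norm $|\cdot|$, with valuation ring $\mathfrak{o}_L$. For a perfect $\mathbb{F}_q$-algebra $R$ put $W(R)_E = W(R) \otimes_{W(\mathbb{F}_q)} \mathfrak{o}_E$, where $W$ denotes $p$-typical Witt vectors. Let $A_{L,E} \subseteq W(L)_E$ be the subring generated by $W(\mathfrak{o}_L)_E$ and the Teichmüller elements $[x]$, $x \in L$, and let $B_{L,E} = A_{L,E} \otimes_{\mathfrak{o}_E} E$. Every element of $B_{L,E}$ has a unique $\varpi$-adically convergent expansion $\sum_{n \in \mathbb{Z}} \varpi^n [x_n]$ with $x_n \in L$ bounded and $x_n = 0$ for all sufficiently small $n$; for $t > 0$ put $$\lambda_t\Big(\sum_{n} \varpi^n [x_n]\Big) = \max_n \, p^{-n} |x_n|^t .$$ For a closed interval $I = [s,r]$ with $0 < s \le r < \infty$, let the extended Robba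 ring $B^I_{L,E}$ be the completion of $B_{L,E}$ with respect to the norm $\lambda_I = \max(\lambda_s, \lambda_r)$, regarded as a Banach ring with the norm $\lambda_I$. For a commutative nonarchimedean Banach ring $A$ and $\rho_1,\dots,\rho_n > 0$, let $A\{T_1/\rho_1,\dots,T_n/\rho_n\}$ be the ring of formal power series $\sum c_{i_1,\dots,i_n} T_1^{i_1}\cdots T_n^{i_n}$ over $A$ with $|c_{i_1,\dots,i_n}|\, \rho_1^{i_1}\cdots\rho_n^{i_n} \to 0$ as $i_1+\cdots+i_n \to \infty$. Then for every integer $n \ge 0$ and all real $\rho_1,\dots,\rho_n > 0$, the ring $B^I_{L,E}\{T_1/\rho_1,\dots,T_n/\rho_n\}$ is noetherian. In particular, $B^I_{L,E}$ is strongly noetherian: $B^I_{L,E}\{T_1,\dots,T_n\}$ is noetherian for every $n \ge 0$. -/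

import Mathlib

noncomputable section
namespace ExtRobba
open IsLocalRing TensorProduct
open scoped NNReal
set_option linter.unusedSectionVars false

section Lift
variable (p : ℕ) [hp : Fact p.Prime] (O : Type*) [CommRing O] [IsDomain O]
  [IsDiscreteValuationRing O] [IsAdicComplete (maximalIdeal O) O]
  [Finite (ResidueField O)] [CharP (ResidueField O) p]

theorem natCast_mem : (p : O) ∈ maximalIdeal O := by
  rw [← residue_eq_zero_iff, map_natCast]
  exact CharP.cast_eq_zero _ p

theorem p_cases : (p : O) = 0 ∨ ∃ e, Ideal.span {(p : O)} = maximalIdeal O ^ (e + 1) := by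
  by_cases h : (p : O) = 0
  · exact Or.inl h
  right
  obtain ⟨e, he⟩ := exists_maximalIdeal_pow_eq_of_principal O
    (IsPrincipalIdealRing.principal _) (Ideal.span {(p : O)}) (by simpa using h)
  obtain _ | e := e
  · have h1 := natCast_mem p O
    have : (1 : O) ∈ Ideal.span {(p : O)} := by simp [he]
    exact absurd ((Ideal.span_singleton_le_iff_mem _).2 h1 this)
      ((Ideal.ne_top_iff_one _).1 (maximalIdeal.isMaximal O).ne_top)
  · exact ⟨e, he⟩

theorem isAdicComplete_p : IsAdicComplete (Ideal.span {(p : O)}) O := by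
  rcases p_cases p O with h | ⟨e, he⟩
  · rw [h, Ideal.span_singleton_eq_bot.2 rfl]; infer_instance
  · rw [he]
    refine { haus' := fun x hx => ?_, prec' := fun f hf => ?_ }
    · refine IsHausdorff.haus (I := maximalIdeal O) inferInstance x fun n => ?_
      have := hx n
      simp only [smul_eq_mul, Ideal.mul_top, ← pow_mul] at this ⊢
      exact this.mono (Ideal.pow_le_pow_right (by nlinarith))
    · simp only [smul_eq_mul, Ideal.mul_top, ← pow_mul] at hf ⊢
      obtain ⟨l, hl⟩ := IsPrecomplete.prec (I := maximalIdeal O) inferInstance (f := f)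
        fun {m n} h => by
          simp only [smul_eq_mul, Ideal.mul_top]
          exact (hf h).mono (Ideal.pow_le_pow_right (by nlinarith))
      refine ⟨l, fun n => ?_⟩
      have h1 := hl ((e + 1) * n)
      simp only [smul_eq_mul, Ideal.mul_top] at h1
      exact (hf (show n ≤ (e + 1) * n by nlinarith)).trans h1

theorem exists_wittLift : ∃ φ : WittVector p (ResidueField O) →+* O,
    ∀ x, residue O (φ x) = x.coeff 0 := by
  have : CharP (O ⧸ maximalIdeal O) p := ‹CharP (ResidueField O) p›
  have := isAdicComplete_p p O
  have : Fact (¬ IsUnit (p : O)) := ⟨(mem_maximalIdeal _).1 (natCast_mem p O)⟩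
  let T : ResidueField O →* O := (Perfection.teichmuller p (maximalIdeal O)).comp
    (Perfection.lift p (ResidueField O) (O ⧸ maximalIdeal O) (RingHom.id _) : _ →* _)
  have hT : ∀ x, residue O (T x) = x := fun x => by
    refine (Perfection.mk_teichmuller _).trans ?_
    exact RingHom.congr_fun ((Perfection.lift p (ResidueField O) (O ⧸ maximalIdeal O)).symm_apply_apply (RingHom.id _)) x
  let Q := ModP O p
  let π : O →+* Q := Ideal.Quotient.mk _
  have key : ∀ x y n, ∃ c ∈ maximalIdeal O ^ n, π (T (x + y)) = π (T x) + π (T y) + π c := by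
    intro x y n
    obtain ⟨a, rfl⟩ := (iterateFrobeniusEquiv (ResidueField O) p n).surjective x
    obtain ⟨b, rfl⟩ := (iterateFrobeniusEquiv (ResidueField O) p n).surjective y
    rw [← map_add]
    simp only [iterateFrobeniusEquiv_apply, map_pow, iterateFrobenius_def]
    refine ⟨(T (a + b) - T a - T b) ^ p ^ n, ?_, ?_⟩
    · have : T (a + b) - T a - T b ∈ maximalIdeal O := by
        rw [← residue_eq_zero_iff]; simp [hT]
      exact Ideal.pow_le_pow_right (Nat.lt_pow_self hp.out.one_lt).le (Ideal.pow_mem_pow this _)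
    · rw [map_pow, map_sub, map_sub, sub_pow_char_pow, sub_pow_char_pow]; ring
  have hadd : ∀ x y, π (T (x + y)) = π (T x) + π (T y) := by
    intro x y
    rcases p_cases p O with h | ⟨e, he⟩
    · have : Function.Injective π := by
        rw [injective_iff_map_eq_zero]
        intro a ha
        simpa [h] using Ideal.Quotient.eq_zero_iff_mem.1 ha
      rw [← map_add]
      congr 1
      rw [← sub_eq_zero]
      refine IsHausdorff.haus (I := maximalIdeal O) inferInstance _ fun n => ?_
      obtain ⟨c, hc, hc'⟩ := key x y n
      rw [← map_add, ← map_add] at hc'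
      rw [this hc', SModEq.zero]
      simpa using hc
    · obtain ⟨c, hc, hc'⟩ := key x y (e + 1)
      rw [hc']
      rw [← he] at hc
      rw [show π c = 0 from Ideal.Quotient.eq_zero_iff_mem.2 hc, add_zero]
  let g0 : ResidueField O →+* Q :=
    { toFun := fun x => π (T x)
      map_one' := by simp
      map_mul' := by simp
      map_zero' := by have := hadd 0 0; simpa using this
      map_add' := hadd }
  let g : ResidueField O →+* PreTilt O p := Perfection.lift p (ResidueField O) Q g0
  have hg : ∀ x, PreTilt.coeff 0 (g x) = π (T x) := fun x =>
    RingHom.congr_fun ((Perfection.lift p (ResidueField O) Q).symm_apply_apply g0) x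
  refine ⟨(WittVector.fontaineTheta O p).comp (WittVector.map g), fun x => ?_⟩
  have h1 := WittVector.mk_fontaineTheta (R := O) (p := p) (WittVector.map g x)
  rw [WittVector.map_coeff, hg] at h1
  have h2 := Ideal.Quotient.eq.1 h1
  have h3 : Ideal.span {(p : O)} ≤ maximalIdeal O :=
    (Ideal.span_singleton_le_iff_mem _).2 (natCast_mem p O)
  have h4 := (residue_eq_zero_iff _).2 (h3 h2)
  rw [map_sub, hT, sub_eq_zero] at h4
  exact h4

/-- The canonical ring homomorphism `W(k) → O`, where `k` is the residue field of `O`: the unique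
one that induces the identity on residue fields. -/
def wittLift : WittVector p (ResidueField O) →+* O := (exists_wittLift p O).choose

theorem residue_wittLift (x : WittVector p (ResidueField O)) :
    residue O (wittLift p O x) = x.coeff 0 := (exists_wittLift p O).choose_spec x

instance wittAlgebra : Algebra (WittVector p (ResidueField O)) O := (wittLift p O).toAlgebra

end Lift

section Rings

/-- The valuation ring `𝔬_L` of a nonarchimedean normed field `L`. -/
def unitBall (L : Type*) [NormedField L] [IsUltrametricDist L] : Subring L where
  carrier := {x | ‖x‖ ≤ 1}
  mul_mem' {a b} ha hb := by
    change ‖a * b‖ ≤ 1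
    rw [norm_mul]; exact mul_le_one₀ ha (norm_nonneg _) hb
  one_mem' := by simp
  add_mem' {a b} ha hb := (IsUltrametricDist.norm_add_le_max a b).trans (max_le ha hb)
  zero_mem' := by simp
  neg_mem' {a} ha := by simpa using ha

variable (p : ℕ) [hp : Fact p.Prime] (O : Type*) [CommRing O] [IsDomain O]
  [IsDiscreteValuationRing O] [IsAdicComplete (maximalIdeal O) O]
  [Finite (ResidueField O)] [CharP (ResidueField O) p]
  (L : Type*) [NormedField L] [IsUltrametricDist L] [CharP L p] [PerfectRing L p]
  [Algebra (ResidueField O) L]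

instance wittAlgebraMap : Algebra (WittVector p (ResidueField O)) (WittVector p L) :=
  (WittVector.map (algebraMap (ResidueField O) L)).toAlgebra

/-- The ring `W(L)_E = 𝔬_E ⊗_{W(k)} W(L)`, where `O = 𝔬_E` and `k` is its residue field. -/
abbrev WittE : Type _ := O ⊗[WittVector p (ResidueField O)] WittVector p L

variable {L}

/-- The Teichmüller element `[x]` of `W(L)_E`. -/
def teich (x : L) : WittE p O L := 1 ⊗ₜ WittVector.teichmuller p x

variable (L)

/-- The canonical map `W(𝔬_L) → W(L)_E`. -/
def ballMap : WittVector p (unitBall L) →+* WittE p O L :=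
  (Algebra.TensorProduct.includeRight
    (R := WittVector p (ResidueField O)) (A := O) (B := WittVector p L)).toRingHom.comp
    (WittVector.map (unitBall L).subtype)

/-- The ring `W(𝔬_L)_E`, as the `𝔬_E`-subalgebra of `W(L)_E` generated by `W(𝔬_L)`. -/
def ALo : Subalgebra O (WittE p O L) := Algebra.adjoin O (Set.range (ballMap p O L))

/-- The ring `A_{L,E} = W(𝔬_L)_E[[x] : x ∈ L]`, as a subring of `W(L)_E`. -/
def AL : Subalgebra O (WittE p O L) :=
  Algebra.adjoin O (ALo p O L ∪ Set.range (teich p O (L := L)))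

variable {L}

theorem teich_mem (x : L) : teich p O x ∈ AL p O L :=
  Algebra.subset_adjoin (Or.inr ⟨x, rfl⟩)

/-- The Teichmüller map `L → A_{L,E}`. -/
def T : L →* AL p O L where
  toFun x := ⟨teich p O x, teich_mem p O x⟩
  map_one' := by ext; simp [teich, Algebra.TensorProduct.one_def]
  map_mul' x y := by ext; simp [teich]

theorem T_zero : T p O (0 : L) = 0 := by
  ext; simp [T, teich]

/-- The reduction map `W(L)_E → L`, whose kernel is generated by a uniformizer of `E`. -/
def resW : WittE p O L →+* L :=
  letI : Algebra (WittVector p (ResidueField O)) L :=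
    ((algebraMap (ResidueField O) L).comp WittVector.constantCoeff).toAlgebra
  (Algebra.TensorProduct.lift (R := WittVector p (ResidueField O))
    (S := WittVector p (ResidueField O)) (A := O) (B := WittVector p L) (C := L)
    { ((algebraMap (ResidueField O) L).comp (residue O)) with
      commutes' := fun x => by
        change algebraMap (ResidueField O) L (residue O (wittLift p O x)) = _
        rw [residue_wittLift]; rfl }
    { (WittVector.constantCoeff (p := p) (R := L)) with
      commutes' := fun x => by
        change (WittVector.map (algebraMap (ResidueField O) L) x).coeff 0 = _
        rw [WittVector.map_coeff]; rfl }
    (fun _ _ => Commute.all _ _)).toRingHom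

theorem resW_tmul (o : O) (a : WittVector p L) :
    resW p O (o ⊗ₜ a) = algebraMap (ResidueField O) L (residue O o) * a.coeff 0 := by
  simp only [resW, AlgHom.toRingHom_eq_coe, RingHom.coe_coe, Algebra.TensorProduct.lift_tmul]
  rfl

/-- The reduction map `A_{L,E} → L`. -/
def res : AL p O L →+* L := (resW p O).comp (AL p O L).subtype

theorem res_T (x : L) : res p O (T p O x) = x := by
  simp [res, T, teich, resW_tmul]

variable {O}

theorem res_smul (o : O) (x : AL p O L) :
    res p O (o • x) = algebraMap (ResidueField O) L (residue O o) * res p O x := by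
  have : o • (x : WittE p O L) = (o ⊗ₜ 1 : WittE p O L) * (x : WittE p O L) := by
    rw [Algebra.smul_def]; rfl
  simp only [res, RingHom.comp_apply]
  change resW p O (o • (x : WittE p O L)) = _
  rw [this, map_mul, resW_tmul]
  simp

variable (L)

theorem flat_witt : Module.Flat (WittVector p (ResidueField O)) (WittVector p L) := by
  have : FaithfulSMul (WittVector p (ResidueField O)) (WittVector p L) := by
    rw [faithfulSMul_iff_algebraMap_injective]
    exact WittVector.map_injective _ (algebraMap (ResidueField O) L).injective
  infer_instance

variable {L}

theorem smul_inj {ϖ : O} (hϖ : ϖ ≠ 0) {x y : WittE p O L} (h : ϖ • x = ϖ • y) : x = y := by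
  have := flat_witt p (O := O) L
  let f : O →ₗ[WittVector p (ResidueField O)] O :=
    LinearMap.mulLeft _ ϖ
  have hf : Function.Injective f := mul_right_injective₀ hϖ
  have h2 := Module.Flat.rTensor_preserves_injective_linearMap (M := WittVector p L) f hf
  have h3 : ∀ z : WittE p O L, f.rTensor (WittVector p L) z = ϖ • z := fun z => by
    induction z using TensorProduct.induction_on with
    | zero => simp
    | tmul o a => simp [f, smul_tmul']
    | add a b ha hb => simp [ha, hb]
  apply h2
  rw [h3, h3, h]

theorem norm_algebraMap_le (c : ResidueField O) : ‖algebraMap (ResidueField O) L c‖ ≤ 1 := by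
  by_cases hc : c = 0
  · simp [hc]
  have : Fintype (ResidueField O) := Fintype.ofFinite _
  have h : c ^ (Fintype.card (ResidueField O) - 1) = 1 := FiniteField.pow_card_sub_one_eq_one c hc
  have h2 : ‖algebraMap (ResidueField O) L c‖ ^ (Fintype.card (ResidueField O) - 1) = 1 := by
    rw [← norm_pow, ← map_pow, h, map_one, norm_one]
  have h3 : Fintype.card (ResidueField O) - 1 ≠ 0 := by
    have := Fintype.one_lt_card (α := ResidueField O); omega
  exact ((pow_eq_one_iff_of_nonneg (norm_nonneg _) h3).1 h2).le

variable (L) in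
theorem ball_charP : CharP (unitBall L) p :=
  (RingHom.charP_iff (unitBall L).subtype Subtype.val_injective p).2 inferInstance

variable (L) in
theorem ball_perfect : have := ball_charP p L; PerfectRing (unitBall L) p := by
  have := ball_charP p L
  refine PerfectRing.ofSurjective _ p fun x => ?_
  obtain ⟨y, hy⟩ := (frobeniusEquiv L p).surjective x
  rw [frobeniusEquiv_apply, frobenius_def] at hy
  refine ⟨⟨y, ?_⟩, Subtype.ext hy⟩
  have : ‖y‖ ^ p ≤ 1 := by rw [← norm_pow, hy]; exact x.2
  exact (pow_le_one_iff_of_nonneg (norm_nonneg _) hp.out.ne_zero).1 this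

theorem T_ball (x : unitBall L) :
    (T p O (x : L) : WittE p O L) = ballMap p O L (WittVector.teichmuller p x) := by
  simp [T, teich, ballMap, WittVector.map_teichmuller]

theorem ballMap_mem (a : WittVector p (unitBall L)) : ballMap p O L a ∈ ALo p O L :=
  Algebra.subset_adjoin ⟨a, rfl⟩

theorem ALo_expand {ϖ : O} (hϖ : Irreducible ϖ) {y : WittE p O L} (hy : y ∈ ALo p O L) :
    ∃ c : unitBall L, ∃ z ∈ ALo p O L, y = teich p O (c : L) + ϖ • z := by
  have hdiv : ∀ o : O, residue O o = 0 → ∃ o', o = ϖ * o' := fun o ho => by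
    rw [residue_eq_zero_iff, hϖ.maximalIdeal_eq, Ideal.mem_span_singleton] at ho
    exact ho
  have h0 : ∃ a, ∃ z ∈ ALo p O L, y = ballMap p O L a + ϖ • z := by
    induction hy using Algebra.adjoin_induction with
    | mem x hx =>
      obtain ⟨a, rfl⟩ := hx
      exact ⟨a, 0, zero_mem _, by simp⟩
    | algebraMap o =>
      let c := residue O o
      obtain ⟨o', ho'⟩ := hdiv (o - wittLift p O (WittVector.teichmuller p c)) (by
        rw [map_sub, residue_wittLift, WittVector.teichmuller_coeff_zero, sub_self])
      refine ⟨WittVector.teichmuller p ⟨algebraMap _ L c, norm_algebraMap_le c⟩,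
        algebraMap O _ o', Subalgebra.algebraMap_mem _ _, ?_⟩
      rw [← T_ball]
      have h1 : teich p O (algebraMap _ L c) =
          algebraMap O (WittE p O L) (wittLift p O (WittVector.teichmuller p c)) := by
        rw [teich, Algebra.TensorProduct.algebraMap_apply, ← WittVector.map_teichmuller]
        have h2 : wittLift p O (WittVector.teichmuller p c) = WittVector.teichmuller p c • (1 : O) := by
          rw [Algebra.smul_def, mul_one]; rfl
        change _ = wittLift p O (WittVector.teichmuller p c) ⊗ₜ 1
        rw [h2, TensorProduct.smul_tmul, Algebra.smul_def, mul_one]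
        rfl
      change _ = teich p O (algebraMap _ L c) + _
      rw [h1, Algebra.smul_def, ← map_mul, ← ho', map_sub]; ring
    | add x y _ _ hx hy =>
      obtain ⟨a, z, hz, rfl⟩ := hx
      obtain ⟨b, w, hw, rfl⟩ := hy
      exact ⟨a + b, z + w, add_mem hz hw, by rw [map_add, smul_add]; ring⟩
    | mul x y _ _ hx hy =>
      obtain ⟨a, z, hz, rfl⟩ := hx
      obtain ⟨b, w, hw, rfl⟩ := hy
      refine ⟨a * b, ballMap p O L a * w + z * ballMap p O L b + ϖ • (z * w),
        add_mem (add_mem (mul_mem (ballMap_mem p a) hw) (mul_mem hz (ballMap_mem p b)))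
          (Subalgebra.smul_mem _ (mul_mem hz hw) _), ?_⟩
      rw [map_mul]
      simp only [Algebra.smul_def]; ring
  have := ball_charP p L
  have := ball_perfect p L
  obtain ⟨a, z, hz, rfl⟩ := h0
  obtain ⟨a', ha'⟩ := Ideal.mem_span_singleton.1 ((WittVector.mem_span_p_iff_coeff_zero_eq_zero
    (a - WittVector.teichmuller p (a.coeff 0))).2 (by
      have := (WittVector.constantCoeff (p := p) (R := unitBall L)).map_sub a
        (WittVector.teichmuller p (a.coeff 0))
      exact this.trans (by simp [WittVector.constantCoeff])))
  obtain ⟨v, hv⟩ := hdiv (p : O) (by rw [map_natCast]; exact CharP.cast_eq_zero _ p)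
  refine ⟨a.coeff 0, v • ballMap p O L a' + z,
    add_mem (Subalgebra.smul_mem _ (ballMap_mem p a') _) hz, ?_⟩
  have h1 : ballMap p O L a = teich p O ((a.coeff 0 : unitBall L) : L) + (p : WittE p O L) * ballMap p O L a' := by
    rw [show teich p O ((a.coeff 0 : unitBall L) : L) = _ from T_ball p (a.coeff 0), ← sub_eq_iff_eq_add', ← map_sub, ha', map_mul, map_natCast]
  have h2 : (p : WittE p O L) = algebraMap O _ (ϖ * v) := by rw [← hv, map_natCast]
  rw [h1, h2, smul_add]
  simp only [Algebra.smul_def, map_mul]; ring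

theorem ALo_le : ALo p O L ≤ AL p O L := fun _ hx => Algebra.subset_adjoin (Or.inl hx)


theorem exists_teich_mul {x : WittE p O L} (hx : x ∈ AL p O L) :
    ∃ a : L, a ≠ 0 ∧ ‖a‖ ≤ 1 ∧ teich p O a * x ∈ ALo p O L := by
  have hT : ∀ a : L, ‖a‖ ≤ 1 → teich p O a ∈ ALo p O L := fun a ha => by
    rw [show teich p O a = _ from T_ball p (⟨a, ha⟩ : unitBall L)]
    exact ballMap_mem p _
  have hmul : ∀ a b : L, teich p O (a * b) = teich p O a * teich p O b := fun a b => by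
    simp [teich]
  have hone : teich p O (1 : L) = 1 := by simp [teich, Algebra.TensorProduct.one_def]
  induction hx using Algebra.adjoin_induction with
  | mem x hx =>
    rcases hx with hx | ⟨b, rfl⟩
    · exact ⟨1, one_ne_zero, by simp, by simpa [hone] using hx⟩
    · by_cases hb : ‖b‖ ≤ 1
      · exact ⟨1, one_ne_zero, by simp, by simpa [hone] using hT b hb⟩
      · have hb0 : b ≠ 0 := by rintro rfl; simp at hb
        refine ⟨b⁻¹, inv_ne_zero hb0, ?_, ?_⟩
        · rw [norm_inv]; exact inv_le_one_of_one_le₀ (not_le.1 hb).le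
        · rw [← hmul, inv_mul_cancel₀ hb0, hone]; exact one_mem _
  | algebraMap o =>
    exact ⟨1, one_ne_zero, by simp, by rw [hone, one_mul]; exact Subalgebra.algebraMap_mem _ _⟩
  | add x y _ _ hx hy =>
    obtain ⟨a, ha, ha1, hax⟩ := hx
    obtain ⟨b, hb, hb1, hby⟩ := hy
    refine ⟨a * b, mul_ne_zero ha hb, ?_, ?_⟩
    · rw [norm_mul]; exact mul_le_one₀ ha1 (norm_nonneg _) hb1
    · have : teich p O (a * b) * (x + y) =
          teich p O b * (teich p O a * x) + teich p O a * (teich p O b * y) := by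
        rw [hmul]; ring
      rw [this]
      exact add_mem (mul_mem (hT b hb1) hax) (mul_mem (hT a ha1) hby)
  | mul x y _ _ hx hy =>
    obtain ⟨a, ha, ha1, hax⟩ := hx
    obtain ⟨b, hb, hb1, hby⟩ := hy
    refine ⟨a * b, mul_ne_zero ha hb, ?_, ?_⟩
    · rw [norm_mul]; exact mul_le_one₀ ha1 (norm_nonneg _) hb1
    · have : teich p O (a * b) * (x * y) = (teich p O a * x) * (teich p O b * y) := by
        rw [hmul]; ring
      rw [this]
      exact mul_mem hax hby

variable (O L) in
/-- `W(𝔬_L)_E` as a subring of `A_{L,E}`. -/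
def A0 : Subring (AL p O L) := (ALo p O L).toSubring.comap (AL p O L).val.toRingHom

variable {p}

theorem mem_A0 {x : AL p O L} : x ∈ A0 p O L ↔ (x : WittE p O L) ∈ ALo p O L := Iff.rfl

theorem smul_mem_A0 (o : O) {x : AL p O L} (hx : x ∈ A0 p O L) : o • x ∈ A0 p O L :=
  (ALo p O L).smul_mem hx o

theorem exists_T_mul (x : AL p O L) : ∃ a : L, a ≠ 0 ∧ T p O a * x ∈ A0 p O L := by
  obtain ⟨a, ha, _, h⟩ := exists_teich_mul p x.2
  exact ⟨a, ha, h⟩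

theorem smul_inj' {ϖ : O} (hϖ : ϖ ≠ 0) {x y : AL p O L} (h : ϖ • x = ϖ • y) : x = y :=
  Subtype.ext (smul_inj p hϖ (congrArg Subtype.val h))

theorem res_smul_unif {ϖ : O} (hϖ : Irreducible ϖ) (x : AL p O L) : res p O (ϖ • x) = 0 := by
  rw [res_smul, (residue_eq_zero_iff ϖ).2 ((mem_maximalIdeal _).2 hϖ.not_isUnit)]; simp

theorem A0_expand {ϖ : O} (hϖ : Irreducible ϖ) {y : AL p O L} (hy : y ∈ A0 p O L) :
    ‖res p O y‖ ≤ 1 ∧ ∃ z ∈ A0 p O L, y = T p O (res p O y) + ϖ • z := by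
  obtain ⟨c, z, hz, h⟩ := ALo_expand p hϖ hy
  have h1 : y = T p O (c : L) + ϖ • (⟨z, ALo_le p hz⟩ : AL p O L) := Subtype.ext h
  have h2 : res p O y = c := by
    rw [h1, map_add, res_T, res_smul_unif hϖ, add_zero]
  rw [h2]
  exact ⟨c.2, _, hz, h1⟩

theorem AL_expand {ϖ : O} (hϖ : Irreducible ϖ) (x : AL p O L) :
    ∃ z, x = T p O (res p O x) + ϖ • z := by
  obtain ⟨a, ha, h⟩ := exists_T_mul x
  obtain ⟨-, z, -, hz⟩ := A0_expand hϖ h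
  have hinv : T p O a⁻¹ * T p O a = 1 := by rw [← map_mul, inv_mul_cancel₀ ha, map_one]
  refine ⟨T p O a⁻¹ * z, ?_⟩
  have h1 := congrArg (T p O a⁻¹ * ·) hz
  simp only [← mul_assoc, hinv, one_mul, mul_add, map_mul, res_T] at h1
  rw [mul_smul_comm] at h1
  exact h1

/-- For `x ∈ A_{L,E}`, the element `z ∈ A_{L,E}` with `x = [res x] + ϖ z`. -/
def tail (ϖ : {x : O // Irreducible x}) (x : AL p O L) : AL p O L := (AL_expand ϖ.2 x).choose

theorem tail_spec (ϖ : {x : O // Irreducible x}) (x : AL p O L) :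
    x = T p O (res p O x) + ϖ.1 • tail ϖ x := (AL_expand ϖ.2 x).choose_spec

/-- The coefficients `x_n ∈ L` in the unique expansion `x = ∑_{n ≥ 0} ϖ^n [x_n]` of an element
`x` of `A_{L,E}`. -/
def digit (ϖ : {x : O // Irreducible x}) (x : AL p O L) : ℕ → L
  | 0 => res p O x
  | n + 1 => digit ϖ (tail ϖ x) n

variable (ϖ : {x : O // Irreducible x})

theorem tail_unique {x z : AL p O L} {c : L} (h : x = T p O c + ϖ.1 • z) :
    res p O x = c ∧ tail ϖ x = z := by
  have h1 : res p O x = c := by rw [h, map_add, res_T, res_smul_unif ϖ.2, add_zero]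
  refine ⟨h1, smul_inj' ϖ.2.ne_zero ?_⟩
  have h2 := tail_spec ϖ x
  rw [h1] at h2
  exact add_left_cancel (h2.symm.trans h)

theorem expansion (x : AL p O L) (n : ℕ) :
    ∃ z, x = ∑ i ∈ Finset.range n, ϖ.1 ^ i • T p O (digit ϖ x i) + ϖ.1 ^ n • z := by
  induction n generalizing x with
  | zero => exact ⟨x, by simp⟩
  | succ n ih =>
    obtain ⟨z, hz⟩ := ih (tail ϖ x)
    refine ⟨z, ?_⟩
    rw [Finset.sum_range_succ']
    conv_lhs => rw [tail_spec ϖ x, hz]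
    simp only [digit, smul_add, Finset.smul_sum, smul_smul, pow_succ', pow_zero, one_smul]
    abel

theorem digit_congr {x y z : AL p O L} {n : ℕ} (h : x = y + ϖ.1 ^ (n + 1) • z) :
    ∀ i ≤ n, digit ϖ x i = digit ϖ y i := by
  induction n generalizing x y with
  | zero =>
    intro i hi
    obtain rfl : i = 0 := by omega
    simp only [digit]
    rw [h, map_add, zero_add, pow_one, res_smul_unif ϖ.2, add_zero]
  | succ n ih =>
    have h1 : x = T p O (res p O y) + ϖ.1 • (tail ϖ y + ϖ.1 ^ (n + 1) • z) := by
      rw [h]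
      conv_lhs => rw [tail_spec ϖ y]
      rw [smul_add, smul_smul, ← pow_succ', add_assoc]
    obtain ⟨h2, h3⟩ := tail_unique ϖ h1
    rintro (_ | i) hi
    · exact h2
    · simp only [digit]
      exact ih h3 i (by omega)

/-- Uniqueness of the expansion. -/
theorem digit_unique {x : AL p O L} {c : ℕ → L}
    (h : ∀ n, ∃ z, x = ∑ i ∈ Finset.range n, ϖ.1 ^ i • T p O (c i) + ϖ.1 ^ n • z) (n : ℕ) :
    digit ϖ x n = c n := by
  induction n generalizing x c with
  | zero =>
    obtain ⟨z, hz⟩ := h 1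
    exact (tail_unique ϖ (z := z) (by simpa using hz)).1
  | succ n ih =>
    simp only [digit]
    refine ih (c := fun i => c (i + 1)) fun m => ?_
    obtain ⟨z, hz⟩ := h (m + 1)
    refine ⟨z, (tail_unique ϖ (c := c 0) ?_).2⟩
    rw [hz, Finset.sum_range_succ']
    simp only [smul_add, Finset.smul_sum, smul_smul, pow_succ', pow_zero, one_smul]
    abel

theorem digit_A0 {y : AL p O L} (hy : y ∈ A0 p O L) (n : ℕ) : ‖digit ϖ y n‖ ≤ 1 := by
  induction n generalizing y with
  | zero => exact (A0_expand ϖ.2 hy).1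
  | succ n ih =>
    obtain ⟨-, z, hz, h⟩ := A0_expand ϖ.2 hy
    rw [digit, (tail_unique ϖ h).2]
    exact ih hz

theorem digit_T_mul (a : L) (x : AL p O L) (n : ℕ) :
    digit ϖ (T p O a * x) n = a * digit ϖ x n := by
  induction n generalizing x with
  | zero => simp [digit, res_T]
  | succ n ih =>
    have h : T p O a * x = T p O (a * res p O x) + ϖ.1 • (T p O a * tail ϖ x) := by
      conv_lhs => rw [tail_spec ϖ x]
      rw [mul_add, map_mul, mul_smul_comm]
    rw [digit, (tail_unique ϖ h).2, ih, digit]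

theorem digit_smul_pow (m : ℕ) (x : AL p O L) (n : ℕ) :
    digit ϖ (ϖ.1 ^ m • x) n = if n < m then 0 else digit ϖ x (n - m) := by
  induction m generalizing n with
  | zero => simp
  | succ m ih =>
    have h : ϖ.1 ^ (m + 1) • x = T p O 0 + ϖ.1 • (ϖ.1 ^ m • x) := by
      rw [T_zero, zero_add, smul_smul, pow_succ']
    obtain ⟨h1, h2⟩ := tail_unique ϖ h
    cases n with
    | zero => simp [digit, h1]
    | succ n => rw [digit, h2, ih]; simp

theorem digit_zero (n : ℕ) : digit ϖ (0 : AL p O L) n = 0 := by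
  have := digit_T_mul ϖ (0 : L) 0 n
  rwa [mul_zero, zero_mul] at this

theorem T_mem_A0 {a : L} (ha : ‖a‖ ≤ 1) : T p O a ∈ A0 p O L := by
  rw [mem_A0, T_ball p (⟨a, ha⟩ : unitBall L)]
  exact ballMap_mem p _

theorem exists_A0_of_digit_le {a : L} (ha : a ≠ 0) {x : AL p O L} {n : ℕ}
    (h : ∀ i ≤ n, ‖digit ϖ x i‖ ≤ ‖a‖) :
    ∃ y ∈ A0 p O L, ∃ z, T p O a⁻¹ * x = y + ϖ.1 ^ (n + 1) • z := by
  obtain ⟨z, hz⟩ := expansion ϖ (T p O a⁻¹ * x) (n + 1)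
  refine ⟨_, sum_mem fun i hi => smul_mem_A0 _ (T_mem_A0 ?_), z, hz⟩
  rw [digit_T_mul, norm_mul, norm_inv, inv_mul_le_one₀ (norm_pos_iff.2 ha)]
  exact h i (by simpa [Nat.lt_succ_iff] using hi)

/-- The key estimate on the coefficients of a difference. -/
theorem digit_sub_le (x y : AL p O L) (n : ℕ) :
    ∃ i ≤ n, ‖digit ϖ (x - y) n‖ ≤ max ‖digit ϖ x i‖ ‖digit ϖ y i‖ := by
  obtain ⟨i, hi, hmax⟩ := Finset.exists_max_image (Finset.range (n + 1))
    (fun i => max ‖digit ϖ x i‖ ‖digit ϖ y i‖) ⟨0, by simp⟩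
  have hi' : i ≤ n := by simpa [Nat.lt_succ_iff] using hi
  have hmax' : ∀ j ≤ n, max ‖digit ϖ x j‖ ‖digit ϖ y j‖ ≤
      max ‖digit ϖ x i‖ ‖digit ϖ y i‖ := fun j hj =>
    hmax j (by simpa [Nat.lt_succ_iff] using hj)
  refine ⟨i, hi', ?_⟩
  obtain ⟨a, ha⟩ : ∃ a : L, ‖a‖ = max ‖digit ϖ x i‖ ‖digit ϖ y i‖ := by
    rcases max_choice ‖digit ϖ x i‖ ‖digit ϖ y i‖ with h | h
    · exact ⟨_, h.symm⟩
    · exact ⟨_, h.symm⟩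
  rw [← ha] at hmax' ⊢
  by_cases ha0 : a = 0
  · subst ha0
    have hx0 : ∀ j ≤ n, digit ϖ x j = 0 := fun j hj => by
      have := (le_max_left _ _).trans (hmax' j hj)
      simpa using this
    have hy0 : ∀ j ≤ n, digit ϖ y j = 0 := fun j hj => by
      have := (le_max_right _ _).trans (hmax' j hj)
      simpa using this
    obtain ⟨z, hz⟩ := expansion ϖ x (n + 1)
    obtain ⟨w, hw⟩ := expansion ϖ y (n + 1)
    rw [Finset.sum_eq_zero fun j hj => by
      rw [hx0 j (by simpa [Nat.lt_succ_iff] using hj), T_zero, smul_zero]] at hz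
    rw [Finset.sum_eq_zero fun j hj => by
      rw [hy0 j (by simpa [Nat.lt_succ_iff] using hj), T_zero, smul_zero]] at hw
    have h : x - y = 0 + ϖ.1 ^ (n + 1) • (z - w) := by
      rw [hz, hw, smul_sub]; abel
    rw [digit_congr ϖ h n le_rfl, digit_zero]
  · obtain ⟨u, hu, z, hz⟩ := exists_A0_of_digit_le ϖ ha0
      fun j hj => (le_max_left _ _).trans (hmax' j hj)
    obtain ⟨v, hv, w, hw⟩ := exists_A0_of_digit_le ϖ ha0
      fun j hj => (le_max_right _ _).trans (hmax' j hj)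
    have h : T p O a⁻¹ * (x - y) = (u - v) + ϖ.1 ^ (n + 1) • (z - w) := by
      rw [mul_sub, hz, hw, smul_sub]; abel
    have h1 := digit_A0 ϖ (sub_mem hu hv) n
    rw [← digit_congr ϖ h n le_rfl, digit_T_mul, norm_mul, norm_inv,
      inv_mul_le_one₀ (norm_pos_iff.2 ha0)] at h1
    exact h1

theorem digit_neg_le (x : AL p O L) (n : ℕ) :
    ∃ i ≤ n, ‖digit ϖ (-x) n‖ ≤ ‖digit ϖ x i‖ := by
  obtain ⟨i, hi, h⟩ := digit_sub_le ϖ 0 x n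
  refine ⟨i, hi, ?_⟩
  rwa [zero_sub, digit_zero, norm_zero, max_eq_right (norm_nonneg _)] at h

theorem digit_add_le (x y : AL p O L) (n : ℕ) :
    ∃ i ≤ n, ‖digit ϖ (x + y) n‖ ≤ ‖digit ϖ x i‖ ∨ ‖digit ϖ (x + y) n‖ ≤ ‖digit ϖ y i‖ := by
  obtain ⟨i, hi, h⟩ := digit_sub_le ϖ x (-y) n
  rw [sub_neg_eq_add] at h
  rcases le_max_iff.1 h with h | h
  · exact ⟨i, hi, Or.inl h⟩
  · obtain ⟨j, hj, h'⟩ := digit_neg_le ϖ y i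
    exact ⟨j, hj.trans hi, Or.inr (h.trans h')⟩

theorem digit_sum_le {ι : Type*} (s : Finset ι) (f : ι → AL p O L) (n : ℕ) :
    digit ϖ (∑ i ∈ s, f i) n = 0 ∨
      ∃ i ∈ s, ∃ j ≤ n, ‖digit ϖ (∑ i ∈ s, f i) n‖ ≤ ‖digit ϖ (f i) j‖ := by
  classical
  induction s using Finset.induction_on generalizing n with
  | empty => left; simp [digit_zero]
  | insert a s ha ih =>
    rw [Finset.sum_insert ha]
    obtain ⟨j, hj, h | h⟩ := digit_add_le ϖ (f a) (∑ i ∈ s, f i) n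
    · exact Or.inr ⟨a, by simp, j, hj, h⟩
    · rcases ih j with h' | ⟨i, hi, k, hk, h'⟩
      · left
        rwa [h', norm_zero, norm_le_zero_iff] at h
      · exact Or.inr ⟨i, by simp [hi], k, hk.trans hj, h.trans h'⟩

theorem digit_mul_le (x y : AL p O L) (n : ℕ) :
    digit ϖ (x * y) n = 0 ∨
      ∃ i j, i + j ≤ n ∧ ‖digit ϖ (x * y) n‖ ≤ ‖digit ϖ x i‖ * ‖digit ϖ y j‖ := by
  obtain ⟨z, hz⟩ := expansion ϖ x (n + 1)
  have h : x * y = ∑ i ∈ Finset.range (n + 1), ϖ.1 ^ i • (T p O (digit ϖ x i) * y) +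
      ϖ.1 ^ (n + 1) • (z * y) := by
    conv_lhs => rw [hz]
    rw [add_mul, Finset.sum_mul]
    simp only [smul_mul_assoc]
  rw [digit_congr ϖ h n le_rfl]
  rcases digit_sum_le ϖ (Finset.range (n + 1))
    (fun i => ϖ.1 ^ i • (T p O (digit ϖ x i) * y)) n with h' | ⟨i, _, j, hj, h'⟩
  · exact Or.inl h'
  · rw [digit_smul_pow] at h'
    split_ifs at h' with hij
    · left; rwa [norm_zero, norm_le_zero_iff] at h'
    · right
      refine ⟨i, j - i, by omega, ?_⟩
      rwa [digit_T_mul, norm_mul] at h'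

theorem digit_bounded (x : AL p O L) : ∃ C, ∀ n, ‖digit ϖ x n‖ ≤ C := by
  obtain ⟨a, ha, h⟩ := exists_T_mul x
  refine ⟨‖a‖⁻¹, fun n => ?_⟩
  have := digit_A0 ϖ h n
  rw [digit_T_mul, norm_mul] at this
  rwa [← one_div, le_div_iff₀' (norm_pos_iff.2 ha)]

end Rings

section Norms

variable (p : ℕ) [hp : Fact p.Prime] (O : Type*) [CommRing O] [IsDomain O]
  [IsDiscreteValuationRing O] [IsAdicComplete (maximalIdeal O) O]
  [Finite (ResidueField O)] [CharP (ResidueField O) p]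
  (E : Type*) [Field E] [Algebra O E] [IsFractionRing O E]
  (L : Type*) [NormedField L] [IsUltrametricDist L] [CharP L p] [PerfectRing L p]
  [Algebra (ResidueField O) L]

/-- The ring `B_{L,E} = A_{L,E} ⊗_{𝔬_E} E`. -/
abbrev BL : Type _ := E ⊗[O] AL p O L

variable {p O E L}

theorem BL_clear (ϖ : {x : O // Irreducible x}) (z : BL p O E L) :
    ∃ (m : ℕ) (a : AL p O L), ϖ.1 ^ m • z = (1 : E) ⊗ₜ a := by
  induction z using TensorProduct.induction_on with
  | zero => exact ⟨0, 0, by simp⟩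
  | tmul e a =>
    obtain ⟨n, d, hd, rfl⟩ := IsFractionRing.div_surjective (A := O) e
    have hd0 : d ≠ 0 := nonZeroDivisors.ne_zero hd
    obtain ⟨m, u, rfl⟩ := IsDiscreteValuationRing.eq_unit_mul_pow_irreducible hd0 ϖ.2
    refine ⟨m, ((u⁻¹ : Oˣ) * n : O) • a, ?_⟩
    rw [← smul_tmul, smul_tmul']
    congr 1
    have h0 : algebraMap O E (u * ϖ.1 ^ m) ≠ 0 := by
      simpa using (map_ne_zero_iff _ (IsFractionRing.injective O E)).2 hd0
    rw [Algebra.smul_def, Algebra.smul_def, mul_one, ← mul_div_assoc, div_eq_iff h0, ← map_mul,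
      ← map_mul]
    congr 1
    calc ϖ.1 ^ m * n = (u⁻¹ * u : Oˣ) * n * ϖ.1 ^ m := by simp; ring
      _ = _ := by push_cast; ring
  | add z w hz hw =>
    obtain ⟨m, a, ha⟩ := hz
    obtain ⟨n, b, hb⟩ := hw
    refine ⟨m + n, ϖ.1 ^ n • a + ϖ.1 ^ m • b, ?_⟩
    rw [tmul_add, tmul_smul, tmul_smul, ← ha, ← hb, smul_add, smul_smul, smul_smul, pow_add,
      mul_comm]

theorem one_tmul_inj {a b : AL p O L} (h : (1 : E) ⊗ₜ[O] a = (1 : E) ⊗ₜ[O] b) : a = b := by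
  have : Module.IsTorsionFree O (AL p O L) := by
    refine ⟨fun r hr x y h => smul_inj' hr.ne_zero h⟩
  have h1 := Module.Flat.rTensor_preserves_injective_linearMap (M := AL p O L)
    (Algebra.linearMap O E) (IsFractionRing.injective O E)
  have h2 : (1 : O) ⊗ₜ[O] a = (1 : O) ⊗ₜ[O] b := h1 (by simpa using h)
  simpa using congrArg (TensorProduct.lid O _) h2

variable (ϖ : {x : O // Irreducible x})

theorem digit_shift {z : BL p O E L} {m k : ℕ} {a b : AL p O L}
    (h : ϖ.1 ^ m • z = (1 : E) ⊗ₜ a) (h' : ϖ.1 ^ k • z = (1 : E) ⊗ₜ b) (n : ℤ) :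
    (if 0 ≤ n + k then digit ϖ b (n + k).toNat else 0) =
      if 0 ≤ n + m then digit ϖ a (n + m).toNat else 0 := by
  have hab : ϖ.1 ^ m • b = ϖ.1 ^ k • a := by
    apply one_tmul_inj (E := E)
    rw [tmul_smul, tmul_smul, ← h, ← h', smul_smul, smul_smul, mul_comm]
  have hd := congrArg (digit ϖ · (n + k + m).toNat) hab
  simp only [digit_smul_pow] at hd
  by_cases hk : 0 ≤ n + k <;> by_cases hm : 0 ≤ n + m
  · rw [if_neg (by omega), if_neg (by omega)] at hd
    rw [if_pos hk, if_pos hm]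
    convert hd using 2 <;> omega
  · rw [if_pos hk, if_neg hm]
    by_cases hj : (0 : ℤ) ≤ n + k + m
    · rw [if_neg (by omega), if_pos (by omega)] at hd
      rw [← hd]; congr 1; omega
    · omega
  · rw [if_neg hk, if_pos hm]
    rw [if_pos (by omega), if_neg (by omega)] at hd
    rw [hd]; congr 1; omega
  · rw [if_neg hk, if_neg hm]

/-- The coefficients `x_n ∈ L`, `n ∈ ℤ`, in the unique expansion `z = ∑_{n ∈ ℤ} ϖ^n [x_n]` of an
element `z` of `B_{L,E}`: if `ϖ^m z` belongs to `A_{L,E}`, they are the coefficients of `ϖ^m z`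
shifted by `m`. -/
def coeffB (z : BL p O E L) (n : ℤ) : L :=
  if 0 ≤ n + (BL_clear ϖ z).choose then
    digit ϖ (BL_clear ϖ z).choose_spec.choose (n + (BL_clear ϖ z).choose).toNat
  else 0

theorem coeffB_eq {z : BL p O E L} {m : ℕ} {a : AL p O L} (h : ϖ.1 ^ m • z = (1 : E) ⊗ₜ a)
    (n : ℤ) : coeffB ϖ z n = if 0 ≤ n + m then digit ϖ a (n + m).toNat else 0 :=
  digit_shift ϖ h (BL_clear ϖ z).choose_spec.choose_spec n

open Classical in
variable (p) in
/-- The value `p^{-n} |x|^t` of `λ_t` on `ϖ^n [x]`, with the convention `0^t = 0` even for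
`t = 0`. -/
def gaussTerm (t : ℝ≥0) (n : ℤ) (x : L) : ℝ :=
  if x = 0 then 0 else (p : ℝ) ^ (-n) * ‖x‖ ^ (t : ℝ)

theorem p_pos : 0 < (p : ℝ) := Nat.cast_pos.2 hp.out.pos

theorem one_le_p : 1 ≤ (p : ℝ) := Nat.one_le_cast.2 hp.out.one_le

theorem gaussTerm_nonneg (t : ℝ≥0) (n : ℤ) (x : L) : 0 ≤ gaussTerm p t n x := by
  unfold gaussTerm
  split_ifs
  · rfl
  · have := p_pos (p := p); positivity

theorem gaussTerm_zero (t : ℝ≥0) (n : ℤ) : gaussTerm p t n (0 : L) = 0 := if_pos rfl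

theorem gaussTerm_mono (t : ℝ≥0) {m n : ℤ} {x y : L} (hmn : m ≤ n) (h : ‖x‖ ≤ ‖y‖) :
    gaussTerm p t n x ≤ gaussTerm p t m y := by
  by_cases hx : x = 0
  · rw [hx, gaussTerm_zero]; exact gaussTerm_nonneg _ _ _
  have hy : y ≠ 0 := by
    rintro rfl
    rw [norm_zero, norm_le_zero_iff] at h
    exact hx h
  rw [gaussTerm, gaussTerm, if_neg hx, if_neg hy]
  have := p_pos (p := p)
  exact mul_le_mul (zpow_le_zpow_right₀ one_le_p (by omega))
    (Real.rpow_le_rpow (norm_nonneg _) h t.2) (by positivity) (by positivity)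

theorem gaussTerm_mul (t : ℝ≥0) (m n : ℤ) (x y : L) :
    gaussTerm p t (m + n) (x * y) = gaussTerm p t m x * gaussTerm p t n y := by
  by_cases hx : x = 0
  · simp [hx, gaussTerm_zero]
  by_cases hy : y = 0
  · simp [hy, gaussTerm_zero]
  rw [gaussTerm, gaussTerm, gaussTerm, if_neg hx, if_neg hy, if_neg (mul_ne_zero hx hy), norm_mul,
    Real.mul_rpow (norm_nonneg _) (norm_nonneg _), neg_add, zpow_add₀ p_pos.ne']
  ring

/-- The Gauss norm `λ_t(∑ ϖ^n [x_n]) = max_n p^{-n} |x_n|^t` on `B_{L,E}`. -/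
def gaussNorm (t : ℝ≥0) (z : BL p O E L) : ℝ := ⨆ n : ℤ, gaussTerm p t n (coeffB ϖ z n)

theorem gauss_bdd (t : ℝ≥0) (z : BL p O E L) :
    BddAbove (Set.range fun n : ℤ => gaussTerm p t n (coeffB ϖ z n)) := by
  obtain ⟨m, a, h⟩ := BL_clear ϖ z
  obtain ⟨C, hC⟩ := digit_bounded ϖ a
  have := p_pos (p := p)
  have hC0 : 0 ≤ C := (norm_nonneg _).trans (hC 0)
  refine ⟨(p : ℝ) ^ (m : ℤ) * C ^ (t : ℝ), ?_⟩
  rintro _ ⟨n, rfl⟩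
  simp only [coeffB_eq ϖ h]
  split_ifs with hn
  · unfold gaussTerm
    split_ifs
    · positivity
    · exact mul_le_mul (zpow_le_zpow_right₀ one_le_p (by omega))
        (Real.rpow_le_rpow (norm_nonneg _) (hC _) t.2) (by positivity) (by positivity)
  · rw [gaussTerm_zero]; positivity

theorem gaussNorm_nonneg (t : ℝ≥0) (z : BL p O E L) : 0 ≤ gaussNorm ϖ t z :=
  Real.iSup_nonneg fun _ => gaussTerm_nonneg _ _ _

theorem digit_le_gaussNorm (t : ℝ≥0) {z : BL p O E L} {m : ℕ} {a : AL p O L}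
    (h : ϖ.1 ^ m • z = (1 : E) ⊗ₜ a) (j : ℕ) :
    gaussTerm p t (j - m) (digit ϖ a j) ≤ gaussNorm ϖ t z := by
  have h1 : gaussTerm p t (j - m) (coeffB ϖ z (j - m)) ≤ gaussNorm ϖ t z :=
    le_ciSup (gauss_bdd ϖ t z) (j - m)
  rwa [coeffB_eq ϖ h, if_pos (by omega), show ((j : ℤ) - m + m).toNat = j by omega] at h1

theorem gaussNorm_le {t : ℝ≥0} {z : BL p O E L} {m : ℕ} {a : AL p O L}
    (h : ϖ.1 ^ m • z = (1 : E) ⊗ₜ a) {C : ℝ} (hC : 0 ≤ C)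
    (hz : ∀ j : ℕ, gaussTerm p t (j - m) (digit ϖ a j) ≤ C) : gaussNorm ϖ t z ≤ C := by
  refine ciSup_le fun n => ?_
  rw [coeffB_eq ϖ h]
  split_ifs with hn
  · have := hz (n + m).toNat
    rwa [show (((n + m).toNat : ℤ) - m) = n by omega] at this
  · rwa [gaussTerm_zero]

theorem gaussNorm_zero (t : ℝ≥0) : gaussNorm ϖ t (0 : BL p O E L) = 0 := by
  refine le_antisymm (gaussNorm_le ϖ (m := 0) (a := 0) (by simp) le_rfl fun j => ?_)
    (gaussNorm_nonneg _ _ _)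
  rw [digit_zero, gaussTerm_zero]

theorem gaussNorm_neg_le (t : ℝ≥0) (z : BL p O E L) : gaussNorm ϖ t (-z) ≤ gaussNorm ϖ t z := by
  obtain ⟨m, a, h⟩ := BL_clear ϖ z
  refine gaussNorm_le ϖ (m := m) (a := -a) (by rw [smul_neg, h, tmul_neg])
    (gaussNorm_nonneg _ _ _) fun j => ?_
  obtain ⟨i, hi, h1⟩ := digit_neg_le ϖ a j
  exact (gaussTerm_mono t (by omega) h1).trans (digit_le_gaussNorm ϖ t h i)

theorem gaussNorm_neg (t : ℝ≥0) (z : BL p O E L) : gaussNorm ϖ t (-z) = gaussNorm ϖ t z :=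
  le_antisymm (gaussNorm_neg_le ϖ t z) (by simpa using gaussNorm_neg_le ϖ t (-z))

theorem gaussNorm_add (t : ℝ≥0) (z w : BL p O E L) :
    gaussNorm ϖ t (z + w) ≤ max (gaussNorm ϖ t z) (gaussNorm ϖ t w) := by
  obtain ⟨m, a, h⟩ := BL_clear ϖ z
  obtain ⟨n, b, h'⟩ := BL_clear ϖ w
  have hz : ϖ.1 ^ (n + m) • z = (1 : E) ⊗ₜ (ϖ.1 ^ n • a) := by
    rw [tmul_smul, ← h, smul_smul, pow_add]
  have hw : ϖ.1 ^ (n + m) • w = (1 : E) ⊗ₜ (ϖ.1 ^ m • b) := by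
    rw [tmul_smul, ← h', smul_smul, add_comm, pow_add]
  refine gaussNorm_le ϖ (m := n + m) (by rw [smul_add, hz, hw, ← tmul_add])
    (le_max_of_le_left (gaussNorm_nonneg _ _ _)) fun j => ?_
  obtain ⟨i, hi, h1 | h1⟩ := digit_add_le ϖ (ϖ.1 ^ n • a) (ϖ.1 ^ m • b) j
  · exact le_max_of_le_left ((gaussTerm_mono t (by omega) h1).trans (digit_le_gaussNorm ϖ t hz i))
  · exact le_max_of_le_right ((gaussTerm_mono t (by omega) h1).trans (digit_le_gaussNorm ϖ t hw i))

theorem gaussNorm_mul (t : ℝ≥0) (z w : BL p O E L) :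
    gaussNorm ϖ t (z * w) ≤ gaussNorm ϖ t z * gaussNorm ϖ t w := by
  obtain ⟨m, a, h⟩ := BL_clear ϖ z
  obtain ⟨n, b, h'⟩ := BL_clear ϖ w
  refine gaussNorm_le ϖ (m := m + n) (a := a * b) ?_
    (mul_nonneg (gaussNorm_nonneg _ _ _) (gaussNorm_nonneg _ _ _)) fun j => ?_
  · have := congrArg₂ (· * ·) h h'
    simp only [Algebra.TensorProduct.tmul_mul_tmul, mul_one] at this
    rw [← this, smul_mul_smul_comm, pow_add]
  · rcases digit_mul_le ϖ a b j with h1 | ⟨i, k, hik, h1⟩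
    · rw [h1, gaussTerm_zero]
      exact mul_nonneg (gaussNorm_nonneg _ _ _) (gaussNorm_nonneg _ _ _)
    · rw [← norm_mul] at h1
      refine (gaussTerm_mono t (m := (i - m) + (k - n)) (by push_cast; omega) h1).trans ?_
      rw [gaussTerm_mul]
      exact mul_le_mul (digit_le_gaussNorm ϖ t h i) (digit_le_gaussNorm ϖ t h' k)
        (gaussTerm_nonneg _ _ _) (gaussNorm_nonneg _ _ _)

/-- The norm `λ_I = max (λ_s, λ_r)` on `B_{L,E}`, where `I = [s, r]`. -/
def gaussNormI (s r : ℝ≥0) (z : BL p O E L) : ℝ := max (gaussNorm ϖ s z) (gaussNorm ϖ r z)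

theorem gaussNormI_add_max (s r : ℝ≥0) (z w : BL p O E L) :
    gaussNormI ϖ s r (z + w) ≤ max (gaussNormI ϖ s r z) (gaussNormI ϖ s r w) := by
  refine max_le ((gaussNorm_add ϖ s z w).trans ?_) ((gaussNorm_add ϖ r z w).trans ?_)
  · exact max_le_max (le_max_left _ _) (le_max_left _ _)
  · exact max_le_max (le_max_right _ _) (le_max_right _ _)

/-- `λ_I` as a (submultiplicative) seminorm of rings. -/
def seminormI (s r : ℝ≥0) : RingSeminorm (BL p O E L) where
  toFun := gaussNormI ϖ s r
  map_zero' := by simp [gaussNormI, gaussNorm_zero]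
  add_le' z w := (gaussNormI_add_max ϖ s r z w).trans
    (max_le_add_of_nonneg (le_max_of_le_left (gaussNorm_nonneg _ _ _))
      (le_max_of_le_left (gaussNorm_nonneg _ _ _)))
  neg' z := by simp [gaussNormI, gaussNorm_neg]
  mul_le' z w := by
    have h1 := gaussNorm_nonneg ϖ s z
    have h2 := gaussNorm_nonneg ϖ r z
    have h3 := gaussNorm_nonneg ϖ s w
    have h4 := gaussNorm_nonneg ϖ r w
    refine max_le ((gaussNorm_mul ϖ s z w).trans ?_) ((gaussNorm_mul ϖ r z w).trans ?_)
    · exact mul_le_mul (le_max_left _ _) (le_max_left _ _) h3 (h1.trans (le_max_left _ _))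
    · exact mul_le_mul (le_max_right _ _) (le_max_right _ _) h4 (h1.trans (le_max_left _ _))

variable (p E L) in
/-- The ring `B_{L,E}`, to be equipped with the norm `λ_I` for `I = [s, r]`. -/
@[nolint unusedArguments]
def NormedBL (_ : {x : O // Irreducible x}) (_ _ : ℝ≥0) : Type _ := BL p O E L

instance (s r : ℝ≥0) : CommRing (NormedBL p E L ϖ s r) :=
  inferInstanceAs (CommRing (BL p O E L))

/-- `B_{L,E}` with the norm `λ_I`. -/
instance (s r : ℝ≥0) : SeminormedCommRing (NormedBL p E L ϖ s r) :=
  { RingSeminorm.toSeminormedRing (R := NormedBL p E L ϖ s r)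
      (seminormI (p := p) (E := E) (L := L) ϖ s r) with
    mul_comm := mul_comm }

theorem norm_NormedBL (s r : ℝ≥0) (z : BL p O E L) :
    ‖(show NormedBL p E L ϖ s r from z)‖ = max (gaussNorm ϖ s z) (gaussNorm ϖ r z) := rfl

instance (s r : ℝ≥0) : IsUltrametricDist (NormedBL p E L ϖ s r) :=
  IsUltrametricDist.isUltrametricDist_of_forall_norm_add_le_max_norm
    (S' := NormedBL p E L ϖ s r) (gaussNormI_add_max (p := p) (E := E) (L := L) ϖ s r)

variable (p E L) in
/-- The extended Robba ring `B^I_{L,E}` for `I = [s, r]`: the completion of `B_{L,E}` with respect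
to the norm `λ_I`. -/
abbrev BI (s r : ℝ≥0) : Type _ := UniformSpace.Completion (NormedBL p E L ϖ s r)

instance (s r : ℝ≥0) : IsUltrametricDist (BI p E L ϖ s r) where
  dist_triangle_max x y z := by
    induction x, y, z using UniformSpace.Completion.induction_on₃ with
    | hp =>
      exact isClosed_le (by fun_prop) (by fun_prop)
    | ih x y z =>
      simp only [UniformSpace.Completion.dist_eq]
      exact IsUltrametricDist.dist_triangle_max x y z

end Norms

/-- The weighted Tate algebra `A{T_1/ρ_1, …, T_n/ρ_n}`: the ring of formal power series
`∑ c_i T^i` over `A` with `|c_i| ρ^i → 0`. -/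
abbrev TateAlgebra (A : Type*) [NormedCommRing A] [IsUltrametricDist A] {n : ℕ}
    (ρ : Fin n → ℝ) : Type _ := MvPowerSeries.IsRestricted.subring (R := A) ρ

/-- A nonarchimedean Banach ring `A` is strongly noetherian if `A{T_1, …, T_n}` is noetherian
for all `n ≥ 0`. -/
def IsStronglyNoetherian (A : Type*) [NormedCommRing A] [IsUltrametricDist A] : Prop :=
  ∀ n : ℕ, IsNoetherianRing (TateAlgebra A (fun _ : Fin n => (1 : ℝ)))

end ExtRobba

end

/-! ### Terms, bounds on their coefficients, and the groups they generate -/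

noncomputable section

open Filter Topology

/-! For the norm attached to `λ_t`, the term `[x] ϖ^k T^i` has size `p^{-k} |x|^t ρ^i`. With `v = k
log p - log ρ^i`, this is at most `c^t` exactly when `|x| ≤ c exp(v / t)`. So each norm corresponds
to a slope `β = 1/t`, and the balls of `λ_I` correspond to the bounds `c min(exp(v/r), exp(v/s))`.
The task is to find, for an ideal `J`, finitely many `F_k ∈ J` such that every `h ∈ J` within a
bound `l₁ exp(a v) ⊓ l₂ exp(d v)`, where `a = 1/r` and `d = 1/s`, becomes bounded by half of it
after subtracting a combination of the `F_k` with coefficients at most `D` times the bound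
(`Reduces`). Successive approximation in the complete ring then gives `J = (F_k)`.

For a single slope this is Gröbner theory (`exists_division`). Up to a small error an element has
finitely many terms of maximal size. Their coefficients lie in the field `L`, and the leading
monomials, taken together with a degree bound, are well-quasi-ordered by a version of Dickson's
lemma. Teichmüller representatives are not additive, but the carries contain additional factors `ϖ`
and are smaller by a fixed factor, so they join the remainder.

For two slopes the difficulty is that a remainder that is small on one line need not be small on the
other. Division at slope `β` can be arranged to keep the quotients small on one chosen side of a
point of the `v`-axis. Dividing from both sides gives two systems of quotients whose difference is
an approximate relation between the `F_k`. These relations are again approximately finitely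
generated, by division in a free module (`exists_relations`). Hence the difference can be cut at a
point and its pieces distributed over the two sides, as in a Mayer-Vietoris argument. This yields
division with quotients supported near a window (`exists_local_division`), and from it a procedure
for gluing reductions that are good on either side of a point (`exists_glue`).

Gluing shows that `Reduces` holds for any two sufficiently near slopes (`exists_reduces_near`) and
that adjacent intervals of slopes can be joined (`Reduces.trans`). A supremum argument then covers
`[1/r, 1/s]` (`reduces`). The remainder of the proof checks that expansions in the Tate algebra have
the formal properties used. -/

/-- Exponents of the monomials `ϖ^k T^i` with `k ∈ ℤ` and `i ∈ ℕ^n`. -/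
abbrev Mon (n : ℕ) : Type := ℤ × (Fin n →₀ ℕ)

/-- A ring with elements `term x m`, to be thought of as `[x] ϖ^k T^i` with `m = (k, i)`, and
the data that determine their size. -/
structure TermData (n : ℕ) (L R : Type*) where
  term : L → Mon n → R
  ν : Mon n →+ ℝ
  τ₀ : ℝ
  τ₁ : ℝ

namespace TermData

variable {n : ℕ} {L R : Type*} [NormedField L] [CommRing R] (X : TermData n L R)

/-- The lower bound for the sizes of terms that define neighbourhoods of zero. -/
def o (c : ℝ) (v : ℝ) : ℝ := c * min (Real.exp (X.τ₀ * v)) (Real.exp (X.τ₁ * v))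

/-- Finite sums of terms `term x m` with `‖x‖ ≤ s (ν m)`. -/
def fin (s : ℝ → ℝ) : AddSubgroup R :=
  AddSubgroup.closure {f | ∃ x m, ‖x‖ ≤ s (X.ν m) ∧ f = X.term x m}

/-- The sum of the terms given by a finitely supported function. -/
def rep (x : Mon n →₀ L) : R := x.sum fun m a => X.term a m

/-- The closure of the group of finite sums of terms `term x m` with `‖x‖ ≤ s (ν m)`. -/
def U [TopologicalSpace R] [IsTopologicalRing R] (s : ℝ → ℝ) : AddSubgroup R :=
  (X.fin s).topologicalClosure

end TermData

/-- The properties of the terms that the division algorithm uses. -/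
structure TermSystem (n : ℕ) (L R : Type*) [NormedField L] [CommRing R] [TopologicalSpace R]
    [IsTopologicalRing R] extends TermData n L R where
  τ₀_pos : 0 < τ₀
  τ_le : τ₀ ≤ τ₁
  u_pos : 0 < ν (1, 0)
  term_zero : ∀ m, term 0 m = 0
  term_mul : ∀ x y m k, term x m * term y k = term (x * y) (m + k)
  -- The carries in the subtraction of Teichmüller representatives involve at least one further
  -- factor `ϖ`, hence the shifts by `(k + 1) * ν (1, 0)`.
  term_sub : ∀ (x y : L) (m : Mon n) (s : ℝ → ℝ),
    (∀ k : ℕ, max ‖x‖ ‖y‖ ≤ s (ν m + (k + 1) * ν (1, 0))) →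
      term x m - term y m - term (x - y) m ∈ toTermData.U s
  U_mem_nhds : ∀ c : ℝ, 0 < c → (toTermData.U (toTermData.o c) : Set R) ∈ 𝓝 0
  exists_U_subset : ∀ V ∈ 𝓝 (0 : R), ∃ c : ℝ, 0 < c ∧ (toTermData.U (toTermData.o c) : Set R) ⊆ V
  exists_mem_U : ∀ h : R, ∃ c : ℝ, 0 < c ∧ h ∈ toTermData.U (toTermData.o c)
  -- Coefficients can be read off from membership in `U s`. Monotonicity is needed because carries
  -- move terms to larger `ν`, and the lower bound by some `o c` lets `s` absorb small errors.
  rep_bound : ∀ (s : ℝ → ℝ), Monotone s → (∃ c : ℝ, 0 < c ∧ ∀ v, toTermData.o c v ≤ s v) →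
    ∀ x : Mon n →₀ L, toTermData.rep x ∈ toTermData.U s → ∀ m, ‖x m‖ ≤ s (ν m)
  rep_exists : ∀ (s : ℝ → ℝ), Monotone s → (∀ v, 0 ≤ s v) → ∀ h ∈ toTermData.U s,
    ∀ c : ℝ, 0 < c → ∃ x : Mon n →₀ L, (∀ m, ‖x m‖ ≤ s (ν m)) ∧
      h - toTermData.rep x ∈ toTermData.U (toTermData.o c)

namespace TermSystem

variable {n : ℕ} {L R : Type*} [NormedField L] [CommRing R] [TopologicalSpace R]
  [IsTopologicalRing R] (X : TermSystem n L R)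

theorem o_pos {c : ℝ} (hc : 0 < c) (v : ℝ) : 0 < X.o c v :=
  mul_pos hc (lt_min (Real.exp_pos _) (Real.exp_pos _))

theorem o_eq (c v : ℝ) : X.o c v = c * X.o 1 v := by simp [TermData.o]

/-- An exponential of intermediate slope lies above the smaller of the two extremal ones. Errors
that are small in the topology of `R` are therefore small on every line of slope between `τ₀` and
`τ₁`. -/
theorem o_le {c β : ℝ} (hc : 0 ≤ c) (h0 : X.τ₀ ≤ β) (h1 : β ≤ X.τ₁) (v : ℝ) :
    X.o c v ≤ c * Real.exp (β * v) := by
  refine mul_le_mul_of_nonneg_left ?_ hc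
  rcases le_total 0 v with hv | hv
  · exact (min_le_left _ _).trans (Real.exp_le_exp.2 (mul_le_mul_of_nonneg_right h0 hv))
  · exact (min_le_right _ _).trans (Real.exp_le_exp.2 (mul_le_mul_of_nonpos_right h1 hv))

theorem fin_mono {s s' : ℝ → ℝ} (h : ∀ v, s v ≤ s' v) : X.fin s ≤ X.fin s' :=
  AddSubgroup.closure_mono fun _ ⟨x, m, hx, hf⟩ => ⟨x, m, hx.trans (h _), hf⟩

theorem fin_le_U (s : ℝ → ℝ) : X.fin s ≤ X.U s := AddSubgroup.le_topologicalClosure _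

theorem U_mono {s s' : ℝ → ℝ} (h : ∀ v, s v ≤ s' v) : X.U s ≤ X.U s' :=
  AddSubgroup.topologicalClosure_mono (X.fin_mono h)

theorem term_mem_fin {s : ℝ → ℝ} {x : L} {m : Mon n} (h : ‖x‖ ≤ s (X.ν m)) :
    X.term x m ∈ X.fin s := AddSubgroup.subset_closure ⟨x, m, h, rfl⟩

theorem fin_induction {s : ℝ → ℝ} {S : AddSubgroup R}
    (h : ∀ x m, ‖x‖ ≤ s (X.ν m) → X.term x m ∈ S) : X.fin s ≤ S :=
  (AddSubgroup.closure_le _).2 fun _ ⟨x, m, hx, hf⟩ => hf ▸ h x m hx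

theorem rep_mem_fin {s : ℝ → ℝ} {x : Mon n →₀ L} (h : ∀ m, x m ≠ 0 → ‖x m‖ ≤ s (X.ν m)) :
    X.rep x ∈ X.fin s :=
  sum_mem fun m hm => X.term_mem_fin (h m (Finsupp.mem_support_iff.1 hm))

theorem rep_mem_U {s : ℝ → ℝ} {x : Mon n →₀ L} (h : ∀ m, x m ≠ 0 → ‖x m‖ ≤ s (X.ν m)) :
    X.rep x ∈ X.U s := X.fin_le_U s (X.rep_mem_fin h)

theorem mul_mem_fin {s₁ s₂ s₃ : ℝ → ℝ} (h : ∀ v w, 0 ≤ s₁ v → 0 ≤ s₂ w →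
    s₁ v * s₂ w ≤ s₃ (v + w)) {a b : R} (ha : a ∈ X.fin s₁) (hb : b ∈ X.fin s₂) :
    a * b ∈ X.fin s₃ := by
  have h1 : ∀ x m, ‖x‖ ≤ s₁ (X.ν m) → X.term x m * b ∈ X.fin s₃ := fun x m hx => by
    have : X.fin s₂ ≤ (X.fin s₃).comap (AddMonoidHom.mulLeft (X.term x m)) := by
      refine X.fin_induction fun y k hy => ?_
      change X.term x m * X.term y k ∈ X.fin s₃
      rw [X.term_mul]
      refine X.term_mem_fin ?_
      rw [norm_mul, map_add]
      exact (mul_le_mul hx hy (norm_nonneg _) ((norm_nonneg _).trans hx)).trans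
        (h _ _ ((norm_nonneg _).trans hx) ((norm_nonneg _).trans hy))
    exact this hb
  have h2 : X.fin s₁ ≤ (X.fin s₃).comap (AddMonoidHom.mulRight b) := X.fin_induction h1
  exact h2 ha

theorem mul_mem_U {s₁ s₂ s₃ : ℝ → ℝ} (h : ∀ v w, 0 ≤ s₁ v → 0 ≤ s₂ w →
    s₁ v * s₂ w ≤ s₃ (v + w)) {a b : R} (ha : a ∈ X.U s₁) (hb : b ∈ X.U s₂) :
    a * b ∈ X.U s₃ :=
  map_mem_closure₂ (s := (X.fin s₁ : Set R)) (t := (X.fin s₂ : Set R)) (u := (X.fin s₃ : Set R))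
    continuous_mul ha hb fun _ ha _ hb => X.mul_mem_fin h ha hb

theorem add_mem_U {s₁ s₂ s₃ : ℝ → ℝ} (h₁ : ∀ v, s₁ v ≤ s₃ v) (h₂ : ∀ v, s₂ v ≤ s₃ v) {a b : R}
    (ha : a ∈ X.U s₁) (hb : b ∈ X.U s₂) : a + b ∈ X.U s₃ :=
  add_mem (X.U_mono h₁ ha) (X.U_mono h₂ hb)

/-- Approximation of an element of `U s` by a finite sum of terms. -/
theorem exists_fin {s : ℝ → ℝ} {h : R} (hh : h ∈ X.U s) {c : ℝ} (hc : 0 < c) :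
    ∃ f ∈ X.fin s, h - f ∈ X.U (X.o c) := by
  have h1 : (fun f => h - f) ⁻¹' (X.U (X.o c) : Set R) ∈ 𝓝 h :=
    (continuous_const.sub continuous_id).continuousAt.preimage_mem_nhds
      (by simpa using X.U_mem_nhds c hc)
  obtain ⟨f, hf, hf'⟩ := mem_closure_iff_nhds.1 hh _ h1
  exact ⟨f, hf', hf⟩

/-- A finite sum of terms is the sum of its parts on both sides of a cut. -/
theorem fin_split {s : ℝ → ℝ} (P : ℝ → Prop) [DecidablePred P] {a : R} (ha : a ∈ X.fin s) :
    ∃ b ∈ X.fin (fun v => if P v then s v else 0), ∃ c ∈ X.fin (fun v => if P v then 0 else s v),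
      a = b + c := by
  have : X.fin s ≤ X.fin (fun v => if P v then s v else 0) ⊔
      X.fin (fun v => if P v then 0 else s v) := by
    refine X.fin_induction fun x m hx => ?_
    by_cases h : P (X.ν m)
    · exact AddSubgroup.mem_sup_left (X.term_mem_fin (by simpa [h] using hx))
    · exact AddSubgroup.mem_sup_right (X.term_mem_fin (by simpa [h] using hx))
  obtain ⟨b, hb, c, hc, h⟩ := AddSubgroup.mem_sup.1 (this ha)
  exact ⟨b, hb, c, hc, h.symm⟩

/-- An element with all its terms in a bounded range of `ν`, up to a small error. -/
theorem exists_fin_bounded {s : ℝ → ℝ} (hs : ∀ v, 0 ≤ s v) {h : R} (hh : h ∈ X.U s) {c : ℝ}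
    (hc : 0 < c) :
    ∃ C : ℝ, 0 ≤ C ∧ ∃ f ∈ X.fin (fun v => if |v| ≤ C then s v else 0), h - f ∈ X.U (X.o c) := by
  obtain ⟨f, hf, hf'⟩ := X.exists_fin hh hc
  have : ∀ f ∈ X.fin s, ∃ C : ℝ, 0 ≤ C ∧ f ∈ X.fin (fun v => if |v| ≤ C then s v else 0) := by
    intro f hf
    have mono : ∀ {C C' : ℝ}, C ≤ C' → X.fin (fun v => if |v| ≤ C then s v else 0) ≤
        X.fin (fun v => if |v| ≤ C' then s v else 0) := fun {C C'} h => X.fin_mono fun v => by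
      by_cases h1 : |v| ≤ C
      · simp [h1, h1.trans h]
      · simp only [h1, if_false]; split_ifs; exacts [hs v, le_rfl]
    induction hf using AddSubgroup.closure_induction with
    | mem x hx =>
      obtain ⟨x, m, hx, rfl⟩ := hx
      exact ⟨|X.ν m|, abs_nonneg _, X.term_mem_fin (by simpa using hx)⟩
    | zero => exact ⟨0, le_rfl, zero_mem _⟩
    | add x y _ _ hx hy =>
      obtain ⟨C, hC, h⟩ := hx
      obtain ⟨C', hC', h'⟩ := hy
      exact ⟨max C C', le_max_of_le_left hC, add_mem (mono (le_max_left _ _) h)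
        (mono (le_max_right _ _) h')⟩
    | neg x _ hx =>
      obtain ⟨C, hC, h⟩ := hx
      exact ⟨C, hC, neg_mem h⟩
  obtain ⟨C, hC, h'⟩ := this f hf
  exact ⟨C, hC, f, h', hf'⟩

/-- A finite approximation chosen for `s₁` differs from `f` by an error that both bounds absorb. It
therefore also lies in `U s₂`, and since its coefficients are determined by the element they satisfy
both bounds. -/
theorem U_inf {s₁ s₂ : ℝ → ℝ} (h₁ : Monotone s₁) (h₂ : Monotone s₂)
    (h : ∃ c : ℝ, 0 < c ∧ ∀ v, X.o c v ≤ min (s₁ v) (s₂ v)) {f : R} (hf₁ : f ∈ X.U s₁)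
    (hf₂ : f ∈ X.U s₂) : f ∈ X.U fun v => min (s₁ v) (s₂ v) := by
  obtain ⟨c, hc, ho⟩ := h
  obtain ⟨x, hx, hx'⟩ := X.rep_exists s₁ h₁
    (fun v => (X.o_pos hc v).le.trans ((ho v).trans (min_le_left _ _))) f hf₁ c hc
  have h3 : X.rep x ∈ X.U s₂ := by
    have := sub_mem hf₂ (X.U_mono (fun v => (ho v).trans (min_le_right _ _)) hx')
    rwa [sub_sub_cancel] at this
  have h4 := X.rep_bound s₂ h₂ ⟨c, hc, fun v => (ho v).trans (min_le_right _ _)⟩ x h3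
  have h5 := add_mem (X.U_mono (s' := fun v => min (s₁ v) (s₂ v)) ho hx')
    (X.rep_mem_U (s := fun v => min (s₁ v) (s₂ v)) fun m _ => le_min (hx m) (h4 m))
  rwa [sub_add_cancel] at h5

theorem rep_eq_sum {x : Mon n →₀ L} {S : Finset (Mon n)} (h : x.support ⊆ S) :
    X.rep x = ∑ m ∈ S, X.term (x m) m :=
  Finsupp.sum_of_support_subset _ h _ fun m _ => X.term_zero m

theorem rep_sub_mem {s : ℝ → ℝ} {x y : Mon n →₀ L}
    (h : ∀ m, (x m ≠ 0 ∨ y m ≠ 0) →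
      ∀ k : ℕ, max ‖x m‖ ‖y m‖ ≤ s (X.ν m + (k + 1) * X.ν (1, 0))) :
    X.rep x - X.rep y - X.rep (x - y) ∈ X.U s := by
  classical
  rw [X.rep_eq_sum (S := x.support ∪ y.support) Finset.subset_union_left,
    X.rep_eq_sum (S := x.support ∪ y.support) Finset.subset_union_right,
    X.rep_eq_sum (S := x.support ∪ y.support) Finsupp.support_sub, ← Finset.sum_sub_distrib,
    ← Finset.sum_sub_distrib]
  refine sum_mem fun m hm => X.term_sub _ _ _ _ (h m ?_)
  simpa using hm

theorem rep_add_of_disjoint {x y : Mon n →₀ L} (h : ∀ m, x m = 0 ∨ y m = 0) :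
    X.rep (x + y) = X.rep x + X.rep y := by
  classical
  rw [X.rep_eq_sum (S := x.support ∪ y.support) Finset.subset_union_left,
    X.rep_eq_sum (S := x.support ∪ y.support) Finset.subset_union_right,
    X.rep_eq_sum (S := x.support ∪ y.support) Finsupp.support_add, ← Finset.sum_add_distrib]
  refine Finset.sum_congr rfl fun m _ => ?_
  rcases h m with h | h <;> simp [h, X.term_zero]

theorem term_mul_rep (b : L) (k : Mon n) (y : Mon n →₀ L) :
    X.term b k * X.rep y =
      X.rep ((b • y).embDomain (addRightEmbedding k)) := by
  by_cases hb : b = 0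
  · subst hb; simp [X.term_zero, TermData.rep]
  simp only [TermData.rep, Finsupp.sum_embDomain]
  rw [Finsupp.sum_smul_index' (h := fun a b => X.term b ((addRightEmbedding k) a))
    (fun m => X.term_zero _)]
  rw [Finsupp.mul_sum]
  refine Finsupp.sum_congr fun m _ => ?_
  rw [X.term_mul, add_comm]; rfl

end TermSystem

/-! ### Well-quasi-orders and the ordering of monomials -/

/-- In a well-quasi-ordered set every family is dominated from below by finitely many members. -/
theorem exists_finite_basis {T W : Type*} [PartialOrder W] [WellQuasiOrderedLE W] (P : Set T)
    (φ : T → W) : ∃ F : Set T, F.Finite ∧ F ⊆ P ∧ ∀ t ∈ P, ∃ f ∈ F, φ f ≤ φ t := by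
  let Q : Set W := {w | Minimal (· ∈ φ '' P) w}
  have hfin : Q.Finite := WellQuasiOrderedLE.finite_of_isAntichain (setOfPred_minimal_antichain _)
  have hsec : ∀ w ∈ Q, ∃ t ∈ P, φ t = w := fun w hw => hw.prop
  choose g hg hg' using hsec
  have := hfin.to_subtype
  refine ⟨Set.range fun w : Q => g w w.2, Set.finite_range _, ?_, fun t ht => ?_⟩
  · rintro _ ⟨w, rfl⟩; exact hg w w.2
  · obtain ⟨w, hwle, hw⟩ := exists_minimal_le_of_wellFoundedLT (· ∈ φ '' P) (φ t) ⟨t, ht, rfl⟩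
    exact ⟨g w hw, ⟨⟨w, hw⟩, rfl⟩, (hg' w hw).trans_le hwle⟩

namespace Mon
variable {n : ℕ}

/-- The degree of a monomial. -/
def deg (m : Mon n) : ℕ := m.1.natAbs + m.2.degree

theorem deg_add_le (m k : Mon n) : deg (m + k) ≤ deg m + deg k := by
  have := Int.natAbs_add_le m.1 k.1
  simp only [deg, Prod.fst_add, Prod.snd_add, map_add]
  omega

theorem finite_deg_le (e : ℕ) : {m : Mon n | deg m ≤ e}.Finite := by
  refine ((Set.finite_Icc (-(e : ℤ)) e).prod (Finsupp.finite_of_degree_le (σ := Fin n) e)).subset ?_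
  rintro ⟨k, i⟩ h
  simp only [deg, Set.mem_ofPred_eq] at h
  refine ⟨⟨by dsimp; omega, by dsimp; omega⟩, ?_⟩
  simp only [Set.mem_ofPred_eq]; omega

/-- The Gröbner relation between leading monomials with a bound for the degrees is a
well-quasi-order. -/
theorem exists_finite_divisors {ι : Type*} [Finite ι] (P : Set (ι × Mon n × ℕ))
    (hP : ∀ p ∈ P, deg p.2.1 ≤ p.2.2) :
    ∃ F : Set (ι × Mon n × ℕ), F.Finite ∧ F ⊆ P ∧ ∀ p ∈ P, ∃ q ∈ F, ∃ b : Mon n,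
      q.1 = p.1 ∧ p.2.1 = q.2.1 + b ∧ q.2.2 + deg b ≤ p.2.2 := by
  -- Once the component and the sign of the exponent of `ϖ` are fixed, degrees are additive under
  -- division. The condition on degree bounds then says that the excess `e - deg` does not decrease
  -- from divisor to multiple, so a product of well-quasi-orders governs divisibility.
  have key : ∀ z : ι × Bool, ∃ F : Set (ι × Mon n × ℕ), F.Finite ∧ F ⊆ P ∧ ∀ p ∈ P,
      (p.1, decide (0 ≤ p.2.1.1)) = z → ∃ q ∈ F, ∃ b : Mon n,
      q.1 = p.1 ∧ p.2.1 = q.2.1 + b ∧ q.2.2 + deg b ≤ p.2.2 := by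
    intro z
    obtain ⟨F, hF, hFP, h⟩ := exists_finite_basis
      (P ∩ {p | (p.1, decide (0 ≤ p.2.1.1)) = z})
      (fun p => (p.2.1.1.natAbs, p.2.1.2, p.2.2 - deg p.2.1))
    refine ⟨F, hF, hFP.trans Set.inter_subset_left, fun p hp hz => ?_⟩
    obtain ⟨q, hq, hle⟩ := h p ⟨hp, hz⟩
    obtain ⟨hq1, hq2⟩ := hFP hq
    have hz' : (q.1, decide (0 ≤ q.2.1.1)) = (p.1, decide (0 ≤ p.2.1.1)) := hq2.trans hz.symm
    simp only [Prod.mk.injEq, decide_eq_decide] at hz'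
    obtain ⟨h1, h2, h3⟩ := hle
    dsimp at h1 h2 h3
    have hdp := hP p hp
    have hdq := hP q hq1
    have hd : (p.2.1.2 - q.2.1.2).degree + q.2.1.2.degree = p.2.1.2.degree := by
      rw [← map_add, tsub_add_cancel_of_le h2]
    refine ⟨q, hq, (p.2.1.1 - q.2.1.1, p.2.1.2 - q.2.1.2), hz'.1, ?_, ?_⟩
    · ext1
      · simp
      · exact (add_tsub_cancel_of_le h2).symm
    · simp only [deg] at *
      have := hz'.2
      omega
  choose F hF hFP h using key
  refine ⟨⋃ z, F z, Set.finite_iUnion hF, Set.iUnion_subset hFP, fun p hp => ?_⟩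
  obtain ⟨q, hq, hb⟩ := h _ p hp rfl
  exact ⟨q, Set.mem_iUnion.2 ⟨_, hq⟩, hb⟩

/-- The ordered group in which leading monomials are compared. -/
abbrev Key (n : ℕ) : Type := ℝ ×ₗ (ℤ ×ₗ (Lex (Fin n →₀ ℕ) ×ₗ ℕ))

/-- The order of the monomials: first by `ν`, the rest is a tie break. -/
def key {ι : Type*} [Fintype ι] (ν : Mon n → ℝ) (i : ι) (m : Mon n) : Key n :=
  toLex (ν m, toLex (m.1, toLex (toLex m.2, (Fintype.equivFin ι i : ℕ))))

variable {ι : Type*} [Fintype ι] (ν : Mon n →+ ℝ)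

theorem key_injective {i j : ι} {m k : Mon n} (h : key ν i m = key ν j k) : i = j ∧ m = k := by
  simp only [key, EmbeddingLike.apply_eq_iff_eq, Prod.mk.injEq] at h
  obtain ⟨-, h1, h2, h3⟩ := h
  exact ⟨(Fintype.equivFin ι).injective (Fin.ext h3), Prod.ext h1 h2⟩

theorem key_add_lt {i j : ι} {m k : Mon n} (h : key ν i m < key ν j k) (b : Mon n) :
    key ν i (m + b) < key ν j (k + b) := by
  let z : Key n := toLex (ν b, toLex (b.1, toLex (toLex b.2, 0)))
  have : ∀ (i : ι) (m : Mon n), key ν i (m + b) = key ν i m + z := fun i m => by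
    simp only [key, z, map_add, Prod.fst_add, Prod.snd_add]; rfl
  rw [this, this]
  exact add_lt_add_left h z

theorem le_of_key_le {i j : ι} {m k : Mon n} (h : key ν i m ≤ key ν j k) : ν m ≤ ν k := by
  have := Prod.Lex.monotone_fst _ _ h
  exact this

end Mon

/-! ### Leading terms and standard bases for one slope -/

namespace TermSystem

variable {n : ℕ} {L R : Type*} [NormedField L] [CommRing R] [TopologicalSpace R]
  [IsTopologicalRing R] (X : TermSystem n L R) {ι : Type} [Fintype ι]

/-- The elements of `R^ι` whose components are limits of sums of terms bounded by `s / κ i`. -/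
def UM (κ : ι → ℝ) (s : ℝ → ℝ) : AddSubgroup (ι → R) :=
  AddSubgroup.pi Set.univ fun i => X.U fun v => (κ i)⁻¹ * s v

theorem mem_UM {κ : ι → ℝ} {s : ℝ → ℝ} {h : ι → R} :
    h ∈ X.UM κ s ↔ ∀ i, h i ∈ X.U fun v => (κ i)⁻¹ * s v := by
  simp [UM, AddSubgroup.mem_pi]

theorem UM_mono {κ : ι → ℝ} (hκ : ∀ i, 0 < κ i) {s s' : ℝ → ℝ} (h : ∀ v, s v ≤ s' v) :
    X.UM κ s ≤ X.UM κ s' := fun _ hf => X.mem_UM.2 fun i =>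
  X.U_mono (fun v => mul_le_mul_of_nonneg_left (h v) (inv_pos.2 (hκ i)).le) (X.mem_UM.1 hf i)

theorem smul_mem_UM {κ : ι → ℝ} (hκ : ∀ i, 0 < κ i) {s₁ s₂ s₃ : ℝ → ℝ}
    (h : ∀ v w, 0 ≤ s₁ v → 0 ≤ s₂ w → s₁ v * s₂ w ≤ s₃ (v + w)) {a : R} (ha : a ∈ X.U s₁)
    {g : ι → R} (hg : g ∈ X.UM κ s₂) : a • g ∈ X.UM κ s₃ := X.mem_UM.2 fun i =>
  X.mul_mem_U (fun v w hv hw => by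
    have hw' : 0 ≤ s₂ w := by
      have := mul_nonneg (hκ i).le hw
      rwa [mul_inv_cancel_left₀ (hκ i).ne'] at this
    rw [mul_left_comm]
    exact mul_le_mul_of_nonneg_left (h v w hv hw') (inv_pos.2 (hκ i)).le) ha (X.mem_UM.1 hg i)

/-- Componentwise sums of terms. -/
def repM (x : ι → Mon n →₀ L) : ι → R := fun i => X.rep (x i)

theorem repM_mem_UM {κ : ι → ℝ} (hκ : ∀ i, 0 < κ i) {s : ℝ → ℝ} {x : ι → Mon n →₀ L}
    (h : ∀ i m, x i m ≠ 0 → κ i * ‖x i m‖ ≤ s (X.ν m)) : X.repM x ∈ X.UM κ s :=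
  X.mem_UM.2 fun i => X.rep_mem_U fun m hm => by
    rw [inv_mul_eq_div, le_div_iff₀' (hκ i)]; exact h i m hm

/-- The homomorphism that is used to compare monomials. -/
def νσ (σ : ℝ) : Mon n →+ ℝ := (AddMonoidHom.mulLeft σ).comp X.ν

theorem νσ_apply (σ : ℝ) (m : Mon n) : X.νσ σ m = σ * X.ν m := rfl

/-- An element `g` of `J` together with its terms of maximal size `c`, which have degree at most
`e`, and the leading one of which has the index `(i, α)`, where `p = (i, α, e)`. -/
structure LeadDatum (β σ : ℝ) (κ : ι → ℝ) (J : Submodule R (ι → R)) (p : ι × Mon n × ℕ) where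
  g : ι → R
  g_mem : g ∈ J
  y : ι → Mon n →₀ L
  c : ℝ
  c' : ℝ
  c'_pos : 0 < c'
  c'_lt : c' < c
  approx : g - X.repM y ∈ X.UM κ fun v => c' * Real.exp (β * v)
  level : ∀ i m, y i m ≠ 0 → κ i * ‖y i m‖ = c * Real.exp (β * X.ν m)
  -- The degree bound is part of the datum: a multiple of a basis element whose bound fits
  -- introduces no main terms of larger degree, and this makes division terminate.
  deg_le : ∀ i m, y i m ≠ 0 → Mon.deg m ≤ p.2.2
  lead_ne : y p.1 p.2.1 ≠ 0
  key_le : ∀ i m, y i m ≠ 0 → Mon.key (X.νσ σ) i m ≤ Mon.key (X.νσ σ) p.1 p.2.1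

/-- A finite set of elements of `J` whose leading monomials, with degree bounds, generate all
leading monomials of elements of `J`. -/
structure StdBasis (β σ : ℝ) (κ : ι → ℝ) (J : Submodule R (ι → R)) where
  idx : Type
  [fintype : Fintype idx]
  p : idx → ι × Mon n × ℕ
  dat : ∀ k, X.LeadDatum β σ κ J (p k)
  basis : ∀ q, Nonempty (X.LeadDatum β σ κ J q) → ∃ k b, (p k).1 = q.1 ∧
    q.2.1 = (p k).2.1 + b ∧ (p k).2.2 + Mon.deg b ≤ q.2.2

attribute [instance] StdBasis.fintype

theorem exists_stdBasis (β σ : ℝ) (κ : ι → ℝ) (J : Submodule R (ι → R)) :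
    Nonempty (X.StdBasis β σ κ J) := by
  obtain ⟨F, hF, hFP, h⟩ := Mon.exists_finite_divisors
    {q | Nonempty (X.LeadDatum β σ κ J q)} fun q ⟨d⟩ => d.deg_le _ _ d.lead_ne
  have := hF.fintype
  exact ⟨{ idx := F, p := Subtype.val, dat := fun k => (hFP k.2).some,
           basis := fun q hq => by
            obtain ⟨k, hk, b, hb⟩ := h q hq
            exact ⟨⟨k, hk⟩, b, hb⟩ }⟩

variable {X} in
/-- The bound for the error terms after a division step. -/
def bnd (β ε c : ℝ) (s r : ℝ → ℝ) (v : ℝ) : ℝ :=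
  max (min (s v) (ε * c * Real.exp (β * v))) (r v)

variable {β σ : ℝ} {κ : ι → ℝ} {J : Submodule R (ι → R)}

/-- The terms of maximal size of an element of `J` give a leading datum. -/
theorem exists_leadDatum (hκ : ∀ i, 0 < κ i) {x : ι → Mon n →₀ L} {h : ι → R} {e : ℕ} {δ : ℝ}
    (hδ : 0 < δ) (hxd : ∀ i m, x i m ≠ 0 → Mon.deg m ≤ e) (hh : h ∈ J)
    (happ : h - X.repM x ∈ X.UM κ fun v => δ * Real.exp (β * v))
    (hbig : ∃ i m, δ * Real.exp (β * X.ν m) < κ i * ‖x i m‖) :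
    ∃ i α c₁, δ < c₁ ∧ (∀ j m, κ j * ‖x j m‖ ≤ c₁ * Real.exp (β * X.ν m)) ∧
      κ i * ‖x i α‖ = c₁ * Real.exp (β * X.ν α) ∧
      Nonempty (X.LeadDatum β σ κ J (i, α, e)) := by
  classical
  -- The level is the weighted size of a coefficient relative to `exp (β * ν)`.
  let lv : ι × Mon n → ℝ := fun q => κ q.1 * ‖x q.1 q.2‖ * Real.exp (-(β * X.ν q.2))
  have hlv : ∀ (q : ι × Mon n) (d : ℝ), (lv q ≤ d ↔ κ q.1 * ‖x q.1 q.2‖ ≤ d * Real.exp (β * X.ν q.2)) :=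
    fun q d => by
      simp only [lv, Real.exp_neg]
      rw [← div_eq_mul_inv, div_le_iff₀ (Real.exp_pos _)]
  have hlv' : ∀ (q : ι × Mon n) (d : ℝ), (lv q = d ↔ κ q.1 * ‖x q.1 q.2‖ = d * Real.exp (β * X.ν q.2)) :=
    fun q d => by
      simp only [lv, Real.exp_neg]
      rw [← div_eq_mul_inv, div_eq_iff (Real.exp_pos _).ne']
  let S : Finset (ι × Mon n) := Finset.univ.biUnion fun i =>
    (x i).support.map ⟨fun m => (i, m), fun _ _ h => (Prod.ext_iff.1 h).2⟩
  have hS : ∀ q, q ∈ S ↔ x q.1 q.2 ≠ 0 := by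
    rintro ⟨i, m⟩
    simp only [S, Finset.mem_biUnion, Finset.mem_univ, true_and, Finset.mem_map,
      Finsupp.mem_support_iff]
    constructor
    · rintro ⟨j, k, hk, h⟩
      cases h
      exact hk
    · exact fun h => ⟨i, m, h, rfl⟩
  obtain ⟨i₁, m₁, hb⟩ := hbig
  have hb' : δ < lv (i₁, m₁) := by
    rw [← not_le, hlv]; exact not_le.2 hb
  have hne : (i₁, m₁) ∈ S := by
    rw [hS]; intro h0
    have : lv (i₁, m₁) = 0 := by simp only [lv]; rw [h0]; simp
    linarith
  obtain ⟨q₁, hq₁, hmax⟩ := Finset.exists_max_image S lv ⟨_, hne⟩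
  set c₁ := lv q₁ with hc₁
  have hδc : δ < c₁ := hb'.trans_le (hmax _ hne)
  have hle : ∀ q, lv q ≤ c₁ := fun q => by
    by_cases hq : q ∈ S
    · exact hmax q hq
    · rw [hS, not_not] at hq
      have : lv q = 0 := by simp only [lv]; rw [hq]; simp
      linarith
  obtain ⟨q₂, hq₂, hkey⟩ := Finset.exists_max_image (S.filter fun q => lv q = c₁)
    (fun q => Mon.key (X.νσ σ) q.1 q.2) ⟨q₁, by simp [hq₁, hc₁]⟩
  rw [Finset.mem_filter] at hq₂
  -- Only finitely many terms occur, so there is a gap below the maximal level even if the values of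
  -- the norm are dense; `c'` is the next level or `δ`.
  obtain ⟨c', hc'1, hc'2, hc'3⟩ : ∃ c', δ ≤ c' ∧ c' < c₁ ∧ ∀ q ∈ S, lv q ≠ c₁ → lv q ≤ c' := by
    let T := insert δ ((S.filter fun q => lv q ≠ c₁).image lv)
    have hT : T.Nonempty := ⟨δ, Finset.mem_insert_self _ _⟩
    refine ⟨T.max' hT, T.le_max' _ (Finset.mem_insert_self _ _), ?_, fun q hq hq' =>
      T.le_max' _ (Finset.mem_insert_of_mem (Finset.mem_image_of_mem _
        (Finset.mem_filter.2 ⟨hq, hq'⟩)))⟩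
    rw [Finset.max'_lt_iff]
    intro d hd
    rcases Finset.mem_insert.1 hd with rfl | hd
    · exact hδc
    · obtain ⟨q, hq, rfl⟩ := Finset.mem_image.1 hd
      exact lt_of_le_of_ne (hle q) (Finset.mem_filter.1 hq).2
  refine ⟨q₂.1, q₂.2, c₁, hδc, fun j m => (hlv (j, m) c₁).1 (hle _), (hlv' q₂ c₁).1 hq₂.2, ⟨?_⟩⟩
  let P : ι → Mon n → Prop := fun i m => lv (i, m) = c₁
  have hy : ∀ i m, (x i).filter (P i) m ≠ 0 → (i, m) ∈ S ∧ lv (i, m) = c₁ := fun i m hm => by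
    rw [Finsupp.filter_apply] at hm
    split_ifs at hm with hP
    · exact ⟨(hS _).2 hm, hP⟩
    · exact absurd rfl hm
  refine { g := h, g_mem := hh, y := fun i => (x i).filter (P i), c := c₁, c' := c',
           c'_pos := hδ.trans_le hc'1, c'_lt := hc'2, approx := ?_,
           level := fun i m hm => ?_,
           deg_le := fun i m hm => hxd i m ((hS (i, m)).1 (hy i m hm).1), lead_ne := ?_,
           key_le := fun i m hm => hkey (i, m) (Finset.mem_filter.2 (hy i m hm)) }
  · have h1 : X.repM x = X.repM (fun i => (x i).filter (P i)) +
        X.repM (fun i => (x i).filter fun m => ¬ P i m) := by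
      ext i
      simp only [repM, Pi.add_apply]
      rw [← X.rep_add_of_disjoint, Finsupp.filter_add_filter_not]
      intro m
      simp only [Finsupp.filter_apply]
      by_cases hP : P i m <;> simp [hP]
    have h2 : h - X.repM (fun i => (x i).filter (P i)) =
        (h - X.repM x) + X.repM (fun i => (x i).filter fun m => ¬ P i m) := by rw [h1]; abel
    rw [h2]
    refine add_mem (X.UM_mono hκ (fun v => mul_le_mul_of_nonneg_right hc'1 (Real.exp_pos _).le) happ)
      (X.repM_mem_UM hκ fun i m hm => ?_)
    rw [Finsupp.filter_apply] at hm ⊢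
    split_ifs at hm ⊢ with hP
    · exact absurd rfl hm
    · exact (hlv (i, m) c').1 (hc'3 _ ((hS _).2 hm) hP)
  · rw [Finsupp.filter_apply_pos (P i) _ (hy i m hm).2]
    exact (hlv' (i, m) c₁).1 (hy i m hm).2
  · change (x q₂.1).filter (P q₂.1) q₂.2 ≠ 0
    rw [Finsupp.filter_apply_pos (P q₂.1) _ hq₂.2]
    exact (hS _).1 hq₂.1

end TermSystem

/-! ### The division algorithm at one slope -/

namespace TermSystem

variable {n : ℕ} {L R : Type*} [NormedField L] [CommRing R] [TopologicalSpace R]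
  [IsTopologicalRing R] {X : TermSystem n L R} {ι : Type} [Fintype ι]
  {β σ : ℝ} {κ : ι → ℝ} {J : Submodule R (ι → R)}

/-- Constants that make a division by a standard basis possible, with finite approximations of
the lower order terms of its members. -/
structure StdBasis.Constants (B : X.StdBasis β σ κ J) where
  ε : ℝ
  exp_le : Real.exp (-(β * X.ν (1, 0))) ≤ ε
  c'_le : ∀ k, (B.dat k).c' ≤ ε * (B.dat k).c
  t : ℝ
  t_pos : 0 < t
  C : ℝ
  f : B.idx → ι → R
  f_mem : ∀ k i, f k i ∈
    X.fin fun v => if |v| ≤ C then (κ i)⁻¹ * ((B.dat k).c' * Real.exp (β * v)) else 0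
  approx : ∀ k, (B.dat k).g - X.repM (B.dat k).y - f k ∈ X.UM κ (X.o (t * (B.dat k).c))
  η : ℝ
  η_pos : 0 < η
  -- Over the range occupied by the lower order terms, the loss permitted by the slope condition is
  -- compensated by the gap factor `ε`.
  ε_mul_exp_le : ∀ k, ε * Real.exp (η * (C + |X.ν (B.p k).2.1|)) ≤ 1
  -- This is the origin of the factor `2` in the bounds for quotients.
  exp_le_two : ∀ k, Real.exp (η * |X.ν (B.p k).2.1|) ≤ 2

/-- The conditions on the bounds `s` for the main terms and `r` for the error terms in a
division. -/
structure Shape (X : TermSystem n L R) (β σ ε t η c : ℝ) (s r : ℝ → ℝ) : Prop where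
  s_mono : Monotone s
  s_pos : ∀ v, 0 < s v
  s_le : ∀ v, s v ≤ c * Real.exp (β * v)
  -- Relative to `exp (β * v)`, the bound `s` may drop only in the direction of `σ`, and only at
  -- rate `η`.
  slope : ∀ v v', s v * Real.exp (β * (v' - v)) ≤ Real.exp (η * max (σ * (v' - v)) 0) * s v'
  r_mono : Monotone r
  r_nonneg : ∀ v, 0 ≤ r v
  r_le : ∀ v, r v ≤ ε * c * Real.exp (β * v)
  -- The far terms of the basis elements are known only up to `t` times their size; this makes their
  -- multiples by the quotients admissible errors.
  tail : ∀ v w, 2 * t * (s v * X.o 1 w) ≤ bnd β ε c s r (v + w)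

theorem Shape.c_pos {ε t η c : ℝ} {s r : ℝ → ℝ} (S : X.Shape β σ ε t η c s r) : 0 < c := by
  have := (S.s_pos 0).trans_le (S.s_le 0)
  simpa using this

theorem LeadDatum.c_pos {p} (d : X.LeadDatum β σ κ J p) : 0 < d.c := d.c'_pos.trans d.c'_lt

theorem StdBasis.Constants.ε_pos {B : X.StdBasis β σ κ J} (D : B.Constants) : 0 < D.ε :=
  (Real.exp_pos _).trans_le D.exp_le

open IsUltrametricDist in
/-- One step of the division algorithm: the leading one of the maximal terms is removed. -/
theorem division_step [IsUltrametricDist L] (hβ : 0 < β) (hσ : |σ| ≤ 1) (hκ : ∀ i, 0 < κ i)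
    {B : X.StdBasis β σ κ J}
    (D : B.Constants) {c : ℝ} {s r : ℝ → ℝ} (S : X.Shape β σ D.ε D.t D.η c s r)
    {e : ℕ} {h : ι → R} {x : ι → Mon n →₀ L} (hh : h ∈ J)
    (hxs : ∀ i m, x i m ≠ 0 → κ i * ‖x i m‖ ≤ s (X.ν m))
    (hxd : ∀ i m, x i m ≠ 0 → Mon.deg m ≤ e)
    (happ : h - X.repM x ∈ X.UM κ (bnd β D.ε c s r))
    (hbig : ∃ i m, D.ε * c * Real.exp (β * X.ν m) < κ i * ‖x i m‖) :
    ∃ k a x', a ∈ X.fin (fun v => 2 * s v / (B.dat k).c) ∧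
      (∀ i m, x' i m ≠ 0 → κ i * ‖x' i m‖ ≤ s (X.ν m)) ∧
      (∀ i m, x' i m ≠ 0 → Mon.deg m ≤ e) ∧
      h - a • (B.dat k).g - X.repM x' ∈ X.UM κ (bnd β D.ε c s r) ∧
      ∃ i₀ α₀, x i₀ α₀ ≠ 0 ∧ x' i₀ α₀ = 0 ∧ ∀ i m, x' i m ≠ 0 → x i m = 0 →
        Mon.key (X.νσ σ) i m ≤ Mon.key (X.νσ σ) i₀ α₀ := by
  classical
  have hc := S.c_pos
  have hε := D.ε_pos
  have hxs0 : ∀ i m, κ i * ‖x i m‖ ≤ s (X.ν m) := fun i m => by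
    by_cases h0 : x i m = 0
    · rw [h0, norm_zero, mul_zero]; exact (S.s_pos _).le
    · exact hxs i m h0
  have hbnd : ∀ v, bnd β D.ε c s r v ≤ D.ε * c * Real.exp (β * v) := fun v =>
    max_le (min_le_right _ _) (S.r_le v)
  obtain ⟨i₀, α, c₁, hc₁, -, hlead, ⟨ld⟩⟩ := X.exists_leadDatum (σ := σ) hκ (mul_pos hε hc) hxd hh
    (X.UM_mono hκ hbnd happ) hbig
  obtain ⟨k, b, hk1, hk2, hk3⟩ := B.basis (i₀, α, e) ⟨ld⟩
  dsimp only at hk1 hk2 hk3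
  set d := B.dat k with hd
  have hdc := d.c_pos
  set αk := (B.p k).2.1 with hαk
  have hxα : x i₀ α ≠ 0 := by
    intro h0
    rw [h0, norm_zero, mul_zero] at hlead
    exact (mul_pos ((mul_pos hε hc).trans hc₁) (Real.exp_pos _)).ne hlead
  have hyα : d.y i₀ αk ≠ 0 := by
    have := d.lead_ne
    rwa [hk1] at this
  have hylev : κ i₀ * ‖d.y i₀ αk‖ = d.c * Real.exp (β * X.ν αk) := d.level _ _ hyα
  have hνα : X.ν α = X.ν αk + X.ν b := by rw [hk2, map_add]
  -- the quotient of the leading terms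
  set q : L := x i₀ α / d.y i₀ αk with hq
  have hqy : q * d.y i₀ αk = x i₀ α := div_mul_cancel₀ _ hyα
  have hqn : ‖q‖ * (d.c * Real.exp (β * X.ν αk)) ≤ s (X.ν α) := by
    rw [← hylev, mul_left_comm, ← norm_mul, hqy]; exact hxs0 _ _
  -- Multiplication by `[q]` with exponent `b` moves terms by `ν b` and takes the leading term of
  -- the basis element to a term already bounded by `s`. The slope condition transfers this bound to
  -- the other terms.
  have hqw : ∀ w, ‖q‖ * (d.c * Real.exp (β * w)) ≤
      Real.exp (D.η * max (σ * (w - X.ν αk)) 0) * s (w + X.ν b) := fun w => by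
    have h1 : ‖q‖ * (d.c * Real.exp (β * w)) =
        ‖q‖ * (d.c * Real.exp (β * X.ν αk)) * Real.exp (β * ((w + X.ν b) - X.ν α)) := by
      rw [hνα, mul_assoc, mul_assoc, ← Real.exp_add]; ring_nf
    rw [h1]
    refine (mul_le_mul_of_nonneg_right hqn (Real.exp_pos _).le).trans ((S.slope _ _).trans ?_)
    rw [hνα]; apply le_of_eq; ring_nf
  have hqw' : ∀ w, ‖q‖ * (d.c * Real.exp (β * w)) ≤ c * Real.exp (β * (w + X.ν b)) := fun w => by
    have h1 : ‖q‖ * (d.c * Real.exp (β * w)) =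
        ‖q‖ * (d.c * Real.exp (β * X.ν αk)) * Real.exp (β * ((w + X.ν b) - X.ν α)) := by
      rw [hνα, mul_assoc, mul_assoc, ← Real.exp_add]; ring_nf
    rw [h1]
    refine (mul_le_mul_of_nonneg_right (hqn.trans (S.s_le _)) (Real.exp_pos _).le).trans ?_
    rw [mul_assoc, ← Real.exp_add]; apply le_of_eq; ring_nf
  set z : ι → Mon n →₀ L := fun i => (q • d.y i).embDomain (addRightEmbedding b) with hz
  have hz_add : ∀ i m, z i (m + b) = q * d.y i m := fun i m => by
    have := Finsupp.embDomain_apply_self (addRightEmbedding b) (q • d.y i) m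
    simpa [hz] using this
  have hz_ne : ∀ i m, z i m ≠ 0 → ∃ m', m = m' + b ∧ d.y i m' ≠ 0 := fun i m hm => by
    have hm1 : m ∈ (z i).support := Finsupp.mem_support_iff.2 hm
    rw [hz, Finsupp.support_embDomain, Finset.mem_map] at hm1
    obtain ⟨m', hm', rfl⟩ := hm1
    refine ⟨m', rfl, fun h0 => hm ?_⟩
    change z i (m' + b) = 0
    rw [hz_add, h0, mul_zero]
  have hzs : ∀ i m, κ i * ‖z i m‖ ≤ s (X.ν m) ∧ κ i * ‖z i m‖ ≤ c * Real.exp (β * X.ν m) :=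
    fun i m => by
    by_cases h0 : z i m = 0
    · rw [h0, norm_zero, mul_zero]
      exact ⟨(S.s_pos _).le, (mul_pos hc (Real.exp_pos _)).le⟩
    obtain ⟨m', rfl, hy⟩ := hz_ne i m h0
    rw [hz_add, norm_mul, mul_left_comm, d.level i m' hy, map_add]
    refine ⟨(hqw _).trans ?_, hqw' _⟩
    -- The maximal terms have `σ * ν` no larger than that of the leading one, so the slope condition
    -- costs no factor here.
    have := Mon.le_of_key_le _ (d.key_le i m' hy)
    simp only [νσ_apply] at this
    rw [max_eq_right (by rw [mul_sub]; linarith), mul_zero, Real.exp_zero, one_mul]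
  -- Carries gain at least one factor `ϖ`, which lowers their relative size at slope `β` by `exp
  -- (-(β * ν (1, 0))) ≤ ε`.
  have hupper : ∀ v (j : ℕ), ∀ y, y ≤ s v → y ≤ c * Real.exp (β * v) →
      y ≤ bnd β D.ε c s r (v + (j + 1) * X.ν (1, 0)) := fun v j y h1 h2 => by
    have hu := X.u_pos
    refine le_trans (le_min (h1.trans (S.s_mono ?_)) (h2.trans ?_)) (le_max_left _ _)
    · have : 0 ≤ ((j : ℝ) + 1) * X.ν (1, 0) := by positivity
      linarith
    · have h3 : Real.exp (β * v) = Real.exp (-(β * X.ν (1, 0))) *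
        Real.exp (β * (v + X.ν (1, 0))) := by rw [← Real.exp_add]; ring_nf
      rw [h3, mul_left_comm, mul_assoc]
      refine mul_le_mul D.exp_le (mul_le_mul_of_nonneg_left (Real.exp_le_exp.2
        (mul_le_mul_of_nonneg_left ?_ hβ.le)) hc.le) (by positivity) hε.le
      have : 0 ≤ (j : ℝ) * X.ν (1, 0) := by positivity
      linarith
  have hσ' : ∀ w, max (σ * w) 0 ≤ |w| := fun w => by
    refine max_le ((le_abs_self _).trans ?_) (abs_nonneg _)
    rw [abs_mul]
    exact mul_le_of_le_one_left (abs_nonneg _) hσ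
  have ha : X.term q b ∈ X.fin (fun v => 2 * s v / d.c) := X.term_mem_fin <| by
    have h1 := hqw 0
    rw [mul_zero, Real.exp_zero, mul_one, zero_add, zero_sub] at h1
    rw [le_div_iff₀ hdc]
    refine h1.trans (mul_le_mul_of_nonneg_right ?_ (S.s_pos _).le)
    refine le_trans (Real.exp_le_exp.2 (mul_le_mul_of_nonneg_left ?_ D.η_pos.le)) (D.exp_le_two k)
    simpa using hσ' (-X.ν αk)
  refine ⟨k, X.term q b, fun i => x i - z i, ha, fun i m _ => ?_, fun i m hm => ?_,
    ?_, i₀, α, hxα, ?_, fun i m hm hm0 => ?_⟩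
  · rw [Finsupp.sub_apply]
    have h1 : ‖x i m - z i m‖ ≤ max ‖x i m‖ ‖z i m‖ :=
      (by simpa [sub_eq_add_neg] using norm_add_le_max (x i m) (-z i m))
    refine (mul_le_mul_of_nonneg_left h1 (hκ i).le).trans ?_
    rw [mul_max_of_nonneg _ _ (hκ i).le]
    exact max_le (hxs0 i m) (hzs i m).1
  · by_cases h0 : z i m = 0
    · refine hxd i m fun h1 => hm ?_
      rw [Finsupp.sub_apply, h0, h1, sub_zero]
    · obtain ⟨m', rfl, hy⟩ := hz_ne i m h0
      have := d.deg_le i m' hy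
      have := Mon.deg_add_le m' b
      omega
  · have hrep : X.term q b • X.repM d.y = X.repM z := by
      ext i : 1
      simp only [Pi.smul_apply, repM, smul_eq_mul, X.term_mul_rep, hz]
    -- The new error consists of the old one, the carries of the subtraction, and the multiples of
    -- the far tail and of the lower order terms of the basis element.
    have h1 : h - X.term q b • d.g - X.repM (fun i => x i - z i) =
        (h - X.repM x) + (X.repM x - X.repM z - X.repM (fun i => x i - z i)) -
        X.term q b • (d.g - X.repM d.y - D.f k) - X.term q b • D.f k := by
      rw [smul_sub, smul_sub, hrep]; abel
    rw [h1]
    refine sub_mem (sub_mem (add_mem happ ?_) ?_) ?_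
    · rw [mem_UM]
      intro i
      refine X.rep_sub_mem fun m _ j => ?_
      rw [inv_mul_eq_div, le_div_iff₀' (hκ i), mul_max_of_nonneg _ _ (hκ i).le]
      exact max_le (hupper _ _ _ (hxs0 i m) ((hxs0 i m).trans (S.s_le _)))
        (hupper _ _ _ (hzs i m).1 (hzs i m).2)
    · refine X.smul_mem_UM hκ (fun v w _ _ => ?_) (X.fin_le_U _ ha) (D.approx k)
      refine le_trans (le_of_eq ?_) (S.tail v w)
      rw [X.o_eq (D.t * _), ← hd]
      field_simp
    -- The single term is given a bound supported at `ν b`: the norm of `q` together with the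
    -- location of the product is needed, not just the bound for the quotient.
    · refine X.mem_UM.2 fun i => X.fin_le_U _ (X.mul_mem_fin
        (s₁ := fun v => if v = X.ν b then ‖q‖ else 0) (fun v w _ _ => ?_)
        (X.term_mem_fin (by simp)) (D.f_mem k i))
      have h0 : 0 ≤ (κ i)⁻¹ * bnd β D.ε c s r (v + w) :=
        mul_nonneg (inv_pos.2 (hκ i)).le ((S.r_nonneg _).trans (le_max_right _ _))
      by_cases hv : v = X.ν b
      swap
      · simpa [hv] using h0
      by_cases hw : |w| ≤ D.C
      swap
      · simpa [hw] using h0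
      rw [if_pos hv, if_pos hw, mul_left_comm, hv]
      refine mul_le_mul_of_nonneg_left ?_ (inv_pos.2 (hκ i)).le
      have h1 : ‖q‖ * (d.c' * Real.exp (β * w)) ≤ D.ε * (‖q‖ * (d.c * Real.exp (β * w))) := by
        rw [mul_left_comm D.ε, ← mul_assoc D.ε]
        gcongr
        exact D.c'_le k
      refine h1.trans (le_trans (le_min ?_ ?_) (le_max_left _ _))
      · refine (mul_le_mul_of_nonneg_left (hqw w) hε.le).trans ?_
        rw [← mul_assoc, add_comm w]
        refine mul_le_of_le_one_left (S.s_pos _).le (le_trans ?_ (D.ε_mul_exp_le k))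
        refine mul_le_mul_of_nonneg_left (Real.exp_le_exp.2
          (mul_le_mul_of_nonneg_left ?_ D.η_pos.le)) hε.le
        exact (hσ' _).trans ((abs_sub _ _).trans (add_le_add_left hw _))
      · rw [mul_assoc, add_comm (X.ν b)]
        exact mul_le_mul_of_nonneg_left (hqw' w) hε.le
  · have : z i₀ α = x i₀ α := by
      rw [hk2, hz_add, hqy, hk2]
    rw [Finsupp.sub_apply, this, sub_self]
  · have h0 : z i m ≠ 0 := fun h0 => hm (by rw [Finsupp.sub_apply, h0, hm0, sub_zero])
    obtain ⟨m', rfl, hy⟩ := hz_ne i m h0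
    rcases (d.key_le i m' hy).lt_or_eq with hlt | heq
    · have := (Mon.key_add_lt _ hlt b).le
      rwa [hk1, ← hk2] at this
    · obtain ⟨h1, h2⟩ := Mon.key_injective _ heq
      rw [h1, h2, hk1, ← hk2]

end TermSystem

namespace TermSystem

variable {n : ℕ} {L R : Type*} [NormedField L] [CommRing R] [TopologicalSpace R]
  [IsTopologicalRing R] {X : TermSystem n L R} {ι : Type} [Fintype ι]
  {β σ : ℝ} {κ : ι → ℝ} {J : Submodule R (ι → R)}

/-- The division algorithm removes all large terms. -/
theorem division_loop [IsUltrametricDist L] (hβ : 0 < β) (hσ : |σ| ≤ 1) (hκ : ∀ i, 0 < κ i)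
    {B : X.StdBasis β σ κ J}
    (D : B.Constants) {c : ℝ} {s r : ℝ → ℝ} (S : X.Shape β σ D.ε D.t D.η c s r)
    {e : ℕ} {h : ι → R} {x : ι → Mon n →₀ L} (hh : h ∈ J)
    (hxs : ∀ i m, x i m ≠ 0 → κ i * ‖x i m‖ ≤ s (X.ν m))
    (hxd : ∀ i m, x i m ≠ 0 → Mon.deg m ≤ e)
    (happ : h - X.repM x ∈ X.UM κ (bnd β D.ε c s r)) :
    ∃ a : B.idx → R, (∀ k, a k ∈ X.fin (fun v => 2 * s v / (B.dat k).c)) ∧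
      h - ∑ k, a k • (B.dat k).g ∈ X.UM κ (bnd β D.ε c s r) := by
  classical
  -- All main terms have degree at most `e`, so the sets of occurring keys range over subsets of a
  -- finite set. Each step removes a key and adds only smaller ones, which lowers the set in the
  -- colexicographic order.
  let K₀ : Finset (Mon.Key n) := Finset.univ.biUnion fun i : ι =>
    (Mon.finite_deg_le (n := n) e).toFinset.image (Mon.key (X.νσ σ) i)
  let supp : (ι → Mon n →₀ L) → Finset (Mon.Key n) := fun x =>
    Finset.univ.biUnion fun i => (x i).support.image (Mon.key (X.νσ σ) i)
  have mem_supp : ∀ x i m, Mon.key (X.νσ σ) i m ∈ supp x ↔ x i m ≠ 0 := fun x i m => by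
    simp only [supp, Finset.mem_biUnion, Finset.mem_univ, true_and, Finset.mem_image,
      Finsupp.mem_support_iff]
    constructor
    · rintro ⟨j, k, hk, heq⟩
      obtain ⟨rfl, rfl⟩ := Mon.key_injective _ heq
      exact hk
    · exact fun h => ⟨i, m, h, rfl⟩
  have supp_sub : ∀ x : ι → Mon n →₀ L, (∀ i m, x i m ≠ 0 → Mon.deg m ≤ e) → supp x ⊆ K₀ :=
    fun x hx => Finset.biUnion_mono fun i _ => Finset.image_subset_image fun m hm => by
      simpa using hx i m (Finsupp.mem_support_iff.1 hm)
  let rel : {A : Finset (Mon.Key n) // A ⊆ K₀} → {A : Finset (Mon.Key n) // A ⊆ K₀} → Prop :=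
    fun A A' => toColex A.1 < toColex A'.1
  have : Finite {A : Finset (Mon.Key n) // A ⊆ K₀} :=
    ((K₀.powerset).finite_toSet.subset fun A hA => by simpa using hA : {A | A ⊆ K₀}.Finite)
  have : IsTrans _ rel := ⟨fun _ _ _ => lt_trans⟩
  have : Std.Irrefl rel := ⟨fun _ => lt_irrefl _⟩
  have wf : WellFounded rel := Finite.wellFounded_of_trans_of_irrefl rel
  obtain ⟨A, hA⟩ : ∃ A : {A : Finset (Mon.Key n) // A ⊆ K₀}, A.1 = supp x :=
    ⟨⟨supp x, supp_sub x hxd⟩, rfl⟩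
  induction A using wf.induction generalizing h x with
  | _ A ih =>
  by_cases hbig : ∃ i m, D.ε * c * Real.exp (β * X.ν m) < κ i * ‖x i m‖
  · obtain ⟨k, a, x', ha, hxs', hxd', happ', i₀, α₀, hx0, hx0', hlt⟩ :=
      division_step hβ hσ hκ D S hh hxs hxd happ hbig
    obtain ⟨a', ha', h'⟩ := ih ⟨supp x', supp_sub x' hxd'⟩ (by
      change toColex (supp x') < toColex A.1
      rw [hA, Finset.Colex.toColex_lt_toColex]
      refine ⟨fun heq => ?_, fun q hq hq' => ?_⟩
      · have := (mem_supp x i₀ α₀).2 hx0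
        rw [← heq, mem_supp] at this
        exact this hx0'
      · refine ⟨Mon.key (X.νσ σ) i₀ α₀, (mem_supp _ _ _).2 hx0,
          fun h => (mem_supp _ _ _).1 h hx0', ?_⟩
        obtain ⟨i, -, hi⟩ := Finset.mem_biUnion.1 hq
        obtain ⟨m, -, rfl⟩ := Finset.mem_image.1 hi
        exact hlt i m ((mem_supp _ _ _).1 hq)
          (not_not.1 fun h => hq' ((mem_supp _ _ _).2 h)))
      (sub_mem hh (J.smul_mem a (B.dat k).g_mem)) hxs' hxd' happ' rfl
    refine ⟨a' + (Pi.single k a : B.idx → R), fun j => ?_, ?_⟩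
    · rw [Pi.add_apply]
      refine add_mem (ha' j) ?_
      by_cases hj : j = k
      · subst hj; simpa using ha
      · rw [Pi.single_eq_of_ne hj]; exact zero_mem _
    · have : ∑ j, (a' + (Pi.single k a : B.idx → R)) j • (B.dat j).g =
          ∑ j, a' j • (B.dat j).g + a • (B.dat k).g := by
        simp only [Pi.add_apply, add_smul, Finset.sum_add_distrib]
        congr 1
        rw [Finset.sum_eq_single k (fun j _ hj => by simp [hj]) (by simp)]
        simp
      rw [this, add_comm, ← sub_sub]
      exact h'
  · push Not at hbig
    refine ⟨0, fun k => zero_mem _, ?_⟩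
    simp only [Pi.zero_apply, zero_smul, Finset.sum_const_zero, sub_zero]
    have := add_mem happ (X.repM_mem_UM (s := bnd β D.ε c s r) hκ fun i m hm =>
      (le_min (hxs i m hm) (hbig i m)).trans (le_max_left _ _))
    rwa [sub_add_cancel] at this

/-- The loop is applied to the terms of a finite approximation that exceed `r`; the others are
errors already. The accuracy of the approximation is chosen so that the case `v = 0` of `tail`
absorbs it. -/
theorem division_batch [IsUltrametricDist L] (hβ : 0 < β) (hσ : |σ| ≤ 1) (hκ : ∀ i, 0 < κ i)
    {B : X.StdBasis β σ κ J}
    (D : B.Constants) {c : ℝ} {s r : ℝ → ℝ} (S : X.Shape β σ D.ε D.t D.η c s r)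
    {h : ι → R} (hh : h ∈ J) (hs : h ∈ X.UM κ fun v => max (s v) (r v)) :
    ∃ a : B.idx → R, (∀ k, a k ∈ X.fin (fun v => 2 * s v / (B.dat k).c)) ∧
      h - ∑ k, a k • (B.dat k).g ∈ X.UM κ (bnd β D.ε c s r) := by
  classical
  have hmono : Monotone fun v => max (s v) (r v) := S.s_mono.max S.r_mono
  have h1 : ∀ i, ∃ x : Mon n →₀ L, (∀ m, ‖x m‖ ≤ (κ i)⁻¹ * max (s (X.ν m)) (r (X.ν m))) ∧
      h i - X.rep x ∈ X.U (X.o ((κ i)⁻¹ * (2 * D.t * s 0))) := fun i =>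
    X.rep_exists _ (hmono.const_mul (inv_pos.2 (hκ i)).le)
      (fun v => mul_nonneg (inv_pos.2 (hκ i)).le ((S.s_pos v).le.trans (le_max_left _ _))) _
      (X.mem_UM.1 hs i) _ (mul_pos (inv_pos.2 (hκ i)) (mul_pos (mul_pos two_pos D.t_pos) (S.s_pos 0)))
  choose x hx hx' using h1
  have hx1 : ∀ i m, κ i * ‖x i m‖ ≤ max (s (X.ν m)) (r (X.ν m)) := fun i m => by
    have := hx i m
    rwa [inv_mul_eq_div, le_div_iff₀' (hκ i)] at this
  let P : ι → Mon n → Prop := fun i m => r (X.ν m) < κ i * ‖x i m‖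
  have hsplit : X.repM x = X.repM (fun i => (x i).filter (P i)) +
      X.repM (fun i => (x i).filter fun m => ¬ P i m) := by
    ext i
    simp only [repM, Pi.add_apply]
    rw [← X.rep_add_of_disjoint, Finsupp.filter_add_filter_not]
    intro m
    simp only [Finsupp.filter_apply]
    by_cases hP : P i m <;> simp [hP]
  refine division_loop hβ hσ hκ D S (e := Finset.univ.sup fun i => (x i).support.sup Mon.deg) hh
    (x := fun i => (x i).filter (P i)) (fun i m hm => ?_) (fun i m hm => ?_) ?_
  · rw [Finsupp.filter_apply] at hm ⊢
    split_ifs at hm ⊢ with hP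
    · exact (le_max_iff.1 (hx1 i m)).resolve_right (not_le.2 hP)
    · exact absurd rfl hm
  · have : m ∈ (x i).support := by
      rw [Finsupp.filter_apply] at hm
      split_ifs at hm with hP
      · exact Finsupp.mem_support_iff.2 hm
      · exact absurd rfl hm
    exact (Finset.le_sup (f := Mon.deg) this).trans
      (Finset.le_sup (f := fun i => (x i).support.sup Mon.deg) (Finset.mem_univ i))
  · have h2 : h - X.repM (fun i => (x i).filter (P i)) =
        (h - X.repM x) + X.repM (fun i => (x i).filter fun m => ¬ P i m) := by rw [hsplit]; abel
    rw [h2]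
    refine add_mem (X.mem_UM.2 fun i => X.U_mono (fun v => ?_) (hx' i))
      (X.repM_mem_UM hκ fun i m hm => ?_)
    · rw [X.o_eq, mul_assoc]
      refine mul_le_mul_of_nonneg_left ?_ (inv_pos.2 (hκ i)).le
      have := S.tail 0 v
      rwa [zero_add, ← mul_assoc] at this
    · rw [Finsupp.filter_apply] at hm ⊢
      split_ifs at hm ⊢ with hP
      · exact absurd rfl hm
      · exact (not_lt.1 hP).trans (le_max_right _ _)

/-- Each batch gains a factor `ε` on the line of slope `β`. The quotients of all batches obey the
first bound, since the later bounds are smaller and `fin` is a group. -/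
theorem division_batches [IsUltrametricDist L] (hβ : 0 < β) (hσ : |σ| ≤ 1) (hκ : ∀ i, 0 < κ i)
    {B : X.StdBasis β σ κ J} (D : B.Constants) {s r : ℝ → ℝ} (N : ℕ) {c : ℝ}
    (S : ∀ k < N, X.Shape β σ D.ε D.t D.η (D.ε ^ k * c)
      (fun v => min (s v) (D.ε ^ k * c * Real.exp (β * v))) r)
    (hc : ∀ v, s v ≤ c * Real.exp (β * v))
    {h : ι → R} (hh : h ∈ J) (hs : h ∈ X.UM κ fun v => max (s v) (r v)) :
    ∃ a : B.idx → R, (∀ k, a k ∈ X.fin (fun v => 2 * s v / (B.dat k).c)) ∧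
      h - ∑ k, a k • (B.dat k).g ∈
        X.UM κ fun v => max (min (s v) (D.ε ^ N * c * Real.exp (β * v))) (r v) := by
  induction N with
  | zero =>
    refine ⟨0, fun k => zero_mem _, ?_⟩
    simpa [min_eq_left (hc _)] using hs
  | succ N ih =>
    obtain ⟨a, ha, ha'⟩ := ih fun k hk => S k (hk.trans (Nat.lt_succ_self N))
    have hJ : h - ∑ k, a k • (B.dat k).g ∈ J :=
      sub_mem hh (sum_mem fun k _ => J.smul_mem _ (B.dat k).g_mem)
    obtain ⟨b, hb, hb'⟩ := division_batch hβ hσ hκ D (S N (Nat.lt_succ_self N)) hJ ha'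
    refine ⟨a + b, fun k => add_mem (ha k) (X.fin_mono (fun v => ?_) (hb k)), ?_⟩
    · have := (B.dat k).c_pos
      gcongr
      exact min_le_left _ _
    · simp only [Pi.add_apply, add_smul, Finset.sum_add_distrib, ← sub_sub]
      refine X.UM_mono hκ (fun v => ?_) hb'
      unfold bnd
      rw [pow_succ', mul_assoc D.ε (D.ε ^ N)]
      exact max_le_max_right _ (min_le_min_right _ (min_le_left _ _))

/-- Division with remainder for a submodule `J` of `R^ι`. Only the quotients have to be controlled
at `v` on the side of `σ`. -/
theorem exists_division [IsUltrametricDist L] (X : TermSystem n L R) (hβ : 0 < β) (hσ : |σ| ≤ 1)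
    (hκ : ∀ i, 0 < κ i) (J : Submodule R (ι → R)) :
    ∃ (K : Type) (_ : Fintype K) (g : K → ι → R) (d : K → ℝ) (ε : ℝ), 0 < ε ∧ ε < 1 ∧
      (∀ k, g k ∈ J ∧ 0 < d k ∧ g k ∈ X.UM κ fun v => d k * Real.exp (β * v)) ∧
      ∀ t > 0, ∃ η > 0, ∀ (s r : ℝ → ℝ) (c : ℝ) (N : ℕ), Monotone s → (∀ v, 0 < s v) →
        (∀ v, s v ≤ c * Real.exp (β * v)) →
        (∀ v v', s v * Real.exp (β * (v' - v)) ≤ Real.exp (η * max (σ * (v' - v)) 0) * s v') →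
        Monotone r → (∀ v, 0 ≤ r v) → (∀ v, r v ≤ ε ^ N * c * Real.exp (β * v)) →
        (∀ c', 0 < c' → c' ≤ c → ∀ v w,
          2 * t * (min (s v) (c' * Real.exp (β * v)) * X.o 1 w) ≤
            max (min (s (v + w)) (ε * c' * Real.exp (β * (v + w)))) (r (v + w))) →
        ∀ h ∈ J, h ∈ X.UM κ (fun v => max (s v) (r v)) →
        ∃ a : K → R, (∀ k, a k ∈ X.fin fun v => 2 * s v / d k) ∧
          h - ∑ k, a k • g k ∈
            X.UM κ fun v => max (min (s v) (ε ^ N * c * Real.exp (β * v))) (r v) := by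
  obtain ⟨B⟩ := X.exists_stdBasis β σ κ J
  -- One factor below `1` dominates both the gain from a factor `ϖ` and the gaps below the maximal
  -- terms of the finitely many basis elements.
  obtain ⟨ε, hε1, hε2, hε3⟩ : ∃ ε < 1, Real.exp (-(β * X.ν (1, 0))) ≤ ε ∧
      ∀ k, (B.dat k).c' ≤ ε * (B.dat k).c := by
    let T : Finset ℝ := insert (Real.exp (-(β * X.ν (1, 0))))
      (Finset.univ.image fun k => (B.dat k).c' / (B.dat k).c)
    have hT : T.Nonempty := ⟨_, Finset.mem_insert_self _ _⟩
    refine ⟨T.max' hT, ?_, T.le_max' _ (Finset.mem_insert_self _ _), fun k => ?_⟩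
    · rw [Finset.max'_lt_iff]
      intro y hy
      rcases Finset.mem_insert.1 hy with rfl | hy
      · rw [Real.exp_lt_one_iff]
        exact neg_neg_of_pos (mul_pos hβ X.u_pos)
      · obtain ⟨k, -, rfl⟩ := Finset.mem_image.1 hy
        rw [div_lt_one (B.dat k).c_pos]
        exact (B.dat k).c'_lt
    · rw [← div_le_iff₀ (B.dat k).c_pos]
      exact T.le_max' _ (Finset.mem_insert_of_mem (Finset.mem_image_of_mem _ (Finset.mem_univ k)))
  have hε0 : 0 < ε := (Real.exp_pos _).trans_le hε2
  refine ⟨B.idx, B.fintype, fun k => (B.dat k).g, fun k => (B.dat k).c, ε, hε0, hε1, fun k =>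
    ⟨(B.dat k).g_mem, (B.dat k).c_pos, ?_⟩, fun t ht => ?_⟩
  · have h1 := (B.dat k).approx
    have h2 := X.repM_mem_UM (s := fun v => (B.dat k).c * Real.exp (β * v)) hκ
      fun i m hm => ((B.dat k).level i m hm).le
    have h3 := add_mem (X.UM_mono hκ (fun v => mul_le_mul_of_nonneg_right (B.dat k).c'_lt.le
      (Real.exp_pos _).le) h1) h2
    rwa [sub_add_cancel] at h3
  have hf : ∀ k i, ∃ C : ℝ, 0 ≤ C ∧ ∃ f ∈ X.fin (fun v => if |v| ≤ C then
      (κ i)⁻¹ * ((B.dat k).c' * Real.exp (β * v)) else 0),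
      ((B.dat k).g - X.repM (B.dat k).y) i - f ∈ X.U (X.o ((κ i)⁻¹ * (t * (B.dat k).c))) :=
    fun k i => by
      have hk := inv_pos.2 (hκ i)
      have := (B.dat k).c'_pos
      have := (B.dat k).c_pos
      exact X.exists_fin_bounded (fun v => by positivity) (X.mem_UM.1 (B.dat k).approx i)
        (by positivity)
  choose C hC f hf hf' using hf
  obtain ⟨C₀, hC₀⟩ : ∃ C₀ : ℝ, ∀ k i, C k i ≤ C₀ := by
    obtain ⟨C₀, h⟩ := (Set.finite_range fun q : B.idx × ι => C q.1 q.2).bddAbove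
    exact ⟨C₀, fun k i => h ⟨(k, i), rfl⟩⟩
  obtain ⟨A, hA⟩ : ∃ A : ℝ, ∀ k, |X.ν (B.p k).2.1| ≤ A := by
    obtain ⟨C₀, h⟩ := (Set.finite_range fun k => |X.ν (B.p k).2.1|).bddAbove
    exact ⟨C₀, fun k => h ⟨k, rfl⟩⟩
  -- Both strict inequalities hold at `η = 0`, so by continuity they hold for small positive `η`.
  -- This `η` depends on `t` through the ranges of the finite approximations.
  have hη : ∀ᶠ η : ℝ in 𝓝 0, ε * Real.exp (η * (max C₀ 0 + A)) < 1 ∧ Real.exp (η * A) < 2 := by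
    refine Filter.Eventually.and ?_ ?_
    · exact ContinuousAt.eventually_lt (by fun_prop) continuousAt_const (by simpa using hε1)
    · exact ContinuousAt.eventually_lt (by fun_prop) continuousAt_const (by simp)
  obtain ⟨η, ⟨hη1, hη2⟩, hη0⟩ :=
    ((hη.filter_mono nhdsWithin_le_nhds).and (self_mem_nhdsWithin : Set.Ioi (0 : ℝ) ∈ 𝓝[>] 0)).exists
  replace hη0 : 0 < η := hη0
  let D : B.Constants :=
    { ε := ε, exp_le := hε2, c'_le := hε3, t := t, t_pos := ht, C := max C₀ 0,
      f := f,
      f_mem := fun k i => X.fin_mono (fun v => by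
        have hk := inv_pos.2 (hκ i)
        have := (B.dat k).c'_pos
        by_cases h1 : |v| ≤ C k i
        · rw [if_pos h1, if_pos (h1.trans ((hC₀ k i).trans (le_max_left _ _)))]
        · rw [if_neg h1]
          split_ifs
          · positivity
          · exact le_rfl) (hf k i)
      approx := fun k => X.mem_UM.2 fun i => by
        have := hf' k i
        refine X.U_mono (fun v => ?_) this
        rw [X.o_eq, X.o_eq (t * _), mul_assoc]
      η := η, η_pos := hη0,
      ε_mul_exp_le := fun k => le_trans (by gcongr; exact hA k) hη1.le
      exp_le_two := fun k => le_trans (by gcongr; exact hA k) hη2.le }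
  refine ⟨η, hη0, fun s r c N s_mono s_pos s_le slope r_mono r_nonneg r_le tail h hh hs =>
    division_batches hβ hσ hκ D N (fun k hk => ?_) s_le hh hs⟩
  have hc : 0 < c := by
    have := (s_pos 0).trans_le (s_le 0)
    simpa using this
  have hk' : 0 < ε ^ k * c := by positivity
  exact
  { s_mono := s_mono.min fun v w h => by gcongr
    s_pos := fun v => lt_min (s_pos v) (mul_pos hk' (Real.exp_pos _))
    s_le := fun v => min_le_right _ _
    slope := fun v v' => by
      change min (s v) (ε ^ k * c * Real.exp (β * v)) * Real.exp (β * (v' - v)) ≤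
        Real.exp (η * max (σ * (v' - v)) 0) * min (s v') (ε ^ k * c * Real.exp (β * v'))
      rw [min_mul_of_nonneg _ _ (Real.exp_pos _).le, mul_min_of_nonneg _ _ (Real.exp_pos _).le]
      refine min_le_min (slope v v') ?_
      rw [mul_assoc, ← Real.exp_add, show β * v + β * (v' - v) = β * v' by ring]
      refine le_mul_of_one_le_left (by positivity) (Real.one_le_exp ?_)
      exact mul_nonneg hη0.le (le_max_right _ _)
    r_mono := r_mono
    r_nonneg := r_nonneg
    r_le := fun v => (r_le v).trans (by
      change ε ^ N * c * _ ≤ ε * (ε ^ k * c) * _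
      rw [← mul_assoc ε, ← pow_succ']
      have := pow_le_pow_of_le_one hε0.le hε1.le (Nat.succ_le_of_lt hk)
      gcongr)
    tail := fun v w => by
      refine (tail _ hk' (mul_le_of_le_one_left hc.le (pow_le_one₀ hε0.le hε1.le)) v w).trans
        (max_le_max_right _ (le_min (le_min (min_le_left _ _) ((min_le_right _ _).trans ?_))
          (min_le_right _ _)))
      change ε * _ * _ ≤ ε ^ k * c * _
      rw [mul_assoc]
      exact mul_le_of_le_one_left (by positivity) hε1.le }

end TermSystem

/-! ### One-sided division and approximate relations -/

namespace TermSystem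

variable {n : ℕ} {L R : Type*} [NormedField L] [CommRing R] [TopologicalSpace R]
  [IsTopologicalRing R] {X : TermSystem n L R} {β : ℝ}

/-- The elements whose terms have size at most `c` on the line of slope `β`. -/
def E (X : TermSystem n L R) (β c : ℝ) : AddSubgroup R := X.U fun v => c * Real.exp (β * v)

theorem E_mono {c c' : ℝ} (h : c ≤ c') : X.E β c ≤ X.E β c' :=
  X.U_mono fun _ => mul_le_mul_of_nonneg_right h (Real.exp_pos _).le

theorem mul_mem_E {a b : R} {c c' : ℝ} (ha : a ∈ X.E β c) (hb : b ∈ X.E β c') :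
    a * b ∈ X.E β (c * c') :=
  X.mul_mem_U (fun v w _ _ => le_of_eq (by rw [mul_add, Real.exp_add]; ring)) ha hb

theorem U_le_E {s : ℝ → ℝ} {c : ℝ} (h : ∀ v, s v ≤ c * Real.exp (β * v)) : X.U s ≤ X.E β c :=
  X.U_mono h

theorem fin_le_E {s : ℝ → ℝ} {c : ℝ} (h : ∀ v, s v ≤ c * Real.exp (β * v)) : X.fin s ≤ X.E β c :=
  (X.fin_le_U s).trans (X.U_mono h)

/-- A bound by `c * exp (β * v)` that decreases relative to it beyond `P` in the direction `σ`. -/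
def soft (β σ η c P v : ℝ) : ℝ := c * Real.exp (β * v - η * max (σ * (v - P)) 0)

theorem soft_le {σ η c P : ℝ} (hη : 0 ≤ η) (hc : 0 ≤ c) (v : ℝ) :
    soft β σ η c P v ≤ c * Real.exp (β * v) := by
  refine mul_le_mul_of_nonneg_left (Real.exp_le_exp.2 ?_) hc
  have : 0 ≤ η * max (σ * (v - P)) 0 := by positivity
  linarith

/-- The decay at rate at most `η ≤ β` never outweighs the growth of `exp (β * v)`. -/
theorem soft_mono {σ η c P : ℝ} (hσ : |σ| ≤ 1) (hη : 0 ≤ η) (hηβ : η ≤ β) (hc : 0 ≤ c) :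
    Monotone (soft β σ η c P) := by
  intro v w hvw
  refine mul_le_mul_of_nonneg_left (Real.exp_le_exp.2 ?_) hc
  have h1 : max (σ * (w - P)) 0 ≤ max (σ * (v - P)) 0 + (w - v) := by
    refine max_le ?_ (add_nonneg (le_max_right _ _) (by linarith))
    have : σ * (w - v) ≤ w - v :=
      mul_le_of_le_one_left (by linarith) ((le_abs_self σ).trans hσ)
    have := le_max_left (σ * (v - P)) 0
    nlinarith
  have h2 := mul_le_mul_of_nonneg_left h1 hη
  have h3 : η * (w - v) ≤ β * (w - v) := mul_le_mul_of_nonneg_right hηβ (by linarith)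
  nlinarith

/-- Division with remainder in an ideal, with quotients controlled on one side of `P`. -/
theorem exists_soft_division [IsUltrametricDist L] (X : TermSystem n L R) (hβ₀ : X.τ₀ ≤ β)
    (hβ₁ : β ≤ X.τ₁) {σ : ℝ} (hσ : |σ| ≤ 1) (J : Ideal R) :
    ∃ (K : Type) (_ : Fintype K) (F : K → R) (D : ℝ), 0 < D ∧ (∀ k, F k ∈ J) ∧
      (∀ k, F k ∈ X.E β D) ∧
      ∀ ρ > 0, ∃ δ > 0, ∃ η > 0, η ≤ β ∧ ∀ c > 0, ∀ P : ℝ, ∀ h ∈ J,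
        h ∈ X.U (fun v => max (δ * c * Real.exp (β * v)) (soft β σ η c P v)) →
        ∃ a : K → R, (∀ k, a k ∈ X.fin fun v => D * soft β σ η c P v) ∧
          h - ∑ k, a k * F k ∈ X.E β (ρ * c) := by
  have hβ : 0 < β := X.τ₀_pos.trans_le hβ₀
  obtain ⟨K, hK, g, d, ε, hε0, hε1, hg, H⟩ := X.exists_division (ι := Unit) (κ := fun _ => 1) hβ hσ
    (fun _ => one_pos) (Submodule.comap (LinearMap.proj () : (Unit → R) →ₗ[R] R) J)
  obtain ⟨D, hD0, hD⟩ : ∃ D : ℝ, 0 < D ∧ ∀ k, d k ≤ D ∧ 2 / d k ≤ D := by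
    obtain ⟨D, hD⟩ := (Set.finite_range fun k => max (d k) (2 / d k)).bddAbove
    exact ⟨max D 1, lt_max_of_lt_right one_pos, fun k =>
      ⟨((le_max_left _ _).trans (hD ⟨k, rfl⟩)).trans (le_max_left _ _),
        ((le_max_right _ _).trans (hD ⟨k, rfl⟩)).trans (le_max_left _ _)⟩⟩
  refine ⟨K, hK, fun k => g k (), D, hD0, fun k => (hg k).1, fun k => ?_, fun ρ hρ => ?_⟩
  · have := X.mem_UM.1 (hg k).2.2 ()
    simp only [inv_one, one_mul] at this
    exact X.E_mono (hD k).1 this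
  -- After `N` batches the remainder is below `ρ * c`. Taking `t = ε ^ N / 2` puts all tail errors
  -- below `ε ^ N * c * exp (β * v)`, which serves as the bound `r`; thus `δ = ε ^ N`.
  obtain ⟨N, hN⟩ := exists_pow_lt_of_lt_one hρ hε1
  have hδ : 0 < ε ^ N := pow_pos hε0 N
  obtain ⟨η, hη0, H⟩ := H (ε ^ N / 2) (by positivity)
  refine ⟨ε ^ N, hδ, min η β, lt_min hη0 hβ, min_le_right _ _, fun c hc P h hh hs => ?_⟩
  set η' := min η β with hη'
  have hη'0 : 0 < η' := lt_min hη0 hβ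
  have slope : ∀ v v', soft β σ η' c P v * Real.exp (β * (v' - v)) ≤
      Real.exp (η * max (σ * (v' - v)) 0) * soft β σ η' c P v' := fun v v' => by
    simp only [soft]
    rw [mul_assoc, ← Real.exp_add, mul_left_comm, ← Real.exp_add]
    refine mul_le_mul_of_nonneg_left (Real.exp_le_exp.2 ?_) hc.le
    have h1 : max (σ * (v' - P)) 0 ≤ max (σ * (v - P)) 0 + max (σ * (v' - v)) 0 := by
      refine max_le ?_ (add_nonneg (le_max_right _ _) (le_max_right _ _))
      have := le_max_left (σ * (v - P)) 0
      have := le_max_left (σ * (v' - v)) 0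
      linarith
    have h2 := mul_le_mul_of_nonneg_left h1 hη'0.le
    have h3 : η' * max (σ * (v' - v)) 0 ≤ η * max (σ * (v' - v)) 0 :=
      mul_le_mul_of_nonneg_right (min_le_left _ _) (le_max_right _ _)
    linarith
  have tail : ∀ c', 0 < c' → c' ≤ c → ∀ v w,
      2 * (ε ^ N / 2) * (min (soft β σ η' c P v) (c' * Real.exp (β * v)) * X.o 1 w) ≤
        max (min (soft β σ η' c P (v + w)) (ε * c' * Real.exp (β * (v + w))))
          (ε ^ N * c * Real.exp (β * (v + w))) := fun c' _ _ v w => by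
    refine le_trans ?_ (le_max_right _ _)
    have h1 : min (soft β σ η' c P v) (c' * Real.exp (β * v)) * X.o 1 w ≤
        (c * Real.exp (β * v)) * (1 * Real.exp (β * w)) :=
      mul_le_mul ((min_le_left _ _).trans (soft_le hη'0.le hc.le v)) (X.o_le one_pos.le hβ₀ hβ₁ w)
        (X.o_pos one_pos w).le (by positivity)
    calc _ ≤ 2 * (ε ^ N / 2) * ((c * Real.exp (β * v)) * (1 * Real.exp (β * w))) := by gcongr
      _ = _ := by rw [mul_add, Real.exp_add]; ring
  have hmem : (fun _ => h) ∈ X.UM (fun _ : Unit => 1)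
      (fun v => max (soft β σ η' c P v) (ε ^ N * c * Real.exp (β * v))) := by
    refine X.mem_UM.2 fun _ => ?_
    simp only [inv_one, one_mul, max_comm]
    exact hs
  obtain ⟨a, ha, ha'⟩ := H (soft β σ η' c P) (fun v => ε ^ N * c * Real.exp (β * v)) c N
    (soft_mono hσ hη'0.le (min_le_right _ _) hc.le) (fun v => mul_pos hc (Real.exp_pos _))
    (soft_le hη'0.le hc.le) slope
    (fun v w h => by dsimp only; gcongr) (fun v => by positivity) (fun v => le_rfl)
    tail (fun _ => h) hh hmem
  refine ⟨a, fun k => X.fin_mono (fun v => ?_) (ha k), ?_⟩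
  · rw [mul_comm 2, mul_div_assoc, mul_comm D]
    exact mul_le_mul_of_nonneg_left (hD k).2 (mul_pos hc (Real.exp_pos _)).le
  · have := X.mem_UM.1 ha' ()
    simp only [Pi.sub_apply, Finset.sum_apply, Pi.smul_apply, smul_eq_mul, inv_one,
      one_mul] at this
    refine X.U_le_E (fun v => max_le ((min_le_right _ _).trans ?_) ?_) this <;> gcongr

/-- Generators of the approximate relations between finitely many elements. -/
theorem exists_relations [IsUltrametricDist L] (X : TermSystem n L R) (hβ₀ : X.τ₀ ≤ β)
    (hβ₁ : β ≤ X.τ₁) {K : Type} [Fintype K] (F : K → R) {M : ℝ} (hM : 0 < M) {ρ : ℝ}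
    (hρ : 0 < ρ) :
    ∃ (K' : Type) (_ : Fintype K') (y : K' → K → R) (d : K' → ℝ), (∀ j, 0 < d j) ∧
      (∀ j l, y j l ∈ X.E β (d j)) ∧ (∀ j, ∑ l, y j l * F l ∈ X.E β (M⁻¹ * d j)) ∧
      ∀ c > 0, ∀ u : K → R, (∀ l, u l ∈ X.E β c) → ∑ l, u l * F l ∈ X.E β (M⁻¹ * c) →
        ∃ z : K' → R, (∀ j, z j ∈ X.fin fun v => 2 * c / d j * Real.exp (β * v)) ∧
          ∀ l, u l - ∑ j, z j * y j l ∈ X.E β (ρ * c) := by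
  have hβ : 0 < β := X.τ₀_pos.trans_le hβ₀
  -- Division takes place in the graph of `u ↦ ∑ u l * F l`. The weight `M` on the value makes a
  -- vector of size `c` in the graph an approximate relation. No one-sided control is needed, so `σ
  -- = 0`.
  let κ : Option K → ℝ := fun o => o.elim M fun _ => 1
  have hκ : ∀ i, 0 < κ i := by rintro (_ | i); exacts [hM, one_pos]
  let φ : (K → R) →ₗ[R] (Option K → R) := LinearMap.pi fun o =>
    o.elim (∑ l, (LinearMap.proj l : (K → R) →ₗ[R] R).smulRight (F l)) fun l => LinearMap.proj l
  have hφn : ∀ u, φ u none = ∑ l, u l * F l := fun u => by simp [φ]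
  have hφs : ∀ u l, φ u (some l) = u l := fun u l => by simp [φ]
  obtain ⟨K', hK', g, d, ε, hε0, hε1, hg, H⟩ := X.exists_division (σ := 0) hβ (by simp) hκ
    (LinearMap.range φ)
  choose y hy using fun j => (hg j).1
  have hgm := fun j => X.mem_UM.1 (hg j).2.2
  refine ⟨K', hK', y, d, fun j => (hg j).2.1, fun j l => ?_, fun j => ?_, fun c hc u hu hu' => ?_⟩
  · have := hgm j (some l)
    rw [← hy, hφs] at this
    simpa [κ, E] using this
  · have := hgm j none
    rw [← hy, hφn] at this
    simpa [κ, E, mul_assoc] using this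
  obtain ⟨N, hN⟩ := exists_pow_lt_of_lt_one hρ hε1
  obtain ⟨η, hη0, H⟩ := H (ε / 2) (by positivity)
  have slope : ∀ v v', c * Real.exp (β * v) * Real.exp (β * (v' - v)) ≤
      Real.exp (η * max (0 * (v' - v)) 0) * (c * Real.exp (β * v')) := fun v v' => by
    simp only [zero_mul, max_self, mul_zero, Real.exp_zero, one_mul]
    rw [mul_assoc, ← Real.exp_add, show β * v + β * (v' - v) = β * v' by ring]
  have tail : ∀ c', 0 < c' → c' ≤ c → ∀ v w,
      2 * (ε / 2) * (min (c * Real.exp (β * v)) (c' * Real.exp (β * v)) * X.o 1 w) ≤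
        max (min (c * Real.exp (β * (v + w))) (ε * c' * Real.exp (β * (v + w)))) 0 :=
      fun c' hc' hcc v w => by
    refine le_trans ?_ (le_max_left _ _)
    have h1 : min (c * Real.exp (β * v)) (c' * Real.exp (β * v)) * X.o 1 w ≤
        (c' * Real.exp (β * v)) * (1 * Real.exp (β * w)) :=
      mul_le_mul (min_le_right _ _) (X.o_le one_pos.le hβ₀ hβ₁ w)
        (X.o_pos one_pos w).le (by positivity)
    have h2 : 2 * (ε / 2) * (min (c * Real.exp (β * v)) (c' * Real.exp (β * v)) * X.o 1 w) ≤
        ε * c' * Real.exp (β * (v + w)) := by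
      calc _ ≤ 2 * (ε / 2) * ((c' * Real.exp (β * v)) * (1 * Real.exp (β * w))) := by gcongr
        _ = _ := by rw [mul_add, Real.exp_add]; ring
    refine le_min (h2.trans ?_) h2
    have : ε * c' ≤ c := (mul_le_of_le_one_left hc'.le hε1.le).trans hcc
    gcongr
  have hmem : φ u ∈ X.UM κ (fun v => max (c * Real.exp (β * v)) 0) := by
    refine X.mem_UM.2 ?_
    rintro (_ | l)
    · rw [hφn]
      refine X.U_mono (fun v => ?_) hu'
      simp only [κ, Option.elim_none]
      rw [mul_assoc]
      exact mul_le_mul_of_nonneg_left (le_max_left _ _) (inv_pos.2 hM).le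
    · rw [hφs]
      refine X.U_mono (fun v => ?_) (hu l)
      simp only [κ, Option.elim_some, inv_one, one_mul]
      exact le_max_left _ _
  obtain ⟨z, hz, hz'⟩ := H (fun v => c * Real.exp (β * v)) (fun _ => 0) c N
    (fun v w h => by dsimp only; gcongr) (fun v => by positivity) (fun v => le_rfl)
    slope monotone_const (fun _ => le_rfl) (fun v => by positivity)
    tail (φ u) ⟨u, rfl⟩ hmem
  refine ⟨z, fun j => X.fin_mono (fun v => le_of_eq (by ring)) (hz j), fun l => ?_⟩
  have := X.mem_UM.1 hz' (some l)
  have h2 : (φ u - ∑ k, z k • g k) (some l) = u l - ∑ j, z j * y j l := by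
    simp only [Pi.sub_apply, hφs, Finset.sum_apply, Pi.smul_apply, smul_eq_mul, ← hy]
  rw [h2] at this
  refine X.U_le_E (fun v => ?_) this
  simp only [κ, Option.elim_some, inv_one, one_mul]
  refine max_le ((min_le_right _ _).trans ?_) (by positivity)
  gcongr

end TermSystem

/-! ### Division with quotients supported near a window -/

namespace TermSystem

variable {n : ℕ} {L R : Type*} [NormedField L] [CommRing R] [TopologicalSpace R]
  [IsTopologicalRing R] {X : TermSystem n L R} {β : ℝ}

/-- Up to distance `C` past `P` the decay costs at most the factor `exp (β * C)`, so shifting terms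
by a bounded amount preserves soft bounds up to a constant. -/
theorem le_soft {σ η c P C v : ℝ} (hc : 0 ≤ c) (hη : 0 ≤ η) (hηβ : η ≤ β) (hC : 0 ≤ C)
    (hv : σ * (v - P) ≤ C) : c * Real.exp (β * v) ≤ Real.exp (β * C) * soft β σ η c P v := by
  rw [soft, mul_left_comm, ← Real.exp_add]
  refine mul_le_mul_of_nonneg_left (Real.exp_le_exp.2 ?_) hc
  have h1 : η * max (σ * (v - P)) 0 ≤ β * C :=
    mul_le_mul hηβ (max_le hv hC) (le_max_right _ _) (hη.trans hηβ)
  linarith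

/-- At distance `C` past `P` the decay outweighs the constant `D`; this permits the truncation of
quotients. -/
theorem soft_le_of_far {σ η η' c P C ρ D v : ℝ} (hc : 0 ≤ c) (hη : η' ≤ η) (hC : 0 ≤ C)
    (hD : 0 ≤ D) (hη' : 0 ≤ η')
    (hCρ : D * Real.exp (-(η' * C)) ≤ ρ) (hv : C ≤ σ * (v - P)) :
    D * soft β σ η c P v ≤ ρ * c * Real.exp (β * v) := by
  have h1 : soft β σ η c P v ≤ c * Real.exp (β * v) * Real.exp (-(η' * C)) := by
    rw [soft, mul_assoc, ← Real.exp_add]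
    refine mul_le_mul_of_nonneg_left (Real.exp_le_exp.2 ?_) hc
    have := mul_le_mul hη (hv.trans (le_max_left _ 0)) hC (hη'.trans hη)
    linarith
  calc _ ≤ D * (c * Real.exp (β * v) * Real.exp (-(η' * C))) := mul_le_mul_of_nonneg_left h1 hD
    _ = D * Real.exp (-(η' * C)) * (c * Real.exp (β * v)) := by ring
    _ ≤ ρ * (c * Real.exp (β * v)) := by gcongr
    _ = _ := by ring

theorem sum_mul_mem_E {K : Type*} [Fintype K] {a b : K → R} {c c' : ℝ} (ha : ∀ k, a k ∈ X.E β c)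
    (hb : ∀ k, b k ∈ X.E β c') : ∑ k, a k * b k ∈ X.E β (c * c') :=
  sum_mem fun k _ => mul_mem_E (ha k) (hb k)

/-- Division in an ideal with quotients supported in a neighbourhood of the window `[A, B]` outside
of which the dividend is small. -/
theorem exists_local_division [IsUltrametricDist L] (X : TermSystem n L R) (hβ₀ : X.τ₀ ≤ β)
    (hβ₁ : β ≤ X.τ₁) (J : Ideal R) :
    ∃ (K : Type) (_ : Fintype K) (F : K → R) (D C δ : ℝ), 0 < D ∧ 0 ≤ C ∧ 0 < δ ∧
      (∀ k, F k ∈ J) ∧ (∀ k, F k ∈ X.E β D) ∧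
      ∀ c > 0, ∀ A B : ℝ, A ≤ B → ∀ h ∈ J,
        h ∈ X.U (fun v => max (δ * c * Real.exp (β * v))
          (if A ≤ v then c * Real.exp (β * min v B) else 0)) →
        ∃ a : K → R, (∀ k, a k ∈ X.fin fun v =>
            if A - C ≤ v ∧ v ≤ B + C then D * c * Real.exp (β * v) else 0) ∧
          h - ∑ k, a k * F k ∈ X.E β (c / 2) := by
  classical
  have hβ : 0 < β := X.τ₀_pos.trans_le hβ₀
  obtain ⟨K₁, _, F₁, D₁, hD₁, hF₁J, hF₁, H₁⟩ := X.exists_soft_division hβ₀ hβ₁ (σ := 1) (by simp) J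
  obtain ⟨K₂, _, F₂, D₂, hD₂, hF₂J, hF₂, H₂⟩ := X.exists_soft_division hβ₀ hβ₁ (σ := -1) (by simp) J
  obtain ⟨δ₁, hδ₁, η₁, hη₁, hη₁β, H₁⟩ := H₁ (1 / 4) (by norm_num)
  obtain ⟨δ₂, hδ₂, η₂, hη₂, hη₂β, H₂⟩ := H₂ (1 / 4) (by norm_num)
  let F : K₁ ⊕ K₂ → R := Sum.elim F₁ F₂
  set D₀ := max D₁ D₂ with hD₀
  have hD₀' : 0 < D₀ := lt_max_of_lt_left hD₁
  have hFE : ∀ l, F l ∈ X.E β D₀ := by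
    rintro (l | l)
    · exact X.E_mono (le_max_left _ _) (hF₁ l)
    · exact X.E_mono (le_max_right _ _) (hF₂ l)
  have hFJ : ∀ l, F l ∈ J := by
    rintro (l | l); exacts [hF₁J l, hF₂J l]
  -- An error `ρ * c` in the quotients contributes at most `ρ * D₀ * c = c / 2` to the remainder.
  set ρ := 1 / (2 * D₀) with hρ
  have hρ0 : 0 < ρ := by positivity
  have hρD : ρ * D₀ = 1 / 2 := by rw [hρ]; field_simp
  -- The choice `M = 4 * D₀` matches the remainders `c / 4` of the two one-sided divisions, whose
  -- quotients have size at most `D₀ * c`.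
  obtain ⟨K', _, y, d, hd, hyE, hyF, H⟩ := X.exists_relations hβ₀ hβ₁ F (M := 4 * D₀) (by positivity)
    (ρ := ρ / D₀) (by positivity)
  have hf : ∀ j l, ∃ C : ℝ, 0 ≤ C ∧ ∃ f ∈ X.fin (fun v => if |v| ≤ C then
      d j * Real.exp (β * v) else 0), y j l - f ∈ X.U (X.o (ρ / (2 * D₀) * d j)) := fun j l => by
    have := hd j
    exact X.exists_fin_bounded (fun v => by positivity) (hyE j l) (by positivity)
  choose C' hC' f hf hf' using hf
  obtain ⟨C₁, hC₁0, hC₁⟩ : ∃ C₁ : ℝ, 0 ≤ C₁ ∧ ∀ j l, C' j l ≤ C₁ := by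
    obtain ⟨C₀, h⟩ := (Set.finite_range fun q : K' × (K₁ ⊕ K₂) => C' q.1 q.2).bddAbove
    exact ⟨max C₀ 0, le_max_right _ _, fun k i => (h ⟨(k, i), rfl⟩).trans (le_max_left _ _)⟩
  have hyf : ∀ j l, y j l - f j l ∈ X.E β (ρ / (2 * D₀) * d j) := fun j l =>
    X.U_le_E (X.o_le (by have := hd j; positivity) hβ₀ hβ₁) (hf' j l)
  set D₃ := 2 * D₀ * Real.exp (β * C₁) with hD₃
  have hD₃' : 0 < D₃ := by positivity
  have hD₀₃ : D₀ ≤ D₃ := by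
    have : 1 ≤ Real.exp (β * C₁) := Real.one_le_exp (by positivity)
    nlinarith
  set η := min η₁ η₂ with hη
  have hη0 : 0 < η := lt_min hη₁ hη₂
  -- This makes `D₃ * exp (-(η * C)) ≤ ρ`, by `x ≤ exp x` for `x = D₃ / ρ`.
  set C := D₃ / ρ / η with hC
  have hC0 : 0 ≤ C := by positivity
  have hCρ : D₃ * Real.exp (-(η * C)) ≤ ρ := by
    have h1 : η * C = D₃ / ρ := by rw [hC]; field_simp
    have h2 : D₃ / ρ ≤ Real.exp (D₃ / ρ) := by linarith [Real.add_one_le_exp (D₃ / ρ)]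
    rw [h1, Real.exp_neg, mul_inv_le_iff₀ (Real.exp_pos _)]
    rwa [div_le_iff₀' hρ0] at h2
  refine ⟨K₁ ⊕ K₂, inferInstance, F, max D₃ ρ, C, min δ₁ δ₂, lt_max_of_lt_left hD₃', hC0,
    lt_min hδ₁ hδ₂, hFJ, fun k => X.E_mono (hD₀₃.trans (le_max_left _ _)) (hFE k),
    fun c hc A B hAB h hh hs => ?_⟩
  -- Two divisions of `h`: the quotients `a` decay to the right of `B`, the quotients `b` to the
  -- left of `A`.
  obtain ⟨a, ha, haF⟩ := H₁ c hc B h hh (X.U_mono (fun v => max_le_max (by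
    gcongr; exact min_le_left _ _) (by
    split_ifs
    · refine mul_le_mul_of_nonneg_left (Real.exp_le_exp.2 ?_) hc.le
      rcases le_total v B with hv | hv
      · rw [min_eq_left hv, max_eq_right (by linarith)]; simp
      · rw [min_eq_right hv, max_eq_left (by linarith)]
        nlinarith
    · exact mul_nonneg hc.le (Real.exp_pos _).le)) hs)
  obtain ⟨b, hb, hbF⟩ := H₂ c hc A h hh (X.U_mono (fun v => max_le_max (by
    gcongr; exact min_le_right _ _) (by
    split_ifs with hv
    · refine mul_le_mul_of_nonneg_left (Real.exp_le_exp.2 ?_) hc.le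
      rw [max_eq_right (by linarith), mul_zero, sub_zero]
      exact mul_le_mul_of_nonneg_left (min_le_left _ _) hβ.le
    · exact mul_nonneg hc.le (Real.exp_pos _).le)) hs)
  -- the difference of the two divisions is a relation
  let a' : K₁ ⊕ K₂ → R := Sum.elim a 0
  let b' : K₁ ⊕ K₂ → R := Sum.elim 0 b
  have ha' : ∀ l, a' l ∈ X.fin fun v => D₃ * soft β 1 η₁ c B v := by
    rintro (l | l)
    · exact X.fin_mono (fun v => mul_le_mul_of_nonneg_right ((le_max_left _ _).trans hD₀₃)
        (mul_nonneg hc.le (Real.exp_pos _).le)) (ha l)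
    · exact zero_mem _
  have hb' : ∀ l, b' l ∈ X.fin fun v => D₃ * soft β (-1) η₂ c A v := by
    rintro (l | l)
    · exact zero_mem _
    · exact X.fin_mono (fun v => mul_le_mul_of_nonneg_right ((le_max_right _ _).trans hD₀₃)
        (mul_nonneg hc.le (Real.exp_pos _).le)) (hb l)
  have haE : ∀ l, a' l ∈ X.E β (D₀ * c) := by
    rintro (l | l)
    · refine X.fin_le_E (fun v => ?_) (ha l)
      rw [mul_assoc]
      exact mul_le_mul (le_max_left _ _) (soft_le hη₁.le hc.le v)
        (mul_nonneg hc.le (Real.exp_pos _).le) hD₀'.le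
    · exact zero_mem _
  have hbE : ∀ l, b' l ∈ X.E β (D₀ * c) := by
    rintro (l | l)
    · exact zero_mem _
    · refine X.fin_le_E (fun v => ?_) (hb l)
      rw [mul_assoc]
      exact mul_le_mul (le_max_right _ _) (soft_le hη₂.le hc.le v)
        (mul_nonneg hc.le (Real.exp_pos _).le) hD₀'.le
  have haF' : h - ∑ l, a' l * F l ∈ X.E β (c / 4) := by
    simpa [a', F, div_eq_inv_mul] using haF
  have hbF' : h - ∑ l, b' l * F l ∈ X.E β (c / 4) := by
    simpa [b', F, div_eq_inv_mul] using hbF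
  obtain ⟨z, hz, hz'⟩ := H (D₀ * c) (by positivity) (a' - b') (fun l => sub_mem (haE l) (hbE l)) (by
    have h1 : ∑ l, (a' - b') l * F l = (h - ∑ l, b' l * F l) - (h - ∑ l, a' l * F l) := by
      simp only [Pi.sub_apply, sub_mul, Finset.sum_sub_distrib]; abel
    rw [h1, show (4 * D₀)⁻¹ * (D₀ * c) = c / 4 by field_simp]
    exact sub_mem hbF' haF')
  replace hz' : ∀ l, a' l - b' l - ∑ j, z j * y j l ∈ X.E β (ρ * c) := fun l => by
    have := hz' l
    rwa [show ρ / D₀ * (D₀ * c) = ρ * c by field_simp] at this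
  -- The relation `a' - b' ≈ ∑ z y` is cut at `B`. Subtracting the part left of `B` from `a'`
  -- preserves the decay on the right. The result is also `b'` plus the part right of `B`, up to
  -- small errors, so it decays on the left.
  choose z₁ hz₁ z₂ hz₂ hzz using fun j => X.fin_split (fun v => v ≤ B) (hz j)
  have hzE : ∀ j, z j ∈ X.E β (2 * (D₀ * c) / d j) := fun j => X.fin_le_U _ (hz j)
  have hz₁E : ∀ j, z₁ j ∈ X.E β (2 * (D₀ * c) / d j) := fun j =>
    X.fin_le_E (fun v => by
      have := hd j
      split_ifs
      · exact le_rfl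
      · positivity) (hz₁ j)
  have htail : ∀ (w : K' → R), (∀ j, w j ∈ X.E β (2 * (D₀ * c) / d j)) → ∀ l,
      ∑ j, w j * (y j l - f j l) ∈ X.E β (ρ * c) := fun w hw l => sum_mem fun j _ => by
    have h1 := hd j
    have := X.mul_mem_E (hw j) (hyf j l)
    rwa [show 2 * (D₀ * c) / d j * (ρ / (2 * D₀) * d j) = ρ * c by field_simp] at this
  let a₁ : K₁ ⊕ K₂ → R := fun l => a' l - ∑ j, z₁ j * f j l
  have hmain : ∀ {v w : ℝ} {j l}, |w| ≤ C' j l → 2 * (D₀ * c) / d j * Real.exp (β * v) *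
      (d j * Real.exp (β * w)) ≤ 2 * D₀ * (c * Real.exp (β * (v + w))) := fun {v w j l} _ => by
    have h1 := hd j
    rw [mul_add, Real.exp_add]
    apply le_of_eq
    field_simp
  have hs₁0 : ∀ σ η P v, 0 ≤ D₃ * soft β σ η c P v := fun σ η P v =>
    mul_nonneg hD₃'.le (mul_nonneg hc.le (Real.exp_pos _).le)
  have ha₁ : ∀ l, a₁ l ∈ X.U fun v => max (D₃ * soft β 1 η₁ c B v) (ρ * c * Real.exp (β * v)) :=
    fun l => X.U_mono (fun v => le_max_left _ _) <| X.fin_le_U _ <|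
      sub_mem (ha' l) <| sum_mem fun j _ => X.mul_mem_fin (fun v w _ _ => by
        split_ifs with h1 h2
        · refine (hmain h2).trans ?_
          rw [hD₃, mul_assoc (2 * D₀) (Real.exp _)]
          refine mul_le_mul_of_nonneg_left (le_soft hc.le hη₁.le hη₁β hC₁0 ?_) (by positivity)
          have := (abs_le.1 (h2.trans (hC₁ j l))).2
          linarith
        all_goals simpa using hs₁0 1 η₁ B (v + w)) (hz₁ j) (hf j l)
  have ha₂ : ∀ l, a₁ l ∈ X.U fun v => max (D₃ * soft β (-1) η₂ c A v) (ρ * c * Real.exp (β * v)) :=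
    fun l => by
      have h1 : a₁ l = (b' l + ∑ j, z₂ j * f j l) + ((a' l - b' l - ∑ j, z j * y j l) +
          ∑ j, z j * (y j l - f j l)) := by
        have : ∑ j, z j * (y j l - f j l) = ∑ j, z j * y j l - ∑ j, z₁ j * f j l -
            ∑ j, z₂ j * f j l := by
          rw [← Finset.sum_sub_distrib, ← Finset.sum_sub_distrib]
          refine Finset.sum_congr rfl fun j _ => ?_
          rw [hzz j]; ring
        rw [this]
        simp only [a₁]
        abel
      rw [h1]
      refine X.add_mem_U (fun v => le_max_left _ _) (fun v => le_max_right _ _)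
        (X.fin_le_U _ <| add_mem (hb' l) <| sum_mem fun j _ => X.mul_mem_fin (fun v w _ _ => ?_)
          (hz₂ j) (hf j l)) (add_mem (hz' l) (htail z hzE l))
      split_ifs with h1 h2 h3
      any_goals simpa using hs₁0 (-1) η₂ A (v + w)
      refine (hmain h3).trans ?_
      rw [hD₃, mul_assoc (2 * D₀) (Real.exp _)]
      refine mul_le_mul_of_nonneg_left (le_soft hc.le hη₂.le hη₂β hC₁0 ?_) (by positivity)
      have := (abs_le.1 (h3.trans (hC₁ j l))).1
      linarith
  -- the quotients are controlled on both sides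
  have hinf := fun l => X.U_inf
    (((soft_mono (by simp) hη₁.le hη₁β hc.le).const_mul hD₃'.le).max
      fun v w hvw => by gcongr)
    (((soft_mono (by simp) hη₂.le hη₂β hc.le).const_mul hD₃'.le).max
      fun v w hvw => by gcongr)
    ⟨ρ * c, by positivity, fun v => le_min
      ((X.o_le (by positivity) hβ₀ hβ₁ v).trans (le_max_right _ _))
      ((X.o_le (by positivity) hβ₀ hβ₁ v).trans (le_max_right _ _))⟩ (ha₁ l) (ha₂ l)
  choose f₁ hf₁ hf₁' using fun l => X.exists_fin (hinf l) (c := ρ * c) (by positivity)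
  choose g₁ hg₁ g₂ hg₂ hgg using fun l =>
    X.fin_split (fun v => A - C ≤ v ∧ v ≤ B + C) (hf₁ l)
  have hg₂E : ∀ l, g₂ l ∈ X.E β (ρ * c) := fun l => X.fin_le_E (fun v => by
    split_ifs with h1
    · positivity
    · rw [not_and_or, not_le, not_le] at h1
      rcases h1 with h1 | h1
      · exact (min_le_right _ _).trans (max_le (soft_le_of_far hc.le (min_le_right _ _) hC0 hD₃'.le
          hη0.le hCρ (by linarith)) le_rfl)
      · exact (min_le_left _ _).trans (max_le (soft_le_of_far hc.le (min_le_left _ _) hC0 hD₃'.le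
          hη0.le hCρ (by linarith)) le_rfl)) (hg₂ l)
  have hgE : ∀ l, a₁ l - g₁ l ∈ X.E β (ρ * c) := fun l => by
    have h1 : a₁ l - g₁ l = (a₁ l - f₁ l) + g₂ l := by rw [hgg l]; abel
    rw [h1]
    exact add_mem (X.U_le_E (X.o_le (by positivity) hβ₀ hβ₁) (hf₁' l)) (hg₂E l)
  refine ⟨g₁, fun l => X.fin_mono (fun v => ?_) (hg₁ l), ?_⟩
  · split_ifs with h1
    · refine (min_le_left _ _).trans (max_le ?_ ?_)
      · rw [mul_assoc (max D₃ ρ)]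
        exact mul_le_mul (le_max_left _ _) (soft_le hη₁.le hc.le v)
          (mul_nonneg hc.le (Real.exp_pos _).le) (hD₃'.le.trans (le_max_left _ _))
      · gcongr
        exact le_max_right _ _
    · exact le_rfl
  -- Replacing `a'` by `a₁` changes the remainder only by multiples of the values `∑ l, y j l * F l`
  -- of approximate relations, and by the errors of approximating `y` and truncating.
  · have h1 : h - ∑ l, g₁ l * F l = (h - ∑ l, a' l * F l) + ∑ j, z₁ j * (∑ l, y j l * F l) -
        ∑ l, (∑ j, z₁ j * (y j l - f j l)) * F l + ∑ l, (a₁ l - g₁ l) * F l := by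
      have h2 : ∑ j, z₁ j * (∑ l, y j l * F l) = ∑ l, (∑ j, z₁ j * y j l) * F l := by
        simp only [Finset.mul_sum, Finset.sum_mul]
        rw [Finset.sum_comm]
        simp only [mul_assoc]
      rw [h2]
      simp only [a₁, mul_sub, sub_mul, Finset.sum_sub_distrib]
      abel
    rw [h1]
    have hρc : X.E β (ρ * c * D₀) = X.E β (c / 2) := by
      rw [mul_right_comm, hρD]; congr 1; ring
    refine add_mem (sub_mem (add_mem (X.E_mono (by linarith) haF') (sum_mem fun j _ => ?_)) ?_) ?_
    · have h3 := hd j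
      have := X.mul_mem_E (hz₁E j) (hyF j)
      rwa [show 2 * (D₀ * c) / d j * ((4 * D₀)⁻¹ * d j) = c / 2 by field_simp; norm_num] at this
    · rw [← hρc]
      exact sum_mul_mem_E (htail z₁ hz₁E) hFE
    · rw [← hρc]
      exact sum_mul_mem_E hgE hFE

end TermSystem

/-! ### Making elements small inside a window -/

namespace TermSystem

variable {n : ℕ} {L R : Type*} [NormedField L] [CommRing R] [TopologicalSpace R]
  [IsTopologicalRing R] {X : TermSystem n L R} {β : ℝ}

/-- Bounds that are compatible with the multiplication of terms: intersections of bounds by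
exponential functions with slopes between `τ₀` and `τ₁` have this property. -/
structure IsShape (X : TermSystem n L R) (s : ℝ → ℝ) : Prop where
  mono : Monotone s
  pos : ∀ v, 0 < s v
  compat : ∀ v w, s v * X.o 1 w ≤ s (v + w)

namespace IsShape

theorem min {s s' : ℝ → ℝ} (h : X.IsShape s) (h' : X.IsShape s') :
    X.IsShape fun v => min (s v) (s' v) where
  mono := h.mono.min h'.mono
  pos v := lt_min (h.pos v) (h'.pos v)
  compat v w := by
    rw [min_mul_of_nonneg _ _ (X.o_pos one_pos w).le]
    exact min_le_min (h.compat v w) (h'.compat v w)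

theorem const_mul {s : ℝ → ℝ} (h : X.IsShape s) {c : ℝ} (hc : 0 < c) :
    X.IsShape fun v => c * s v where
  mono := h.mono.const_mul hc.le
  pos v := mul_pos hc (h.pos v)
  compat v w := by
    rw [mul_assoc]; exact mul_le_mul_of_nonneg_left (h.compat v w) hc.le

theorem exp (hβ₀ : X.τ₀ ≤ β) (hβ₁ : β ≤ X.τ₁) {c : ℝ} (hc : 0 < c) :
    X.IsShape fun v => c * Real.exp (β * v) where
  mono v w h := by
    have := X.τ₀_pos.trans_le hβ₀
    dsimp only
    gcongr
  pos v := by positivity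
  compat v w := by
    rw [mul_add, Real.exp_add, mul_assoc]
    have := X.o_le one_pos.le hβ₀ hβ₁ w
    rw [one_mul] at this
    gcongr

/-- It follows that `U s` is a neighbourhood of zero; lower bounds of this kind are what `U_inf`
asks for. -/
theorem o_le {s : ℝ → ℝ} (h : X.IsShape s) (v : ℝ) : X.o (s 0) v ≤ s v := by
  have := h.compat 0 v
  rwa [← X.o_eq, zero_add] at this

end IsShape

/-- Finitely many elements are sums of terms in a bounded range of `ν`, up to a small error. -/
theorem exists_finite_part {K : Type*} [Finite K] {F : K → R} {D e : ℝ}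
    (hF : ∀ k, F k ∈ X.E β D) (he : 0 < e) (hD : 0 ≤ D) : ∃ C : ℝ, 0 ≤ C ∧ ∃ f : K → R,
      (∀ k, f k ∈ X.fin fun v => if |v| ≤ C then D * Real.exp (β * v) else 0) ∧
      ∀ k, F k - f k ∈ X.U (X.o e) := by
  choose C' hC' f hf hf' using fun k => X.exists_fin_bounded (fun v => by positivity) (hF k) he
  obtain ⟨C₀, h⟩ := (Set.finite_range C').bddAbove
  refine ⟨max C₀ 0, le_max_right _ _, f, fun k => X.fin_mono (fun v => ?_) (hf k), hf'⟩
  split_ifs with h1 h2 h2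
  · exact le_rfl
  · exact absurd (h1.trans ((h ⟨k, rfl⟩).trans (le_max_left _ _))) h2
  · positivity
  · exact le_rfl

/-- A bound which is small outside of a window around `γ`, and constant to the right of it. -/
def window (β c ε : ℝ) (m : ℝ → ℝ) (γ W v : ℝ) : ℝ :=
  max (ε * m v) (if γ - W ≤ v then c * Real.exp (β * min v (γ + W)) else 0)

theorem window_mono {c ε γ W : ℝ} {m : ℝ → ℝ} (hβ : 0 ≤ β) (hc : 0 ≤ c) (hε : 0 ≤ ε)
    (hm : Monotone m) : Monotone (window β c ε m γ W) := by
  refine (hm.const_mul hε).max fun v w h => ?_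
  split_ifs with h1 h2
  · have := min_le_min_right (γ + W) h
    gcongr
  · exact absurd (h1.trans h) h2
  · positivity
  · exact le_rfl

/-- An element of an ideal which is small outside of a window can be made small inside the
window. -/
theorem exists_window_division [IsUltrametricDist L] (X : TermSystem n L R) (hβ₀ : X.τ₀ ≤ β)
    (hβ₁ : β ≤ X.τ₁) (J : Ideal R) :
    ∃ (K : Type) (_ : Fintype K) (F : K → R), (∀ k, F k ∈ J) ∧
      ∀ D' > 0, ∃ ε > 0, ε ≤ 1 ∧ ∃ D > 0, ∀ W : ℝ, 0 ≤ W → ∃ Λ ≥ 0,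
        ∀ s, X.IsShape s → ∀ c > 0, ∀ γ : ℝ,
        (∀ v, |v - γ| ≤ Λ → c * Real.exp (β * v) ≤ Real.exp 1 * s v) → ∀ h ∈ J,
        h ∈ X.U (window β (D' * c) ε (fun v => min (s v) (c * Real.exp (β * v))) γ W) →
        ∃ a : K → R, (∀ k, a k ∈ X.fin fun v => D * s v) ∧
          h - ∑ k, a k * F k ∈ X.U fun v => s v / 2 := by
  have hβ : 0 < β := X.τ₀_pos.trans_le hβ₀
  obtain ⟨K, _, F, D, C, δ, hD, hC, hδ, hFJ, hFE, H⟩ := X.exists_local_division hβ₀ hβ₁ J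
  refine ⟨K, inferInstance, F, hFJ, fun D' hD' => ?_⟩
  -- After `N` halvings, `D' * c * exp (β * v)` falls below `s v / 2` wherever `c * exp (β * v) ≤
  -- exp 1 * s v`.
  obtain ⟨N, hN⟩ : ∃ N : ℕ, (1 / 2 : ℝ) ^ N * D' * Real.exp 1 ≤ 1 / 2 := by
    obtain ⟨N, hN⟩ := exists_pow_lt_of_lt_one (show 0 < 1 / (2 * D' * Real.exp 1) by positivity)
      (show (1 / 2 : ℝ) < 1 by norm_num)
    refine ⟨N, ?_⟩
    have := hN.le
    rw [le_div_iff₀ (by positivity)] at this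
    linarith
  have half_pow : ∀ k : ℕ, 0 < (1 / 2 : ℝ) ^ k := fun k => by positivity
  -- Outside of the window, `ε * m` has to stay below the threshold `δ` of the local division
  -- through all `N` halvings.
  set ε := min (1 / 2) (δ * ((1 / 2) ^ N * D')) with hε
  have hε0 : 0 < ε := lt_min (by norm_num) (by have := half_pow N; positivity)
  obtain ⟨C₁, hC₁0, f, hf, hf'⟩ := X.exists_finite_part hFE
    (show 0 < ε / (D * D' * Real.exp 1) by positivity) (by positivity)
  set D₃ := max 1 (D * D) with hD₃
  have hD₃1 : 1 ≤ D₃ := le_max_left _ _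
  -- Growth of the window in one step: `C` for the support of the quotients, `C₁` for that of the `F
  -- k`, and a margin over which `exp (β * v)` grows by the factor `2 * D₃`.
  set w₀ := C + C₁ + Real.log (2 * D₃) / β with hw₀
  have hw₀0 : 0 ≤ w₀ := by
    have : 0 ≤ Real.log (2 * D₃) := Real.log_nonneg (by linarith)
    positivity
  have hw₀' : 2 * D₃ ≤ Real.exp (β * (w₀ - (C + C₁))) := by
    rw [hw₀, add_sub_cancel_left, mul_div_cancel₀ _ hβ.ne', Real.exp_log (by linarith)]
  have hlog : C + C₁ ≤ w₀ := by
    have : 0 ≤ Real.log (2 * D₃) := Real.log_nonneg (by linarith)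
    have : 0 ≤ Real.log (2 * D₃) / β := by positivity
    linarith
  refine ⟨ε, hε0, (min_le_left _ _).trans (by norm_num), D * D' * Real.exp 1, by positivity,
    -- The quotients of all `N` steps are supported within this distance of `γ`, where `s` and `c *
    -- exp (β * v)` can be compared.
    fun W hW => ⟨W + N * w₀ + C, by positivity, fun s hs c hc γ hsγ h hh hhU => ?_⟩⟩
  set m : ℝ → ℝ := fun v => min (s v) (c * Real.exp (β * v)) with hm
  have hms : X.IsShape m := hs.min (IsShape.exp hβ₀ hβ₁ hc)
  have hcm : ∀ v, |v - γ| ≤ W + N * w₀ + C → c * Real.exp (β * v) ≤ Real.exp 1 * m v :=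
    fun v hv => by
      rw [hm, mul_min_of_nonneg _ _ (Real.exp_pos 1).le]
      refine le_min (hsγ v hv) (le_mul_of_one_le_left (by positivity)
        (Real.one_le_exp zero_le_one))
  have main : ∀ k ≤ N, ∃ a : K → R, (∀ l, a l ∈ X.fin fun v => D * D' * Real.exp 1 * s v) ∧
      h - ∑ l, a l * F l ∈ X.U (window β ((1 / 2) ^ k * D' * c) ε m γ (W + k * w₀)) := by
    intro k hk
    induction k with
    | zero => exact ⟨0, fun _ => zero_mem _, by simpa using hhU⟩
    | succ k ih =>
      obtain ⟨a, ha, haU⟩ := ih (by omega)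
      have hJ : h - ∑ l, a l * F l ∈ J := sub_mem hh (sum_mem fun l _ => J.mul_mem_left _ (hFJ l))
      set h₁ := h - ∑ l, a l * F l with hh₁
      have hkN : (k : ℝ) + 1 ≤ N := by exact_mod_cast hk
      set W₁ := W + k * w₀ with hW₁
      have hW₁0 : 0 ≤ W₁ := by positivity
      have hW₁N : W₁ + w₀ ≤ W + N * w₀ := by
        have := mul_le_mul_of_nonneg_right hkN hw₀0
        rw [hW₁]; linarith
      set c₁ := (1 / 2) ^ k * D' * c with hc₁
      have hc₁0 : 0 < c₁ := by have := half_pow k; positivity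
      have hc₁D : c₁ ≤ D' * c := by
        rw [hc₁, mul_assoc]
        exact mul_le_of_le_one_left (by positivity) (pow_le_one₀ (by norm_num) (by norm_num))
      have hεc : ∀ v, ε * m v ≤ δ * c₁ * Real.exp (β * v) := fun v => by
        have h1 : ε ≤ δ * ((1 / 2) ^ k * D') := by
          refine (min_le_right _ _).trans ?_
          have : (1 / 2 : ℝ) ^ N ≤ (1 / 2) ^ k :=
            pow_le_pow_of_le_one (by norm_num) (by norm_num) (by omega)
          gcongr
        calc ε * m v ≤ δ * ((1 / 2) ^ k * D') * (c * Real.exp (β * v)) :=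
              mul_le_mul h1 (min_le_right _ _) (hms.pos v).le (by have := half_pow k; positivity)
          _ = _ := by rw [hc₁]; ring
      obtain ⟨b, hb, hbE⟩ := H c₁ hc₁0 (γ - W₁) (γ + W₁) (by linarith) h₁ hJ
        (X.U_mono (fun v => max_le_max_right _ (hεc v)) haU)
      have hbs : ∀ l, b l ∈ X.fin fun v => D * D' * Real.exp 1 * s v := fun l =>
        X.fin_mono (fun v => by
          split_ifs with hv
          · have := hsγ v (abs_le.2 ⟨by linarith, by linarith⟩)
            calc D * c₁ * Real.exp (β * v) ≤ D * (D' * c) * Real.exp (β * v) := by gcongr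
              _ = D * D' * (c * Real.exp (β * v)) := by ring
              _ ≤ D * D' * (Real.exp 1 * s v) := by gcongr
              _ = _ := by ring
          · have := hs.pos v
            positivity) (hb l)
      refine ⟨a + b, fun l => add_mem (ha l) (hbs l), ?_⟩
      have e1 : h - ∑ l, (a + b) l * F l = h₁ - ∑ l, b l * F l := by
        simp only [Pi.add_apply, add_mul, Finset.sum_add_distrib, hh₁]; abel
      rw [e1]
      -- The new remainder has two bounds: it is still small outside of a slightly larger window, by
      -- the support of the quotients, and it is at most half as large on the line of slope `β`.
      -- Intersecting them gives the next window bound.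
      set q := window β (D₃ * c₁) ε m γ (W₁ + (C + C₁)) with hq
      have hqm : ∀ v, ε * m v ≤ q v := fun v => le_max_left _ _
      have hq1 : h₁ - ∑ l, b l * F l ∈ X.U q := by
        have e2 : h₁ - ∑ l, b l * F l = h₁ - ∑ l, b l * f l - ∑ l, b l * (F l - f l) := by
          simp only [mul_sub, Finset.sum_sub_distrib]; abel
        rw [e2]
        refine sub_mem (sub_mem (X.U_mono (fun v => max_le_max_left _ ?_) haU)
          (sum_mem fun l _ => X.fin_le_U _ (X.mul_mem_fin (fun v w _ _ => ?_) (hb l) (hf l))))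
          (sum_mem fun l _ => X.mul_mem_U (fun v w _ _ => ?_) (X.fin_le_U _ (hb l)) (hf' l))
        · split_ifs with h1 h2 h2
          · have : min v (γ + W₁) ≤ min v (γ + (W₁ + (C + C₁))) :=
              min_le_min_left _ (by linarith)
            have : c₁ ≤ D₃ * c₁ := le_mul_of_one_le_left hc₁0.le hD₃1
            gcongr
          · exact absurd (by linarith) h2
          · positivity
          · exact le_rfl
        · have hq0 : 0 ≤ q (v + w) := (mul_pos hε0 (hms.pos _)).le.trans (hqm _)
          split_ifs with h1 h2
          · have hw := abs_le.1 (h2)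
            refine le_trans ?_ (le_max_right _ _)
            rw [if_pos (by linarith), min_eq_left (by linarith), mul_add, Real.exp_add]
            calc _ = D * D * c₁ * (Real.exp (β * v) * Real.exp (β * w)) := by ring
              _ ≤ _ := by gcongr; exact le_max_right _ _
          · simpa using hq0
          · simpa using hq0
          · simpa using hq0
        · refine le_trans ?_ (hqm (v + w))
          split_ifs with h1
          · rw [X.o_eq]
            have h2 := hcm v (abs_le.2 ⟨by linarith, by linarith⟩)
            have ho := X.o_pos one_pos w
            calc _ ≤ D * (D' * c) * Real.exp (β * v) * (ε / (D * D' * Real.exp 1) * X.o 1 w) := by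
                  gcongr
              _ = ε / Real.exp 1 * (c * Real.exp (β * v)) * X.o 1 w := by field_simp
              _ ≤ ε / Real.exp 1 * (Real.exp 1 * m v) * X.o 1 w := by gcongr
              _ = ε * (m v * X.o 1 w) := by field_simp
              _ ≤ _ := by gcongr; exact hms.compat v w
          · rw [zero_mul]
            exact (mul_pos hε0 (hms.pos _)).le
      have hshape := IsShape.exp (X := X) hβ₀ hβ₁ (half_pos hc₁0)
      have hq2 := X.U_inf (window_mono hβ.le (by positivity) hε0.le hms.mono) hshape.mono
        ⟨min (ε * m 0) (c₁ / 2 * Real.exp (β * 0)), lt_min (mul_pos hε0 (hms.pos 0)) (by positivity),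
          fun v => le_min ?_ ?_⟩ hq1 hbE
      · refine X.U_mono (fun v => ?_) hq2
        have e3 : (1 / 2 : ℝ) ^ (k + 1) * D' * c = c₁ / 2 := by rw [hc₁, pow_succ]; ring
        have e4 : W + (k + 1 : ℕ) * w₀ = W₁ + w₀ := by rw [hW₁]; push_cast; ring
        rw [e3, e4]
        have key : min (if γ - (W₁ + (C + C₁)) ≤ v then
              D₃ * c₁ * Real.exp (β * min v (γ + (W₁ + (C + C₁)))) else 0)
            (c₁ / 2 * Real.exp (β * v)) ≤
            if γ - (W₁ + w₀) ≤ v then c₁ / 2 * Real.exp (β * min v (γ + (W₁ + w₀))) else 0 := by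
          by_cases h1 : γ - (W₁ + (C + C₁)) ≤ v
          · rw [if_pos h1, if_pos (by linarith)]
            rcases le_total v (γ + (W₁ + w₀)) with h2 | h2
            · rw [min_eq_left h2]; exact min_le_right _ _
            · rw [min_eq_right h2,
                min_eq_right (show γ + (W₁ + (C + C₁)) ≤ v by linarith)]
              refine (min_le_left _ _).trans ?_
              have h3 : Real.exp (β * (γ + (W₁ + w₀))) = Real.exp (β * (w₀ - (C + C₁))) *
                  Real.exp (β * (γ + (W₁ + (C + C₁)))) := by rw [← Real.exp_add]; ring_nf
              rw [h3]
              calc _ = c₁ / 2 * (2 * D₃ * Real.exp (β * (γ + (W₁ + (C + C₁))))) := by ring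
                _ ≤ _ := by gcongr
          · rw [if_neg h1]
            refine (min_le_left _ _).trans ?_
            split_ifs <;> positivity
        change min (max _ _) _ ≤ max _ _
        rw [min_max_distrib_right]
        exact max_le_max (min_le_left _ _) key
      · refine le_trans ?_ (hqm v)
        rw [X.o_eq]
        have h1 := hms.o_le v
        rw [X.o_eq] at h1
        calc _ ≤ ε * m 0 * X.o 1 v :=
              mul_le_mul_of_nonneg_right (min_le_left _ _) (X.o_pos one_pos v).le
          _ = ε * (m 0 * X.o 1 v) := by ring
          _ ≤ _ := by gcongr
      · refine le_trans ?_ (hshape.o_le v)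
        rw [X.o_eq, X.o_eq (_ * _)]
        exact mul_le_mul_of_nonneg_right (min_le_right _ _) (X.o_pos one_pos v).le
  obtain ⟨a, ha, haU⟩ := main N le_rfl
  refine ⟨a, ha, X.U_mono (fun v => max_le ?_ ?_) haU⟩
  · calc ε * m v ≤ 1 / 2 * s v :=
          mul_le_mul (min_le_left _ _) (min_le_left _ _) (hms.pos v).le (by norm_num)
      _ = _ := by ring
  · have hs' : ∀ v, |v - γ| ≤ W + N * w₀ →
        (1 / 2) ^ N * D' * c * Real.exp (β * v) ≤ s v / 2 := fun v hv => by
      have h1 := hsγ v (hv.trans (by linarith))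
      have := half_pow N
      have := hs.pos v
      calc _ = (1 / 2) ^ N * D' * (c * Real.exp (β * v)) := by ring
        _ ≤ (1 / 2) ^ N * D' * (Real.exp 1 * s v) := by gcongr
        _ = (1 / 2) ^ N * D' * Real.exp 1 * s v := by ring
        _ ≤ 1 / 2 * s v := by gcongr
        _ = _ := by ring
    have hWN : 0 ≤ W + N * w₀ := by positivity
    split_ifs with h1
    · rcases le_total v (γ + (W + N * w₀)) with h2 | h2
      · rw [min_eq_left h2]
        exact hs' v (abs_le.2 ⟨by linarith, by linarith⟩)
      · rw [min_eq_right h2]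
        refine (hs' _ (abs_le.2 ⟨by linarith, by linarith⟩)).trans ?_
        have := hs.mono h2
        linarith
    · have := hs.pos v
      positivity

end TermSystem

/-! ### Gluing reductions on the two sides of a point -/

namespace TermSystem

variable {n : ℕ} {L R : Type*} [NormedField L] [CommRing R] [TopologicalSpace R]
  [IsTopologicalRing R] {X : TermSystem n L R} {β : ℝ}

/-- The elements of `J` that are bounded by a multiple of `s` can be halved by subtracting
combinations of the elements `F k` with bounded coefficients. -/
def Halves (X : TermSystem n L R) (J : Ideal R) {K : Type} [Fintype K] (F : K → R) (D : ℝ)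
    (s : ℝ → ℝ) : Prop :=
  ∀ t > 0, ∀ h ∈ J, h ∈ X.U (fun v => t * s v) → ∃ a : K → R,
    (∀ k, a k ∈ X.fin fun v => D * (t * s v)) ∧ h - ∑ k, a k * F k ∈ X.U fun v => t * s v / 2

/-- The quotients do not accumulate: the bound for the first halving dominates the later ones, and
`fin` is a group. -/
theorem Halves.iterate {J : Ideal R} {K : Type} [Fintype K] {F : K → R} {D : ℝ} {s : ℝ → ℝ}
    (hs : ∀ v, 0 ≤ s v) (hD : 0 ≤ D)
    (H : X.Halves J F D s) (hF : ∀ k, F k ∈ J) (j : ℕ) {t : ℝ} (ht : 0 < t) {h : R} (hh : h ∈ J)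
    (hU : h ∈ X.U fun v => t * s v) : ∃ a : K → R, (∀ k, a k ∈ X.fin fun v => D * (t * s v)) ∧
      h - ∑ k, a k * F k ∈ X.U fun v => (1 / 2) ^ j * (t * s v) := by
  induction j with
  | zero => exact ⟨0, fun _ => zero_mem _, by simpa using hU⟩
  | succ j ih =>
    obtain ⟨a, ha, haU⟩ := ih
    obtain ⟨b, hb, hbU⟩ := H ((1 / 2) ^ j * t) (by positivity) (h - ∑ k, a k * F k)
      (sub_mem hh (sum_mem fun k _ => J.mul_mem_left _ (hF k))) (by simpa only [mul_assoc] using haU)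
    refine ⟨a + b, fun k => add_mem (ha k) (X.fin_mono (fun v => ?_) (hb k)), ?_⟩
    · have h1 : (1 / 2 : ℝ) ^ j ≤ 1 := pow_le_one₀ (by norm_num) (by norm_num)
      have := hs v
      have h2 : (1 / 2 : ℝ) ^ j * t ≤ t := mul_le_of_le_one_left ht.le h1
      gcongr
    · have e1 : h - ∑ k, (a + b) k * F k = h - ∑ k, a k * F k - ∑ k, b k * F k := by
        simp only [Pi.add_apply, add_mul, Finset.sum_add_distrib]; abel
      rw [e1]
      exact X.U_mono (fun v => le_of_eq (by rw [pow_succ]; ring)) hbU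

/-- An element which is a combination of the `F k` with coefficients supported on either side of
`γ`, up to errors bounded by `s₁` and `s₂`, can be made small with respect to `min s₁ s₂`. -/
theorem exists_glue [IsUltrametricDist L] (X : TermSystem n L R) (hβ₀ : X.τ₀ ≤ β)
    (hβ₁ : β ≤ X.τ₁) (J : Ideal R) {K : Type} [Fintype K] {F : K → R} {D : ℝ} (hD : 0 < D)
    (hF : ∀ k, F k ∈ X.E β D) :
    ∃ (K' : Type) (_ : Fintype K') (F' : K' → R), (∀ k, F' k ∈ J) ∧
      ∃ ε > 0, ε ≤ 1 ∧ ∃ D' > 0, ∃ Λ ≥ 0, ∀ s₁ s₂, X.IsShape s₁ → X.IsShape s₂ → ∀ c > 0, ∀ γ : ℝ,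
        (∀ v, γ ≤ v → s₁ v ≤ s₂ v) → (∀ v, v ≤ γ → s₂ v ≤ s₁ v) →
        (∀ v, min (s₁ v) (s₂ v) ≤ c * Real.exp (β * v)) →
        (∀ v, |v - γ| ≤ Λ → c * Real.exp (β * v) ≤ Real.exp 1 * min (s₁ v) (s₂ v) ∧
          max (s₁ v) (s₂ v) ≤ Real.exp 1 * (c * Real.exp (β * v))) →
        (∀ v w, v ≤ γ → |w| ≤ Λ → s₁ v * Real.exp (β * w) ≤ Real.exp 1 * s₁ (v + w)) →
        (∀ v w, γ ≤ v → |w| ≤ Λ → s₂ v * Real.exp (β * w) ≤ Real.exp 1 * s₂ (v + w)) →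
        ∀ h ∈ J, ∀ a₁ a₂ : K → R,
        (∀ k, a₁ k ∈ X.fin fun v => if v ≤ γ then D * s₁ v else 0) →
        (∀ k, a₂ k ∈ X.fin fun v => if γ ≤ v then D * s₂ v else 0) →
        h - ∑ k, a₁ k * F k ∈ X.U (fun v => max (s₁ (min v γ)) (ε * s₁ v)) →
        h - ∑ k, a₂ k * F k ∈ X.U (fun v => max (if γ ≤ v then s₂ v else 0) (ε * s₂ v)) →
        ∃ b : K' → R, (∀ k, b k ∈ X.fin fun v => D' * min (s₁ v) (s₂ v)) ∧
          h - ∑ k, b k * F' k ∈ X.U fun v => min (s₁ v) (s₂ v) / 2 := by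
  have hβ : 0 < β := X.τ₀_pos.trans_le hβ₀
  obtain ⟨K', _, F', hF'J, H⟩ := X.exists_window_division hβ₀ hβ₁ J
  set D₂ := max 1 (D * D * Real.exp 1) with hD₂
  have hD₂1 : 1 ≤ D₂ := le_max_left _ _
  have hD₂' : D * D * Real.exp 1 ≤ D₂ := le_max_right _ _
  obtain ⟨ε, hε, hε1, D', hD', H⟩ := H (Real.exp 1 * D₂) (by positivity)
  -- Apart from negligible tails, multiplication by the `F k` spreads terms by at most `W`; this is
  -- the width of the window around `γ`.
  obtain ⟨W, hW, f, hf, hf'⟩ := exists_finite_part hF (show 0 < ε / D by positivity) hD.le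
  obtain ⟨Λ, hΛ, H⟩ := H W hW
  refine ⟨K', inferInstance, F', hF'J, ε, hε, hε1, D', hD', max Λ W, le_max_of_le_left hΛ,
    fun s₁ s₂ hs₁ hs₂ c hc γ h12 h21 hle hwin slope₁ slope₂ h hh a₁ a₂ ha₁ ha₂ hx₁ hx₂ => ?_⟩
  set m : ℝ → ℝ := fun v => min (s₁ v) (s₂ v) with hm
  have hms : X.IsShape m := hs₁.min hs₂
  have hmc : (fun v => min (m v) (c * Real.exp (β * v))) = m := funext fun v => min_eq_left (hle v)
  refine H m hms c hc γ (fun v hv => (hwin v (hv.trans (le_max_left _ _))).1) h hh ?_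
  rw [hmc]
  -- the coefficients on the left of `γ`
  have hU₁ : h ∈ X.U fun v => max (D₂ * s₁ (min v (γ + W))) (ε * s₁ v) := by
    have e1 : h = (h - ∑ k, a₁ k * F k) + (∑ k, a₁ k * f k + ∑ k, a₁ k * (F k - f k)) := by
      simp only [mul_sub, Finset.sum_sub_distrib]; abel
    rw [e1]
    refine add_mem (X.U_mono (fun v => max_le_max_right _ ?_) hx₁) (add_mem
      (sum_mem fun k _ => X.fin_le_U _ (X.mul_mem_fin (fun v w _ _ => ?_) (ha₁ k) (hf k)))
      (sum_mem fun k _ => X.mul_mem_U (fun v w _ _ => ?_) (X.fin_le_U _ (ha₁ k)) (hf' k)))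
    · exact (hs₁.mono (min_le_min_left _ (by linarith))).trans
        (le_mul_of_one_le_left (hs₁.pos _).le hD₂1)
    · have h0 : 0 ≤ max (D₂ * s₁ (min (v + w) (γ + W))) (ε * s₁ (v + w)) :=
        le_max_of_le_right (mul_pos hε (hs₁.pos _)).le
      split_ifs with h1 h2
      · refine le_trans ?_ (le_max_left _ _)
        rw [min_eq_left (by have := (abs_le.1 h2).2; linarith)]
        have := slope₁ v w h1 (h2.trans (le_max_right _ _))
        have h3 := hs₁.pos (v + w)
        calc _ = D * D * (s₁ v * Real.exp (β * w)) := by ring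
          _ ≤ D * D * (Real.exp 1 * s₁ (v + w)) := by gcongr
          _ = D * D * Real.exp 1 * s₁ (v + w) := by ring
          _ ≤ _ := by gcongr
      all_goals simpa using h0
    · refine le_trans ?_ (le_max_right _ _)
      split_ifs with h1
      · rw [X.o_eq]
        calc _ = ε * (s₁ v * X.o 1 w) := by field_simp
          _ ≤ _ := mul_le_mul_of_nonneg_left (hs₁.compat v w) hε.le
      · rw [zero_mul]; exact (mul_pos hε (hs₁.pos _)).le
  -- Symmetrically, quotients supported on the right of `γ` leave `h` small with respect to `s₂` on
  -- the left of `γ - W`.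
  have hU₂ : h ∈ X.U fun v => max (if γ - W ≤ v then D₂ * s₂ v else 0) (ε * s₂ v) := by
    have e1 : h = (h - ∑ k, a₂ k * F k) + (∑ k, a₂ k * f k + ∑ k, a₂ k * (F k - f k)) := by
      simp only [mul_sub, Finset.sum_sub_distrib]; abel
    rw [e1]
    refine add_mem (X.U_mono (fun v => max_le_max_right _ ?_) hx₂) (add_mem
      (sum_mem fun k _ => X.fin_le_U _ (X.mul_mem_fin (fun v w _ _ => ?_) (ha₂ k) (hf k)))
      (sum_mem fun k _ => X.mul_mem_U (fun v w _ _ => ?_) (X.fin_le_U _ (ha₂ k)) (hf' k)))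
    · have h0 := hs₂.pos v
      split_ifs with h1 h2 h2
      · exact le_mul_of_one_le_left h0.le hD₂1
      · linarith
      · positivity
      · exact le_rfl
    · have h0 : ∀ y, 0 ≤ max y (ε * s₂ (v + w)) := fun y =>
        le_max_of_le_right (mul_pos hε (hs₂.pos _)).le
      split_ifs with h1 h2 h3
      any_goals simpa only [mul_zero, zero_mul] using h0 _
      · refine le_trans ?_ (le_max_left _ _)
        have := slope₂ v w h1 (h2.trans (le_max_right _ _))
        have h3 := hs₂.pos (v + w)
        calc _ = D * D * (s₂ v * Real.exp (β * w)) := by ring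
          _ ≤ D * D * (Real.exp 1 * s₂ (v + w)) := by gcongr
          _ = D * D * Real.exp 1 * s₂ (v + w) := by ring
          _ ≤ _ := by gcongr
      · have := (abs_le.1 h2).1
        linarith
    · refine le_trans ?_ (le_max_right _ _)
      split_ifs with h1
      · rw [X.o_eq]
        calc _ = ε * (s₂ v * X.o 1 w) := by field_simp
          _ ≤ _ := mul_le_mul_of_nonneg_left (hs₂.compat v w) hε.le
      · rw [zero_mul]; exact (mul_pos hε (hs₂.pos _)).le
  have mono₁ : Monotone fun v => max (D₂ * s₁ (min v (γ + W))) (ε * s₁ v) := fun v w hvw =>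
    max_le_max (mul_le_mul_of_nonneg_left (hs₁.mono (min_le_min_right _ hvw)) (by positivity))
      (mul_le_mul_of_nonneg_left (hs₁.mono hvw) hε.le)
  have mono₂ : Monotone fun v => max (if γ - W ≤ v then D₂ * s₂ v else 0) (ε * s₂ v) :=
    fun v w hvw => by
      refine max_le_max ?_ (mul_le_mul_of_nonneg_left (hs₂.mono hvw) hε.le)
      have h0 := hs₂.pos w
      have := hs₂.mono hvw
      split_ifs with h1 h2 h2
      · gcongr
      · linarith
      · positivity
      · exact le_rfl
  -- To the left of `γ - W` the minimum of the bounds is `s₂`, to the right of `γ + W` it is `s₁`.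
  -- In both regions the matching description shows that `h` is small, up to the constant allowed on
  -- the right, so `h` satisfies the window hypothesis.
  refine X.U_mono (fun v => ?_) (X.U_inf mono₁ mono₂ ⟨ε * m 0, mul_pos hε (hms.pos 0), fun v => ?_⟩
    hU₁ hU₂)
  · have hc' : 0 < c * Real.exp (β * v) := by positivity
    rw [window]
    rcases lt_or_ge v (γ - W) with hv | hv
    · refine (min_le_right _ _).trans (le_trans ?_ (le_max_left _ _))
      rw [if_neg (by linarith), max_eq_right (mul_pos hε (hs₂.pos _)).le, hm]
      dsimp only
      rw [min_eq_right (h21 v (by linarith))]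
    simp only [if_pos hv]
    rcases le_or_gt v (γ + W) with hv' | hv'
    · refine (min_le_left _ _).trans (le_trans ?_ (le_max_right _ _))
      rw [min_eq_left hv']
      have h1 := (le_max_left _ _).trans (hwin v ((abs_le.2 ⟨by linarith, by linarith⟩ :
        |v - γ| ≤ W).trans (le_max_right _ _))).2
      have h2 : D₂ * s₁ v ≤ Real.exp 1 * D₂ * c * Real.exp (β * v) := by
        calc _ ≤ D₂ * (Real.exp 1 * (c * Real.exp (β * v))) := by gcongr
          _ = _ := by ring
      refine max_le (by simpa [mul_assoc] using h2) (le_trans ?_ (by simpa [mul_assoc] using h2))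
      exact mul_le_mul_of_nonneg_right (hε1.trans hD₂1) (hs₁.pos v).le
    · refine (min_le_left _ _).trans (max_le (le_trans ?_ (le_max_right _ _))
        (le_trans ?_ (le_max_left _ _)))
      · rw [min_eq_right hv'.le]
        have h1 := (le_max_left _ _).trans (hwin (γ + W) ((abs_le.2 ⟨by linarith, by linarith⟩ :
          |γ + W - γ| ≤ W).trans (le_max_right _ _))).2
        calc _ ≤ D₂ * (Real.exp 1 * (c * Real.exp (β * (γ + W)))) := by gcongr
          _ = _ := by ring
      · rw [hm]
        dsimp only
        rw [min_eq_left (h12 v (by linarith))]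
  · have h1 : X.o (ε * m 0) v ≤ ε * m v := by
      rw [X.o_eq, mul_assoc]
      have := hms.o_le v
      rw [X.o_eq] at this
      exact mul_le_mul_of_nonneg_left this hε.le
    refine h1.trans (le_min (le_trans ?_ (le_max_right _ _)) (le_trans ?_ (le_max_right _ _)))
    · exact mul_le_mul_of_nonneg_left (min_le_left _ _) hε.le
    · exact mul_le_mul_of_nonneg_left (min_le_right _ _) hε.le

end TermSystem

/-! ### Reduction with respect to two nearby slopes -/

namespace TermSystem

variable {n : ℕ} {L R : Type*} [NormedField L] [CommRing R] [TopologicalSpace R]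
  [IsTopologicalRing R] {X : TermSystem n L R} {β : ℝ}

/-- The pointwise minimum of two exponential functions. -/
def minExp (a d l₁ l₂ v : ℝ) : ℝ := min (l₁ * Real.exp (a * v)) (l₂ * Real.exp (d * v))

theorem isShape_minExp {a d l₁ l₂ : ℝ} (ha₀ : X.τ₀ ≤ a) (ha₁ : a ≤ X.τ₁) (hd₀ : X.τ₀ ≤ d)
    (hd₁ : d ≤ X.τ₁) (hl₁ : 0 < l₁) (hl₂ : 0 < l₂) : X.IsShape (minExp a d l₁ l₂) :=
  (IsShape.exp ha₀ ha₁ hl₁).min (IsShape.exp hd₀ hd₁ hl₂)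

theorem mul_minExp {a d l₁ l₂ t : ℝ} (ht : 0 ≤ t) (v : ℝ) :
    t * minExp a d l₁ l₂ v = minExp a d (t * l₁) (t * l₂) v := by
  rw [minExp, minExp, mul_min_of_nonneg _ _ ht, mul_assoc, mul_assoc]

/-- The ideal `J` has finitely many elements by which all elements of `J` can be reduced
uniformly with respect to the norms of slope `a` and `d`. -/
def Reduces (X : TermSystem n L R) (J : Ideal R) (a d : ℝ) : Prop :=
  ∃ (K : Type) (_ : Fintype K) (F : K → R) (D : ℝ), 0 < D ∧ (∀ k, F k ∈ J) ∧
    ∀ l₁ > 0, ∀ l₂ > 0, ∀ h ∈ J, h ∈ X.U (minExp a d l₁ l₂) → ∃ c : K → R,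
      (∀ k, c k ∈ X.fin fun v => D * minExp a d l₁ l₂ v) ∧
      h - ∑ k, c k * F k ∈ X.U fun v => minExp a d l₁ l₂ v / 2

theorem Reduces.symm {J : Ideal R} {a d : ℝ} (H : X.Reduces J a d) : X.Reduces J d a := by
  obtain ⟨K, hK, F, D, hD, hF, H⟩ := H
  refine ⟨K, hK, F, D, hD, hF, fun l₁ h₁ l₂ h₂ h hh hU => ?_⟩
  have e : minExp d a l₁ l₂ = minExp a d l₂ l₁ := funext fun v => min_comm _ _
  rw [e] at hU ⊢
  exact H l₂ h₂ l₁ h₁ h hh hU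

/-- Multiplying `minExp` by `t` only rescales its two constants, over which the hypothesis is
uniform. -/
theorem halves_minExp {J : Ideal R} {K : Type} [Fintype K] {F : K → R} {D a d : ℝ}
    (H : ∀ l₁ > 0, ∀ l₂ > 0, ∀ h ∈ J, h ∈ X.U (minExp a d l₁ l₂) → ∃ c : K → R,
      (∀ k, c k ∈ X.fin fun v => D * minExp a d l₁ l₂ v) ∧
      h - ∑ k, c k * F k ∈ X.U fun v => minExp a d l₁ l₂ v / 2) {l₁ l₂ : ℝ} (hl₁ : 0 < l₁)
    (hl₂ : 0 < l₂) : X.Halves J F D (minExp a d l₁ l₂) := fun t ht h hh hU => by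
  simp only [mul_minExp ht.le] at hU ⊢
  exact H _ (mul_pos ht hl₁) _ (mul_pos ht hl₂) h hh hU

/-- Relative to `exp (β * v)`, the bound `minExp β (β - σ * θ)` drops only in the direction `σ` and
at rate at most `θ`, so it is admissible for division at slope `β`. The remainder can be made small
up to any prescribed point `γ` in that direction. Beyond a suitable `γ` the element `h` itself is
negligible, and `exists_glue` combines the two facts. -/
theorem exists_reduces_near_of_sign [IsUltrametricDist L] (X : TermSystem n L R) (hβ₀ : X.τ₀ ≤ β)
    (hβ₁ : β ≤ X.τ₁) (J : Ideal R) {σ : ℝ} (hσ : σ = 1 ∨ σ = -1) :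
    ∃ η > 0, ∀ θ, 0 ≤ θ → θ ≤ η → X.τ₀ ≤ β - σ * θ → β - σ * θ ≤ X.τ₁ →
      X.Reduces J β (β - σ * θ) := by
  have hβ : 0 < β := X.τ₀_pos.trans_le hβ₀
  have hσ1 : |σ| ≤ 1 := by rcases hσ with rfl | rfl <;> simp
  have hσσ : σ * σ = 1 := by rcases hσ with rfl | rfl <;> simp
  obtain ⟨K, _, g, d, ε₀, hε₀, hε₀1, hg, H⟩ := X.exists_division (ι := Unit) (κ := fun _ => 1) hβ
    hσ1 (fun _ => one_pos) (Submodule.comap (LinearMap.proj () : (Unit → R) →ₗ[R] R) J)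
  obtain ⟨D, hD0, hD⟩ : ∃ D : ℝ, 0 < D ∧ ∀ k, d k ≤ D ∧ 2 / d k ≤ D := by
    obtain ⟨D, hD⟩ := (Set.finite_range fun k => max (d k) (2 / d k)).bddAbove
    exact ⟨max D 1, lt_max_of_lt_right one_pos, fun k =>
      ⟨((le_max_left _ _).trans (hD ⟨k, rfl⟩)).trans (le_max_left _ _),
        ((le_max_right _ _).trans (hD ⟨k, rfl⟩)).trans (le_max_left _ _)⟩⟩
  let F : K → R := fun k => g k ()
  have hFJ : ∀ k, F k ∈ J := fun k => (hg k).1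
  have hFE : ∀ k, F k ∈ X.E β D := fun k => by
    have := X.mem_UM.1 (hg k).2.2 ()
    simp only [inv_one, one_mul] at this
    exact X.E_mono (hD k).1 this
  obtain ⟨K', _, F', hF'J, ε, hε, hε1, D', hD', Λ, hΛ, G⟩ := X.exists_glue hβ₀ hβ₁ J hD0 hFE
  obtain ⟨η, hη0, H⟩ := H (ε₀ / 2) (by positivity)
  -- Then `θ * Λ ≤ 1`, so within distance `Λ` of `γ` the bound and the exponential of slope `β`
  -- through its value at `γ` differ by a factor at most `exp 1`.
  refine ⟨min η (1 / (Λ + 1)), lt_min hη0 (by positivity), fun θ hθ0 hθ hd₀ hd₁ => ?_⟩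
  have hθη : θ ≤ η := hθ.trans (min_le_left _ _)
  have hθΛ : θ * Λ ≤ 1 := by
    have := hθ.trans (min_le_right _ _)
    rw [le_div_iff₀ (by positivity)] at this
    nlinarith
  refine ⟨K ⊕ K', inferInstance, Sum.elim F F', max D D', lt_max_of_lt_left hD0,
    fun k => by rcases k with k | k; exacts [hFJ k, hF'J k], fun l₁ hl₁ l₂ hl₂ h hh hU => ?_⟩
  set s := minExp β (β - σ * θ) l₁ l₂ with hs
  have hss : X.IsShape s := isShape_minExp hβ₀ hβ₁ hd₀ hd₁ hl₁ hl₂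
  have hs_le : ∀ v, s v ≤ l₁ * Real.exp (β * v) := fun v => min_le_left _ _
  have slope : ∀ v v', s v * Real.exp (β * (v' - v)) ≤
      Real.exp (θ * max (σ * (v' - v)) 0) * s v' := fun v v' => by
    rw [hs, minExp, minExp, min_mul_of_nonneg _ _ (Real.exp_pos _).le,
      mul_min_of_nonneg _ _ (Real.exp_pos _).le, mul_assoc, mul_assoc, ← Real.exp_add,
      ← Real.exp_add, mul_left_comm, mul_left_comm _ l₂, ← Real.exp_add, ← Real.exp_add]
    have h1 : 0 ≤ θ * max (σ * (v' - v)) 0 := mul_nonneg hθ0 (le_max_right _ _)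
    have h2 : θ * (σ * (v' - v)) ≤ θ * max (σ * (v' - v)) 0 :=
      mul_le_mul_of_nonneg_left (le_max_left _ _) hθ0
    refine min_le_min (mul_le_mul_of_nonneg_left (Real.exp_le_exp.2 ?_) hl₁.le)
      (mul_le_mul_of_nonneg_left (Real.exp_le_exp.2 ?_) hl₂.le)
    · linarith
    · linarith
  -- a cut beyond the terms of `h`
  obtain ⟨γ₀, hγ₀, hf, hhf, hht⟩ := X.exists_fin_bounded (fun v => (hss.pos v).le) hU
    (mul_pos hε (hss.pos 0))
  have hht' : h - hf ∈ X.U fun v => ε * s v := X.U_mono (fun v => by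
    rw [X.o_eq, mul_assoc, ← X.o_eq (s 0)]
    exact mul_le_mul_of_nonneg_left (hss.o_le v) hε.le) hht
  set γ := σ * γ₀ with hγ
  -- The exponential `c * exp (β * v)` agrees with `s` at `γ`; it is at most `s` before `γ` and at
  -- least `s` beyond, in the direction `σ`.
  set c := s γ * Real.exp (-(β * γ)) with hc
  have hc0 : 0 < c := mul_pos (hss.pos _) (Real.exp_pos _)
  have hcv : ∀ v, c * Real.exp (β * v) = s γ * Real.exp (β * (v - γ)) := fun v => by
    rw [hc, mul_assoc, ← Real.exp_add]; ring_nf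
  have hsc : ∀ v, s v ≤ Real.exp (θ * max (σ * (γ - v)) 0) * (c * Real.exp (β * v)) := fun v => by
    have := mul_le_mul_of_nonneg_right (slope v γ) (Real.exp_pos (β * (v - γ))).le
    rw [mul_assoc, ← Real.exp_add, mul_assoc, ← hcv] at this
    have e : β * (γ - v) + β * (v - γ) = 0 := by ring
    rwa [e, Real.exp_zero, mul_one] at this
  have hcs : ∀ v, c * Real.exp (β * v) ≤ Real.exp (θ * max (σ * (v - γ)) 0) * s v := fun v => by
    rw [hcv]; exact slope γ v
  have habs : ∀ w, |w| ≤ Λ → Real.exp (θ * max (σ * w) 0) ≤ Real.exp 1 := fun w hw => by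
    refine Real.exp_le_exp.2 (le_trans (mul_le_mul_of_nonneg_left (max_le ?_ hΛ) hθ0) hθΛ)
    refine (le_abs_self _).trans ?_
    rw [abs_mul]
    exact (mul_le_of_le_one_left (abs_nonneg _) hσ1).trans hw
  have hcΛ : ∀ v, |v - γ| ≤ Λ → c * Real.exp (β * v) ≤ Real.exp 1 * s v := fun v hv =>
    (hcs v).trans (mul_le_mul_of_nonneg_right (habs _ hv) (hss.pos v).le)
  have hsΛ : ∀ v, |v - γ| ≤ Λ → s v ≤ Real.exp 1 * (c * Real.exp (β * v)) := fun v hv =>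
    (hsc v).trans (mul_le_mul_of_nonneg_right (habs _ (by rwa [abs_sub_comm])) (by positivity))
  have one_le : (1 : ℝ) ≤ Real.exp 1 := Real.one_le_exp zero_le_one
  have hcΛ' : ∀ v, c * Real.exp (β * v) ≤ Real.exp 1 * (c * Real.exp (β * v)) := fun v =>
    le_mul_of_one_le_left (by positivity) one_le
  have hslope : ∀ v w, |w| ≤ Λ → s v * Real.exp (β * w) ≤ Real.exp 1 * s (v + w) := fun v w hw => by
    have := slope v (v + w)
    rw [add_sub_cancel_left] at this
    exact this.trans (mul_le_mul_of_nonneg_right (habs _ hw) (hss.pos _).le)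
  have hslope' : ∀ v w, c * Real.exp (β * v) * Real.exp (β * w) ≤
      Real.exp 1 * (c * Real.exp (β * (v + w))) := fun v w => by
    rw [mul_assoc, ← Real.exp_add, ← mul_add]; exact hcΛ' _
  have hcshape : X.IsShape fun v => c * Real.exp (β * v) := IsShape.exp hβ₀ hβ₁ hc0
  -- Enough batches for the remainder to fall below `ε * c * exp (β * v)`.
  obtain ⟨N, hN⟩ := exists_pow_lt_of_lt_one (show 0 < ε * c / l₁ by positivity) hε₀1
  rw [lt_div_iff₀ hl₁] at hN
  obtain ⟨a, ha, haU⟩ := H s (fun _ => 0) l₁ N hss.mono hss.pos hs_le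
    (fun v v' => (slope v v').trans (mul_le_mul_of_nonneg_right (Real.exp_le_exp.2
      (mul_le_mul_of_nonneg_right hθη (le_max_right _ _))) (hss.pos _).le))
    monotone_const (fun _ => le_rfl) (fun v => by positivity)
    (fun c' hc' _ v w => by
      refine le_trans (le_min ?_ ?_) (le_max_left _ _)
      · rw [mul_div_cancel₀ _ two_ne_zero]
        refine le_trans ?_ (hss.compat v w)
        refine (mul_le_of_le_one_left ?_ hε₀1.le).trans
          (mul_le_mul_of_nonneg_right (min_le_left _ _) (X.o_pos one_pos w).le)
        exact mul_nonneg (le_min (hss.pos v).le (by positivity)) (X.o_pos one_pos w).le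
      · have := X.o_le one_pos.le hβ₀ hβ₁ w
        rw [mul_div_cancel₀ _ two_ne_zero, mul_assoc, mul_add, Real.exp_add]
        refine mul_le_mul_of_nonneg_left ?_ hε₀.le
        rw [← mul_assoc]
        exact mul_le_mul (min_le_right _ _) (by simpa using this) (X.o_pos one_pos w).le
          (by positivity)) (fun _ => h) hh
    (X.mem_UM.2 fun _ => X.U_mono (fun v => by simp) hU)
  have ha' : ∀ k, a k ∈ X.fin fun v => D * s v := fun k => X.fin_mono (fun v => by
    rw [mul_div_right_comm]
    exact mul_le_mul_of_nonneg_right (hD k).2 (hss.pos v).le) (ha k)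
  have haU' : h - ∑ k, a k * F k ∈ X.U fun v => ε * (c * Real.exp (β * v)) := by
    have := X.mem_UM.1 haU ()
    simp only [Pi.sub_apply, Finset.sum_apply, Pi.smul_apply, smul_eq_mul, inv_one,
      one_mul] at this
    refine X.U_mono (fun v => max_le ((min_le_right _ _).trans ?_) (by positivity)) this
    rw [← mul_assoc]
    gcongr
  choose b₁ hb₁ b₂ hb₂ hbb using fun k => X.fin_split (fun v => σ * v ≤ γ₀) (ha' k)
  have hsum : ∀ k, a k * F k = b₁ k * F k + b₂ k * F k := fun k => by rw [hbb k, add_mul]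
  -- The element `h'` has two descriptions: adding back the `b₁` part gives `h`, negligible beyond
  -- `γ`, and subtracting the `b₂` part gives the remainder of the division, small compared with `c
  -- * exp (β * v)`.
  set h' := h - ∑ k, b₁ k * F k with hh'
  have hJ : h' ∈ J := sub_mem hh (sum_mem fun k _ => J.mul_mem_left _ (hFJ k))
  have e1 : h' - ∑ k, (-b₁) k * F k = h := by
    simp [hh', neg_mul]
  have e2 : h' - ∑ k, b₂ k * F k = h - ∑ k, a k * F k := by
    simp only [hsum, hh', Finset.sum_add_distrib]; abel
  obtain ⟨b, hb, hbU⟩ : ∃ b : K' → R, (∀ k, b k ∈ X.fin fun v => D' * s v) ∧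
      h' - ∑ k, b k * F' k ∈ X.U fun v => s v / 2 := by
    -- The bound that is smaller to the right of `γ` comes first in `exists_glue`; this is `s` for
    -- `σ = 1` and the exponential for `σ = -1`.
    rcases hσ with rfl | rfl
    · rw [one_mul] at hγ
      obtain ⟨b, hb, hbU⟩ := G s (fun v => c * Real.exp (β * v)) hss hcshape c hc0 γ
        (fun v hv => (hsc v).trans (by rw [max_eq_right (by linarith)]; simp))
        (fun v hv => (hcs v).trans (by rw [max_eq_right (by linarith)]; simp))
        (fun v => min_le_right _ _)
        (fun v hv => ⟨by
          rw [mul_min_of_nonneg _ _ (Real.exp_pos _).le]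
          exact le_min (hcΛ v hv) (hcΛ' v), max_le (hsΛ v hv) (hcΛ' v)⟩)
        (fun v w _ hw => hslope v w hw) (fun v w _ _ => hslope' v w) h' hJ (-b₁) b₂
        (fun k => neg_mem (X.fin_mono (fun v => by simp [hγ]) (hb₁ k)))
        (fun k => X.fin_mono (fun v => by
          split_ifs with h1 h2 h2
          · positivity
          · exact le_rfl
          · exact mul_le_mul_of_nonneg_left ((hsc v).trans
              (by rw [max_eq_right (by linarith)]; simp)) hD0.le
          · linarith) (hb₂ k))
        (by
          rw [e1, ← add_sub_cancel hf h]
          refine X.add_mem_U (fun v => ?_) (fun v => le_max_right _ _) (X.fin_le_U _ hhf) hht'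
          split_ifs with h1
          · rw [min_eq_left (by linarith [(abs_le.1 h1).2])]
            exact le_max_left _ _
          · exact (hss.pos _).le.trans (le_max_left _ _))
        (by rw [e2]; exact X.U_mono (fun v => le_max_right _ _) haU')
      exact ⟨b, fun k => X.fin_mono (fun v => mul_le_mul_of_nonneg_left (min_le_left _ _) hD'.le)
        (hb k), X.U_mono (fun v => div_le_div_of_nonneg_right (min_le_left _ _) two_pos.le) hbU⟩
    · obtain ⟨b, hb, hbU⟩ := G (fun v => c * Real.exp (β * v)) s hcshape hss c hc0 γ
        (fun v hv => (hcs v).trans (by rw [max_eq_right (by linarith)]; simp))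
        (fun v hv => (hsc v).trans (by rw [max_eq_right (by linarith)]; simp))
        (fun v => min_le_left _ _)
        (fun v hv => ⟨by
          rw [mul_min_of_nonneg _ _ (Real.exp_pos _).le]
          exact le_min (hcΛ' v) (hcΛ v hv), max_le (hcΛ' v) (hsΛ v hv)⟩)
        (fun v w _ _ => hslope' v w) (fun v w _ hw => hslope v w hw) h' hJ b₂ (-b₁)
        (fun k => X.fin_mono (fun v => by
          split_ifs with h1 h2 h2
          · positivity
          · exact le_rfl
          · exact mul_le_mul_of_nonneg_left ((hsc v).trans
              (by rw [max_eq_right (by linarith)]; simp)) hD0.le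
          · linarith) (hb₂ k))
        (fun k => neg_mem (X.fin_mono (fun v => by
          split_ifs with h1 h2 h2
          · exact le_rfl
          · linarith
          · have := hss.pos v
            positivity
          · exact le_rfl) (hb₁ k)))
        (by rw [e2]; exact X.U_mono (fun v => le_max_right _ _) haU')
        (by
          rw [e1, ← add_sub_cancel hf h]
          refine X.add_mem_U (fun v => ?_) (fun v => le_max_right _ _) (X.fin_le_U _ hhf) hht'
          split_ifs with h1 h2 h2
          · exact le_max_left _ _
          · linarith [(abs_le.1 h1).1]
          · exact (hss.pos _).le.trans (le_max_left _ _)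
          · exact le_max_left _ _)
      exact ⟨b, fun k => X.fin_mono (fun v => mul_le_mul_of_nonneg_left (min_le_right _ _) hD'.le)
        (hb k), X.U_mono (fun v => div_le_div_of_nonneg_right (min_le_right _ _) two_pos.le) hbU⟩
  refine ⟨Sum.elim b₁ b, ?_, ?_⟩
  · rintro (k | k)
    · refine X.fin_mono (fun v => ?_) (hb₁ k)
      have := hss.pos v
      split_ifs
      · exact mul_le_mul_of_nonneg_right (le_max_left _ _) this.le
      · positivity
    · exact X.fin_mono (fun v => mul_le_mul_of_nonneg_right (le_max_right _ _) (hss.pos v).le) (hb k)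
  · simpa [Fintype.sum_sum_type, ← sub_sub] using hbU

/-- Reduction with respect to two norms of nearby slopes. -/
theorem exists_reduces_near [IsUltrametricDist L] (X : TermSystem n L R) (hβ₀ : X.τ₀ ≤ β)
    (hβ₁ : β ≤ X.τ₁) (J : Ideal R) : ∃ η > 0, ∀ d, X.τ₀ ≤ d → d ≤ X.τ₁ → |d - β| ≤ η →
      X.Reduces J β d := by
  obtain ⟨η₁, hη₁, H₁⟩ := X.exists_reduces_near_of_sign hβ₀ hβ₁ J (Or.inl rfl)
  obtain ⟨η₂, hη₂, H₂⟩ := X.exists_reduces_near_of_sign hβ₀ hβ₁ J (Or.inr rfl)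
  refine ⟨min η₁ η₂, lt_min hη₁ hη₂, fun d hd₀ hd₁ hd => ?_⟩
  obtain ⟨h1, h2⟩ := abs_le.1 hd
  have := min_le_left η₁ η₂
  have := min_le_right η₁ η₂
  rcases le_total d β with h | h
  · have e : β - 1 * (β - d) = d := by ring
    have := H₁ (β - d) (by linarith) (by linarith)
    rw [e] at this
    exact this hd₀ hd₁
  · have e : β - -1 * (d - β) = d := by ring
    have := H₂ (d - β) (by linarith) (by linarith)
    rw [e] at this
    exact this hd₀ hd₁

end TermSystem

/-! ### From nearby slopes to the whole interval of slopes -/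

namespace TermSystem

variable {n : ℕ} {L R : Type*} [NormedField L] [CommRing R] [TopologicalSpace R]
  [IsTopologicalRing R] {X : TermSystem n L R} {β : ℝ}

theorem exists_mem_E (hβ₀ : X.τ₀ ≤ β) (hβ₁ : β ≤ X.τ₁) {K : Type*} [Finite K] (F : K → R) :
    ∃ D > 0, ∀ k, F k ∈ X.E β D := by
  choose c hc h using fun k => X.exists_mem_U (F k)
  obtain ⟨D, hD⟩ := (Set.finite_range c).bddAbove
  exact ⟨max D 1, lt_max_of_lt_right one_pos, fun k => X.E_mono
    ((hD ⟨k, rfl⟩).trans (le_max_left _ _)) (X.U_le_E (X.o_le (hc k).le hβ₀ hβ₁) (h k))⟩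

/-- The bound is a minimum of three exponentials. The outer ones are raised so that the middle one
is the smallest within `Λ` of the crossing point `γ`. Then the bound for slopes `a, β` is the
relevant one to the right of `γ`, the one for `β, d` to the left, and they agree in between, as
gluing requires. -/
theorem exists_halves_glue [IsUltrametricDist L] (hβ₀ : X.τ₀ ≤ β)
    (hβ₁ : β ≤ X.τ₁) {J : Ideal R} {a d : ℝ} (ha₀ : X.τ₀ ≤ a) (haβ : a ≤ β) (hβd : β ≤ d)
    (hd₁ : d ≤ X.τ₁) (H₁ : X.Reduces J a β) (H₂ : X.Reduces J β d) :
    ∃ (K : Type) (_ : Fintype K) (F : K → R) (D Λ : ℝ), 0 < D ∧ 0 ≤ Λ ∧ (∀ k, F k ∈ J) ∧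
      ∀ (γ c l₁ l₂ : ℝ), 0 < c → 0 < l₁ → 0 < l₂ → l₁ * Real.exp (a * γ) = c * Real.exp (β * γ) →
        l₂ * Real.exp (d * γ) = c * Real.exp (β * γ) →
        X.Halves J F D fun v => min (minExp a β (l₁ * Real.exp ((β - a) * Λ)) c v)
          (minExp β d c (l₂ * Real.exp ((d - β) * Λ)) v) := by
  obtain ⟨K₁, _, F₁, D₁, hD₁, hF₁, H₁⟩ := H₁
  obtain ⟨K₂, _, F₂, D₂, hD₂, hF₂, H₂⟩ := H₂
  obtain ⟨M, hM, hFM⟩ := exists_mem_E hβ₀ hβ₁ (Sum.elim F₁ F₂)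
  have hFJ : ∀ k, Sum.elim F₁ F₂ k ∈ J := fun k => by
    rcases k with k | k; exacts [hF₁ k, hF₂ k]
  set D := max M (max D₁ D₂) with hD
  have hMD : M ≤ D := le_max_left _ _
  have hD₁D : D₁ ≤ D := (le_max_left _ _).trans (le_max_right _ _)
  have hD₂D : D₂ ≤ D := (le_max_right _ _).trans (le_max_right _ _)
  have hD0 : 0 < D := lt_max_of_lt_left hM
  obtain ⟨K', _, F', hF'J, ε, hε, hε1, D', hD', Λ, hΛ, G⟩ := X.exists_glue hβ₀ hβ₁ J hD0
    (fun k => X.E_mono hMD (hFM k))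
  -- The gluing asks for remainders with a factor `ε`, which `j` halvings provide.
  obtain ⟨j, hj⟩ := exists_pow_lt_of_lt_one hε (show (1 / 2 : ℝ) < 1 by norm_num)
  refine ⟨(K₁ ⊕ K₂) ⊕ K', inferInstance, Sum.elim (Sum.elim F₁ F₂) F', max D D', Λ,
    lt_max_of_lt_left hD0, hΛ, fun k => by rcases k with k | k; exacts [hFJ k, hF'J k],
    fun γ c l₁ l₂ hc hl₁ hl₂ e₁ e₂ t ht h hh hU => ?_⟩
  set A₁ := l₁ * Real.exp ((β - a) * Λ) with hA₁
  set A₂ := l₂ * Real.exp ((d - β) * Λ) with hA₂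
  have hA₁0 : 0 < A₁ := by positivity
  have hA₂0 : 0 < A₂ := by positivity
  have f₁ : ∀ v, A₁ * Real.exp (a * v) = c * Real.exp (β * v) * Real.exp ((β - a) * (γ + Λ - v)) :=
    fun v => by
      have : c * Real.exp (β * v) * Real.exp ((β - a) * (γ + Λ - v)) =
        c * Real.exp (β * γ) * (Real.exp ((β - a) * Λ) * Real.exp (a * (v - γ))) := by
        rw [mul_assoc, mul_assoc, ← Real.exp_add, ← Real.exp_add, ← Real.exp_add]; ring_nf
      rw [this, ← e₁, hA₁, mul_assoc, mul_assoc, ← Real.exp_add, ← Real.exp_add, ← Real.exp_add]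
      ring_nf
  have f₂ : ∀ v, A₂ * Real.exp (d * v) = c * Real.exp (β * v) * Real.exp ((d - β) * (v - γ + Λ)) :=
    fun v => by
      have : c * Real.exp (β * v) * Real.exp ((d - β) * (v - γ + Λ)) =
        c * Real.exp (β * γ) * (Real.exp ((d - β) * Λ) * Real.exp (d * (v - γ))) := by
        rw [mul_assoc, mul_assoc, ← Real.exp_add, ← Real.exp_add, ← Real.exp_add]; ring_nf
      rw [this, ← e₂, hA₂, mul_assoc, mul_assoc, ← Real.exp_add, ← Real.exp_add, ← Real.exp_add]
      ring_nf
  set s₁ := minExp a β A₁ c with hs₁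
  set s₂ := minExp β d c A₂ with hs₂
  have g₁ : ∀ v, v ≤ γ + Λ → s₁ v = c * Real.exp (β * v) := fun v hv => by
    refine min_eq_right ?_
    rw [f₁]
    exact le_mul_of_one_le_right (by positivity)
      (Real.one_le_exp (mul_nonneg (by linarith) (by linarith)))
  have g₂ : ∀ v, γ - Λ ≤ v → s₂ v = c * Real.exp (β * v) := fun v hv => by
    refine min_eq_left ?_
    rw [f₂]
    exact le_mul_of_one_le_right (by positivity)
      (Real.one_le_exp (mul_nonneg (by linarith) (by linarith)))
  have le₁ : ∀ v, s₁ v ≤ c * Real.exp (β * v) := fun v => min_le_right _ _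
  have le₂ : ∀ v, s₂ v ≤ c * Real.exp (β * v) := fun v => min_le_left _ _
  have h12 : ∀ v, γ ≤ v → s₁ v ≤ s₂ v := fun v hv => by
    rw [g₂ v (by linarith)]; exact le₁ v
  have h21 : ∀ v, v ≤ γ → s₂ v ≤ s₁ v := fun v hv => by
    rw [g₁ v (by linarith)]; exact le₂ v
  have sh₁ : X.IsShape s₁ := isShape_minExp ha₀ (haβ.trans hβ₁) hβ₀ hβ₁ hA₁0 hc
  have sh₂ : X.IsShape s₂ := isShape_minExp hβ₀ hβ₁ (hβ₀.trans hβd) hd₁ hc hA₂0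
  obtain ⟨c₁, hc₁, hc₁U⟩ := (halves_minExp H₁ hA₁0 hc).iterate (fun v => (sh₁.pos v).le) hD₁.le hF₁ j
    ht hh (X.U_mono (fun v => mul_le_mul_of_nonneg_left (min_le_left _ _) ht.le) hU)
  obtain ⟨c₂, hc₂, hc₂U⟩ := (halves_minExp H₂ hc hA₂0).iterate (fun v => (sh₂.pos v).le) hD₂.le hF₂ j
    ht hh (X.U_mono (fun v => mul_le_mul_of_nonneg_left (min_le_right _ _) ht.le) hU)
  choose x₁ hx₁ y₁ hy₁ hxy₁ using fun k => X.fin_split (fun v => v < γ) (hc₁ k)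
  choose x₂ hx₂ y₂ hy₂ hxy₂ using fun k => X.fin_split (fun v => v < γ) (hc₂ k)
  -- The quotients for `a, β` to the right of `γ` and those for `β, d` to its left are bounded by a
  -- multiple of the minimum and are kept. The element `h'` that remains has one description with
  -- quotients on the left of `γ` and one with quotients on the right.
  let q : K₁ ⊕ K₂ → R := Sum.elim y₁ x₂
  set h' := h - ∑ k, q k * Sum.elim F₁ F₂ k with hh'
  have hJ : h' ∈ J := sub_mem hh (sum_mem fun k _ => J.mul_mem_left _ (hFJ k))
  have E₁ : h' - ∑ k, Sum.elim x₁ (-x₂) k * Sum.elim F₁ F₂ k = h - ∑ k, c₁ k * F₁ k := by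
    simp only [hh', q, Fintype.sum_sum_type, Sum.elim_inl, Sum.elim_inr, hxy₁, add_mul,
      Finset.sum_add_distrib, Pi.neg_apply, neg_mul, Finset.sum_neg_distrib]
    abel
  have E₂ : h' - ∑ k, Sum.elim (-y₁) y₂ k * Sum.elim F₁ F₂ k = h - ∑ k, c₂ k * F₂ k := by
    simp only [hh', q, Fintype.sum_sum_type, Sum.elim_inl, Sum.elim_inr, hxy₂, add_mul,
      Finset.sum_add_distrib, Pi.neg_apply, neg_mul, Finset.sum_neg_distrib]
    abel
  have one_le : (1 : ℝ) ≤ Real.exp 1 := Real.one_le_exp zero_le_one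
  obtain ⟨b, hb, hbU⟩ := G (fun v => t * s₁ v) (fun v => t * s₂ v) (sh₁.const_mul ht)
    (sh₂.const_mul ht) (t * c) (by positivity) γ
    (fun v hv => mul_le_mul_of_nonneg_left (h12 v hv) ht.le)
    (fun v hv => mul_le_mul_of_nonneg_left (h21 v hv) ht.le)
    (fun v => (min_le_left _ _).trans (by
      rw [mul_assoc]; exact mul_le_mul_of_nonneg_left (le₁ v) ht.le))
    (fun v hv => by
      obtain ⟨h1, h2⟩ := abs_le.1 hv
      rw [g₁ v (by linarith), g₂ v (by linarith), min_self, max_self, mul_assoc t]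
      have : t * (c * Real.exp (β * v)) ≤ Real.exp 1 * (t * (c * Real.exp (β * v))) :=
        le_mul_of_one_le_left (by positivity) one_le
      exact ⟨this, this⟩)
    (fun v w hv hw => by
      have := (abs_le.1 hw).2
      rw [g₁ v (by linarith), g₁ (v + w) (by linarith), mul_assoc, mul_assoc, ← Real.exp_add,
        ← mul_add]
      exact le_mul_of_one_le_left (by positivity) one_le)
    (fun v w hv hw => by
      have := (abs_le.1 hw).1
      rw [g₂ v (by linarith), g₂ (v + w) (by linarith), mul_assoc, mul_assoc, ← Real.exp_add,
        ← mul_add]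
      exact le_mul_of_one_le_left (by positivity) one_le) h' hJ (Sum.elim x₁ (-x₂))
    (Sum.elim (-y₁) y₂)
    (by
      have hp := fun v => mul_pos ht (sh₁.pos v)
      rintro (k | k)
      · refine X.fin_mono (fun v => ?_) (hx₁ k)
        have := hp v
        split_ifs with h1 h2 h2
        · gcongr
        · linarith
        · positivity
        · exact le_rfl
      · refine neg_mem (X.fin_mono (fun v => ?_) (hx₂ k))
        have := hp v
        split_ifs with h1 h2 h2
        · exact mul_le_mul hD₂D (mul_le_mul_of_nonneg_left (h21 v h2) ht.le)
            (mul_pos ht (sh₂.pos v)).le hD0.le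
        · linarith
        · positivity
        · exact le_rfl)
    (by
      have hp := fun v => mul_pos ht (sh₂.pos v)
      rintro (k | k)
      · refine neg_mem (X.fin_mono (fun v => ?_) (hy₁ k))
        have := hp v
        split_ifs with h1 h2 h2
        · positivity
        · exact le_rfl
        · exact mul_le_mul hD₁D (mul_le_mul_of_nonneg_left (h12 v h2) ht.le)
            (mul_pos ht (sh₁.pos v)).le hD0.le
        · linarith
      · refine X.fin_mono (fun v => ?_) (hy₂ k)
        have := hp v
        split_ifs with h1 h2 h2
        · positivity
        · exact le_rfl
        · gcongr
        · linarith)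
    (by
      rw [E₁]
      exact X.U_mono (fun v => (mul_le_mul_of_nonneg_right hj.le
        (mul_pos ht (sh₁.pos v)).le).trans (le_max_right _ _)) hc₁U)
    (by
      rw [E₂]
      exact X.U_mono (fun v => (mul_le_mul_of_nonneg_right hj.le
        (mul_pos ht (sh₂.pos v)).le).trans (le_max_right _ _)) hc₂U)
  have hmin : ∀ v, min (t * s₁ v) (t * s₂ v) = t * min (s₁ v) (s₂ v) := fun v =>
    (mul_min_of_nonneg _ _ ht.le).symm
  simp only [hmin] at hb hbU
  have hpos : ∀ v, 0 < t * min (s₁ v) (s₂ v) := fun v => mul_pos ht (lt_min (sh₁.pos v) (sh₂.pos v))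
  refine ⟨Sum.elim q b, ?_, ?_⟩
  · have hDm : D ≤ max D D' := le_max_left _ _
    rintro ((k | k) | k)
    · refine X.fin_mono (fun v => ?_) (hy₁ k)
      have := hpos v
      split_ifs with h1
      · have := hD0.trans_le hDm
        positivity
      · beta_reduce
        rw [min_eq_left (h12 v (not_lt.1 h1))]
        exact mul_le_mul_of_nonneg_right (hD₁D.trans hDm) (mul_pos ht (sh₁.pos v)).le
    · refine X.fin_mono (fun v => ?_) (hx₂ k)
      have := hpos v
      split_ifs with h1
      · beta_reduce
        rw [min_eq_right (h21 v h1.le)]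
        exact mul_le_mul_of_nonneg_right (hD₂D.trans hDm) (mul_pos ht (sh₂.pos v)).le
      · have := hD0.trans_le hDm
        positivity
    · exact X.fin_mono (fun v => mul_le_mul_of_nonneg_right (le_max_right _ _) (hpos v).le) (hb k)
  · rw [Fintype.sum_sum_type, ← sub_sub]
    exact hbU

/-- The exponential of slope `β` through the crossing point of those of slopes `a` and `d` lies
above their minimum. Raising the outer exponentials to apply `exists_halves_glue` costs a bounded
factor `B`, which finitely many further halvings recover. -/
theorem Reduces.trans [IsUltrametricDist L] {J : Ideal R} {a d : ℝ} (ha₀ : X.τ₀ ≤ a)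
    (haβ : a ≤ β) (hβd : β ≤ d) (hd₁ : d ≤ X.τ₁) (H₁ : X.Reduces J a β) (H₂ : X.Reduces J β d) :
    X.Reduces J a d := by
  -- Excluding `a = β` ensures `a < d`, so that the two extremal exponentials cross.
  rcases haβ.eq_or_lt with rfl | haβ'
  · exact H₂
  have hβ₀ := ha₀.trans haβ
  have hβ₁ := hβd.trans hd₁
  obtain ⟨K, _, F, D, Λ, hD, hΛ, hF, H⟩ := exists_halves_glue hβ₀ hβ₁ ha₀ haβ hβd hd₁ H₁ H₂
  have h1a : 1 ≤ Real.exp ((β - a) * Λ) := Real.one_le_exp (mul_nonneg (by linarith) hΛ)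
  have h1d : 1 ≤ Real.exp ((d - β) * Λ) := Real.one_le_exp (mul_nonneg (by linarith) hΛ)
  set B := max (Real.exp ((β - a) * Λ)) (Real.exp ((d - β) * Λ)) with hB
  have hB0 : 0 < B := lt_max_of_lt_left (Real.exp_pos _)
  obtain ⟨j, hj⟩ := exists_pow_lt_of_lt_one (show 0 < 1 / (2 * B) by positivity)
    (show (1 / 2 : ℝ) < 1 by norm_num)
  rw [lt_div_iff₀ (by positivity)] at hj
  refine ⟨K, inferInstance, F, D * B, by positivity, hF, fun l₁ hl₁ l₂ hl₂ h hh hU => ?_⟩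
  obtain ⟨γ, hγ⟩ : ∃ γ, l₁ * Real.exp (a * γ) = l₂ * Real.exp (d * γ) := by
    refine ⟨Real.log (l₁ / l₂) / (d - a), ?_⟩
    have h1 : d - a ≠ 0 := by linarith
    have h2 : Real.exp (d * (Real.log (l₁ / l₂) / (d - a))) = l₁ / l₂ *
        Real.exp (a * (Real.log (l₁ / l₂) / (d - a))) := by
      rw [← Real.exp_log (div_pos hl₁ hl₂), ← Real.exp_add, Real.log_exp]
      congr 1
      field_simp
      ring
    rw [h2]
    field_simp
  set c := l₁ * Real.exp (a * γ) * Real.exp (-(β * γ)) with hc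
  have hc0 : 0 < c := by positivity
  have e₁ : l₁ * Real.exp (a * γ) = c * Real.exp (β * γ) := by
    rw [hc, mul_assoc _ (Real.exp (-(β * γ))), ← Real.exp_add, neg_add_cancel, Real.exp_zero,
      mul_one]
  have e₂ : l₂ * Real.exp (d * γ) = c * Real.exp (β * γ) := by rw [← hγ, e₁]
  have f₁ : ∀ v, l₁ * Real.exp (a * v) = c * Real.exp (β * v) * Real.exp ((β - a) * (γ - v)) :=
    fun v => by
      have : c * Real.exp (β * v) * Real.exp ((β - a) * (γ - v)) =
        c * Real.exp (β * γ) * Real.exp (a * (v - γ)) := by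
        rw [mul_assoc c, mul_assoc c, ← Real.exp_add, ← Real.exp_add]; ring_nf
      rw [this, ← e₁, mul_assoc, ← Real.exp_add]
      ring_nf
  have f₂ : ∀ v, l₂ * Real.exp (d * v) = c * Real.exp (β * v) * Real.exp ((d - β) * (v - γ)) :=
    fun v => by
      have : c * Real.exp (β * v) * Real.exp ((d - β) * (v - γ)) =
        c * Real.exp (β * γ) * Real.exp (d * (v - γ)) := by
        rw [mul_assoc c, mul_assoc c, ← Real.exp_add, ← Real.exp_add]; ring_nf
      rw [this, ← e₂, mul_assoc, ← Real.exp_add]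
      ring_nf
  have hlow : ∀ v, minExp a d l₁ l₂ v ≤ min (minExp a β (l₁ * Real.exp ((β - a) * Λ)) c v)
      (minExp β d c (l₂ * Real.exp ((d - β) * Λ)) v) := fun v => by
    have g₁ : minExp a d l₁ l₂ v ≤ l₁ * Real.exp ((β - a) * Λ) * Real.exp (a * v) :=
      (min_le_left _ _).trans (by gcongr; exact le_mul_of_one_le_right hl₁.le h1a)
    have g₂ : minExp a d l₁ l₂ v ≤ l₂ * Real.exp ((d - β) * Λ) * Real.exp (d * v) :=
      (min_le_right _ _).trans (by gcongr; exact le_mul_of_one_le_right hl₂.le h1d)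
    have g₃ : minExp a d l₁ l₂ v ≤ c * Real.exp (β * v) := by
      rcases le_total v γ with hv | hv
      · refine (min_le_right _ _).trans ?_
        rw [f₂]
        exact mul_le_of_le_one_right (by positivity)
          (Real.exp_le_one_iff.2 (mul_nonpos_of_nonneg_of_nonpos (by linarith) (by linarith)))
      · refine (min_le_left _ _).trans ?_
        rw [f₁]
        exact mul_le_of_le_one_right (by positivity)
          (Real.exp_le_one_iff.2 (mul_nonpos_of_nonneg_of_nonpos (by linarith) (by linarith)))
    exact le_min (le_min g₁ g₃) (le_min g₃ g₂)
  have hupp : ∀ v, min (minExp a β (l₁ * Real.exp ((β - a) * Λ)) c v)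
      (minExp β d c (l₂ * Real.exp ((d - β) * Λ)) v) ≤ B * minExp a d l₁ l₂ v := fun v => by
    rw [minExp, minExp, minExp, mul_min_of_nonneg _ _ hB0.le]
    refine min_le_min ((min_le_left _ _).trans ?_) ((min_le_right _ _).trans ?_)
    · rw [mul_comm l₁, mul_assoc]
      gcongr
      exact le_max_left _ _
    · rw [mul_comm l₂, mul_assoc]
      gcongr
      exact le_max_right _ _
  have hpos : ∀ v, 0 < minExp a d l₁ l₂ v := fun v =>
    lt_min (mul_pos hl₁ (Real.exp_pos _)) (mul_pos hl₂ (Real.exp_pos _))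
  obtain ⟨b, hb, hbU⟩ := (H γ c l₁ l₂ hc0 hl₁ hl₂ e₁ e₂).iterate
    (fun v => (hpos v).le.trans (hlow v)) hD.le hF j one_pos hh
    (X.U_mono (fun v => by rw [one_mul]; exact hlow v) hU)
  refine ⟨b, fun k => X.fin_mono (fun v => ?_) (hb k), X.U_mono (fun v => ?_) hbU⟩
  · rw [one_mul, mul_assoc]
    exact mul_le_mul_of_nonneg_left (hupp v) hD.le
  · rw [one_mul]
    have := hpos v
    calc _ ≤ (1 / 2) ^ j * (B * minExp a d l₁ l₂ v) :=
          mul_le_mul_of_nonneg_left (hupp v) (by positivity)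
      _ = (1 / 2) ^ j * (2 * B) * (minExp a d l₁ l₂ v / 2) := by ring
      _ ≤ 1 * (minExp a d l₁ l₂ v / 2) := by gcongr
      _ = _ := one_mul _

/-- Reduction with respect to the norms of the extremal slopes. -/
theorem reduces [IsUltrametricDist L] (X : TermSystem n L R) (J : Ideal R) :
    X.Reduces J X.τ₀ X.τ₁ := by
  -- The supremum of the slopes that can be reached from `τ₀` is itself reached, by nearness from
  -- below. If it were less than `τ₁`, nearness from above would reach a larger slope.
  let S : Set ℝ := {x | X.τ₀ ≤ x ∧ x ≤ X.τ₁ ∧ X.Reduces J X.τ₀ x}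
  have hS₀ : X.τ₀ ∈ S := by
    obtain ⟨η, hη, H⟩ := X.exists_reduces_near le_rfl X.τ_le J
    exact ⟨le_rfl, X.τ_le, H _ le_rfl X.τ_le (by simpa using hη.le)⟩
  have hbdd : BddAbove S := ⟨X.τ₁, fun x hx => hx.2.1⟩
  set x := sSup S with hx
  have hx₀ : X.τ₀ ≤ x := le_csSup hbdd hS₀
  have hx₁ : x ≤ X.τ₁ := csSup_le ⟨_, hS₀⟩ fun y hy => hy.2.1
  obtain ⟨η, hη, H⟩ := X.exists_reduces_near hx₀ hx₁ J
  obtain ⟨y, hy, hyx⟩ := exists_lt_of_lt_csSup ⟨_, hS₀⟩ (show x - η < x by linarith)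
  have hyx' : y ≤ x := le_csSup hbdd hy
  have h1 : X.Reduces J X.τ₀ x := Reduces.trans le_rfl hy.1 hyx' hx₁ hy.2.2
    (H y hy.1 hy.2.1 (abs_le.2 ⟨by linarith, by linarith⟩)).symm
  have hz : X.Reduces J X.τ₀ (min (x + η) X.τ₁) :=
    Reduces.trans le_rfl hx₀ (le_min (by linarith) hx₁) (min_le_right _ _) h1
      (H _ (hx₀.trans (le_min (by linarith) hx₁)) (min_le_right _ _)
        (abs_le.2 ⟨by have := le_min (show x ≤ x + η by linarith) hx₁; linarith,
          by have := min_le_left (x + η) X.τ₁; linarith⟩))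
  have hzS : min (x + η) X.τ₁ ∈ S :=
    ⟨hx₀.trans (le_min (by linarith) hx₁), min_le_right _ _, hz⟩
  have hle : min (x + η) X.τ₁ ≤ x := le_csSup hbdd hzS
  rcases min_le_iff.1 hle with h | h
  · linarith
  · rwa [le_antisymm hx₁ h] at h1

end TermSystem

/-! ### Successive approximation and finite generation of ideals -/

/-- A complete ring with a term system is noetherian. -/
theorem TermSystem.isNoetherianRing {n : ℕ} {L R : Type*} [NormedField L] [IsUltrametricDist L]
    [CommRing R] [UniformSpace R] [IsUniformAddGroup R] [IsTopologicalRing R] [CompleteSpace R]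
    [T2Space R] (X : TermSystem n L R) : IsNoetherianRing R := by
  -- The groups `U (o c)` are open and form a basis at zero, so series whose terms tend to zero
  -- converge.
  have hna : NonarchimedeanAddGroup R := by
    refine ⟨fun V hV => ?_⟩
    obtain ⟨c, hc, h⟩ := X.exists_U_subset V hV
    exact ⟨⟨X.U (X.o c), (X.U (X.o c)).isOpen_of_mem_nhds (g := 0) (X.U_mem_nhds c hc)⟩, h⟩
  refine (isNoetherianRing_iff_ideal_fg R).2 fun J => ?_
  obtain ⟨K, _, F, D, hD, hF, H⟩ := X.reduces J
  have hH : X.Halves J F D (X.o 1) := by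
    have : X.o 1 = TermSystem.minExp X.τ₀ X.τ₁ 1 1 := by
      funext v; simp [TermData.o, TermSystem.minExp]
    rw [this]
    exact TermSystem.halves_minExp H one_pos one_pos
  have ho : ∀ c : ℝ, (fun v => c * X.o 1 v) = X.o c := fun c => funext fun v => (X.o_eq c v).symm
  suffices J = Ideal.span (Set.range F) from ⟨(Set.finite_range F).toFinset, by simp [this]⟩
  refine le_antisymm (fun h hh => ?_) (Ideal.span_le.2 (by rintro _ ⟨k, rfl⟩; exact hF k))
  obtain ⟨c, hc, hU⟩ := X.exists_mem_U h
  -- successive reductions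
  have step : ∀ (j : ℕ) (y : {y : R // y ∈ J ∧ y ∈ X.U (X.o ((1 / 2) ^ j * c))}), ∃ a : K → R,
      (∀ k, a k ∈ X.U (X.o (D * ((1 / 2) ^ j * c)))) ∧
      y.1 - ∑ k, a k * F k ∈ X.U (X.o ((1 / 2) ^ (j + 1) * c)) := by
    rintro j ⟨y, hyJ, hyU⟩
    obtain ⟨a, ha, haU⟩ := hH ((1 / 2) ^ j * c) (by positivity) y hyJ (by rwa [ho])
    refine ⟨a, fun k => X.fin_le_U _ (X.fin_mono (fun v => ?_) (ha k)), X.U_mono (fun v => ?_) haU⟩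
    · rw [X.o_eq (D * _)]
      exact le_of_eq (by ring)
    · rw [X.o_eq ((1 / 2) ^ (j + 1) * c), pow_succ]
      exact le_of_eq (by ring)
  choose a ha haU using step
  let y : ∀ j : ℕ, {y : R // y ∈ J ∧ y ∈ X.U (X.o ((1 / 2) ^ j * c))} := fun j =>
    Nat.rec ⟨h, hh, by simpa using hU⟩ (fun j y => ⟨y.1 - ∑ k, a j y k * F k,
      sub_mem y.2.1 (sum_mem fun k _ => J.mul_mem_left _ (hF k)), haU j y⟩) j
  have hy : ∀ j, (y (j + 1)).1 = (y j).1 - ∑ k, a j (y j) k * F k := fun j => rfl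
  have hsum : ∀ N, h = ∑ k, (∑ j ∈ Finset.range N, a j (y j) k) * F k + (y N).1 := by
    intro N
    induction N with
    | zero => simp [y]
    | succ N ih =>
      rw [hy]
      simp only [Finset.sum_range_succ, add_mul, Finset.sum_add_distrib]
      nth_rewrite 1 [ih]
      abel
  have lim : ∀ (A : ℝ), 0 < A → ∀ z : ℕ → R, (∀ j, z j ∈ X.U (X.o (A * ((1 / 2) ^ j * c)))) →
      Tendsto z atTop (𝓝 0) := by
    intro A hA z hz V hV
    obtain ⟨e, he, h⟩ := X.exists_U_subset V hV
    have h1 : Tendsto (fun j : ℕ => A * ((1 / 2 : ℝ) ^ j * c)) atTop (𝓝 (A * (0 * c))) :=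
      ((tendsto_pow_atTop_nhds_zero_of_lt_one (by norm_num) (by norm_num)).mul_const c).const_mul A
    rw [zero_mul, mul_zero] at h1
    change ∀ᶠ j in atTop, z j ∈ V
    filter_upwards [(tendsto_order.1 h1).2 e he] with j hj
    refine h (X.U_mono (fun v => ?_) (hz j))
    rw [X.o_eq, X.o_eq e]
    exact mul_le_mul_of_nonneg_right hj.le (X.o_pos one_pos v).le
  have hsm : ∀ k, Summable fun j => a j (y j) k := fun k => by
    refine NonarchimedeanAddGroup.summable_of_tendsto_cofinite_zero ?_
    rw [Nat.cofinite_eq_atTop]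
    exact lim D hD _ fun j => ha j (y j) k
  have hy0 : Tendsto (fun j => (y j).1) atTop (𝓝 0) :=
    lim 1 one_pos _ fun j => by simpa using (y j).2.2
  have hlim : Tendsto (fun N => ∑ k, (∑ j ∈ Finset.range N, a j (y j) k) * F k + (y N).1) atTop
      (𝓝 (∑ k, (∑' j, a j (y j) k) * F k + 0)) :=
    (tendsto_finsetSum _ fun k _ => (hsm k).hasSum.tendsto_sum_nat.mul_const _).add hy0
  -- The limit writes `h` directly as a combination of the `F k`; closedness of `J` is not used.
  have heq : h = ∑ k, (∑' j, a j (y j) k) * F k := by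
    rw [add_zero] at hlim
    refine tendsto_nhds_unique (tendsto_const_nhds.congr fun N => ?_) hlim
    exact hsum N
  rw [heq]
  exact sum_mem fun k _ => Ideal.mul_mem_left _ _ (Ideal.subset_span ⟨k, rfl⟩)

/-! ### The Gauss norm on weighted Tate algebras -/

namespace ExtRobba

open MvPowerSeries

section TateNorm

variable {A : Type*} [NormedCommRing A] [IsUltrametricDist A] {n : ℕ} (ρ : Fin n → ℝ)

/-- The weight `ρ^i` of the monomial `T^i`. -/
def weight (i : Fin n →₀ ℕ) : ℝ := i.prod (ρ · ^ ·)

variable {ρ}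

theorem weight_pos (hρ : ∀ i, 0 < ρ i) (i : Fin n →₀ ℕ) : 0 < weight ρ i :=
  Finset.prod_pos fun _ _ => pow_pos (hρ _) _

theorem weight_add (i j : Fin n →₀ ℕ) : weight ρ (i + j) = weight ρ i * weight ρ j :=
  Finsupp.prod_add_index' (by simp) fun _ _ _ => pow_add _ _ _

theorem tate_bdd (f : TateAlgebra A ρ) :
    BddAbove (Set.range fun i => ‖coeff i f.1‖ * weight ρ i) :=
  (show Tendsto (fun i => ‖coeff i f.1‖ * weight ρ i) cofinite (𝓝 0) from
    f.2).bddAbove_range_of_cofinite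

/-- The Gauss norm on the Tate algebra. -/
def tateNorm (f : TateAlgebra A ρ) : ℝ := ⨆ i, ‖coeff i f.1‖ * weight ρ i

theorem coeff_le_tateNorm (f : TateAlgebra A ρ) (i : Fin n →₀ ℕ) :
    ‖coeff i f.1‖ * weight ρ i ≤ tateNorm f := le_ciSup (tate_bdd f) i

theorem tateNorm_le {f : TateAlgebra A ρ} {C : ℝ}
    (h : ∀ i, ‖coeff i f.1‖ * weight ρ i ≤ C) : tateNorm f ≤ C := ciSup_le h

theorem tateNorm_nonneg (hρ : ∀ i, 0 < ρ i) (f : TateAlgebra A ρ) : 0 ≤ tateNorm f :=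
  Real.iSup_nonneg fun i => mul_nonneg (norm_nonneg _) (weight_pos hρ i).le

/-- The Gauss norm on the Tate algebra as a norm of rings. -/
def tateRingNorm (hρ : ∀ i, 0 < ρ i) : RingNorm (TateAlgebra A ρ) where
  toFun := tateNorm
  map_zero' := le_antisymm (tateNorm_le fun i => by simp) (tateNorm_nonneg hρ _)
  add_le' f g := tateNorm_le fun i => by
    have := weight_pos hρ i
    calc ‖coeff i (f + g).1‖ * weight ρ i
        ≤ (‖coeff i f.1‖ + ‖coeff i g.1‖) * weight ρ i := by
          gcongr
          simpa using norm_add_le (coeff i f.1) (coeff i g.1)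
      _ ≤ _ := by
          rw [add_mul]
          exact add_le_add (coeff_le_tateNorm f i) (coeff_le_tateNorm g i)
  neg' f := by simp [tateNorm]
  mul_le' f g := tateNorm_le fun i => by
    classical
    have hw := weight_pos hρ
    rw [← le_div_iff₀ (hw i)]
    have e : coeff i (f * g).1 = ∑ q ∈ Finset.HasAntidiagonal.antidiagonal i, coeff q.1 f.1 * coeff q.2 g.1 :=
      coeff_mul i f.1 g.1
    rw [e]
    refine IsUltrametricDist.norm_sum_le_of_forall_le_of_nonneg
      (div_nonneg (mul_nonneg (tateNorm_nonneg hρ f) (tateNorm_nonneg hρ g)) (hw i).le)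
      fun q hq => ?_
    rw [le_div_iff₀ (hw i), ← Finset.HasAntidiagonal.mem_antidiagonal.1 hq, weight_add]
    calc ‖coeff q.1 f.1 * coeff q.2 g.1‖ * (weight ρ q.1 * weight ρ q.2)
        ≤ ‖coeff q.1 f.1‖ * ‖coeff q.2 g.1‖ * (weight ρ q.1 * weight ρ q.2) := by
          have := hw q.1
          have := hw q.2
          gcongr
          exact norm_mul_le _ _
      _ = (‖coeff q.1 f.1‖ * weight ρ q.1) * (‖coeff q.2 g.1‖ * weight ρ q.2) := by ring
      _ ≤ _ := mul_le_mul (coeff_le_tateNorm f _) (coeff_le_tateNorm g _)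
          (mul_nonneg (norm_nonneg _) (hw _).le) (tateNorm_nonneg hρ f)
  eq_zero_of_map_eq_zero' f hf := by
    ext i
    have h1 := coeff_le_tateNorm f i
    have h2 := weight_pos hρ i
    change tateNorm f = 0 at hf
    rw [hf] at h1
    have h3 : ‖coeff i f.1‖ ≤ 0 := by
      by_contra! h
      exact absurd h1 (not_le.2 (mul_pos h h2))
    simpa using h3

/-- The Tate algebra with the Gauss norm. -/
@[reducible] def tateNormedCommRing (hρ : ∀ i, 0 < ρ i) : NormedCommRing (TateAlgebra A ρ) :=
  { RingNorm.toNormedRing (tateRingNorm (A := A) hρ) with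
    mul_comm := mul_comm }

theorem tate_complete [CompleteSpace A] (hρ : ∀ i, 0 < ρ i) :
    letI := tateNormedCommRing (A := A) hρ
    CompleteSpace (TateAlgebra A ρ) := by
  let := tateNormedCommRing (A := A) hρ
  have hnorm : ∀ f : TateAlgebra A ρ, ‖f‖ = tateNorm f := fun f => rfl
  have hw := weight_pos hρ
  refine Metric.complete_of_cauchySeq_tendsto fun u hu => ?_
  have hu' := Metric.cauchySeq_iff.1 hu
  have hdist : ∀ k l i, ‖coeff i (u k).1 - coeff i (u l).1‖ * weight ρ i ≤ dist (u k) (u l) :=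
    fun k l i => by
      have := coeff_le_tateNorm (u k - u l) i
      rw [dist_eq_norm, hnorm]
      simpa using this
  have hc : ∀ i, ∃ a, Tendsto (fun k => coeff i (u k).1) atTop (𝓝 a) := fun i => by
    refine cauchySeq_tendsto_of_complete (Metric.cauchySeq_iff.2 fun ε hε => ?_)
    obtain ⟨N, hN⟩ := hu' (ε * weight ρ i) (mul_pos hε (hw i))
    refine ⟨N, fun k hk l hl => ?_⟩
    rw [dist_eq_norm]
    exact lt_of_mul_lt_mul_right ((hdist k l i).trans_lt (hN k hk l hl)) (hw i).le
  choose a ha using hc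
  -- Uniformity in `i` makes the coefficientwise limit restricted and turns coefficientwise
  -- convergence into convergence in norm.
  have hlim : ∀ ε > 0, ∃ N, ∀ k ≥ N, ∀ i, ‖coeff i (u k).1 - a i‖ * weight ρ i ≤ ε := by
    intro ε hε
    obtain ⟨N, hN⟩ := hu' ε hε
    refine ⟨N, fun k hk i => ?_⟩
    have h1 : Tendsto (fun l => ‖coeff i (u k).1 - coeff i (u l).1‖ * weight ρ i) atTop
        (𝓝 (‖coeff i (u k).1 - a i‖ * weight ρ i)) :=
      ((tendsto_const_nhds.sub (ha i)).norm).mul_const _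
    exact le_of_tendsto h1 (eventually_atTop.2 ⟨N, fun l hl =>
      (hdist k l i).trans (hN k hk l hl).le⟩)
  let f₀ : MvPowerSeries (Fin n) A := a
  have hf₀ : ∀ i, coeff i f₀ = a i := fun i => rfl
  have hmem : f₀ ∈ MvPowerSeries.IsRestricted.subring (R := A) ρ := by
    change Tendsto (fun i => ‖coeff i f₀‖ * weight ρ i) cofinite (𝓝 0)
    rw [Metric.tendsto_nhds]
    intro ε hε
    obtain ⟨N, hN⟩ := hlim (ε / 2) (half_pos hε)
    have h1 : Tendsto (fun i => ‖coeff i (u N).1‖ * weight ρ i) cofinite (𝓝 0) := (u N).2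
    filter_upwards [(Metric.tendsto_nhds.1 h1) (ε / 2) (half_pos hε)] with i hi
    rw [dist_zero_right, Real.norm_of_nonneg (mul_nonneg (norm_nonneg _) (hw i).le)] at hi ⊢
    have h2 := hN N le_rfl i
    have h3 : ‖a i‖ ≤ ‖coeff i (u N).1‖ + ‖coeff i (u N).1 - a i‖ := by
      have := norm_sub_le (coeff i (u N).1) (coeff i (u N).1 - a i)
      rwa [sub_sub_cancel] at this
    have h4 := mul_le_mul_of_nonneg_right h3 (hw i).le
    rw [add_mul] at h4
    rw [hf₀]
    linarith
  refine ⟨⟨f₀, hmem⟩, Metric.tendsto_atTop.2 fun ε hε => ?_⟩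
  obtain ⟨N, hN⟩ := hlim (ε / 2) (half_pos hε)
  refine ⟨N, fun k hk => ?_⟩
  rw [dist_eq_norm, hnorm]
  refine (tateNorm_le fun i => ?_).trans_lt (half_lt_self hε)
  have := hN k hk i
  rw [← hf₀] at this
  simpa using this

end TateNorm

end ExtRobba

/-! ### Teichmüller expansions in `B_{L,E}` -/

namespace ExtRobba

open IsLocalRing TensorProduct
open scoped NNReal

section Expansion

variable {p : ℕ} [hp : Fact p.Prime] {O : Type*} [CommRing O] [IsDomain O]
  [IsDiscreteValuationRing O] [IsAdicComplete (maximalIdeal O) O]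
  [Finite (ResidueField O)] [CharP (ResidueField O) p]
  {E : Type*} [Field E] [Algebra O E] [IsFractionRing O E]
  {L : Type*} [NormedField L] [IsUltrametricDist L] [CharP L p] [PerfectRing L p]
  [Algebra (ResidueField O) L] (ϖ : {x : O // Irreducible x})

theorem digit_tail (x : AL p O L) (N : ℕ) : ∃ z, x = ∑ i ∈ Finset.range N,
    ϖ.1 ^ i • T p O (digit ϖ x i) + ϖ.1 ^ N • z ∧ ∀ j, digit ϖ z j = digit ϖ x (N + j) := by
  induction N generalizing x with
  | zero => exact ⟨x, by simp, by simp⟩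
  | succ n ih =>
    obtain ⟨z, hz, hz'⟩ := ih (tail ϖ x)
    refine ⟨z, ?_, fun j => ?_⟩
    · rw [Finset.sum_range_succ']
      conv_lhs => rw [tail_spec ϖ x, hz]
      simp only [digit, smul_add, Finset.smul_sum, smul_smul, pow_succ', pow_zero, one_smul]
      abel
    · rw [hz', show n + 1 + j = (n + j) + 1 by omega]
      rfl

variable (E) in
/-- The element `ϖ^k a` of `B_{L,E}`. -/
def shiftB (k : ℤ) : AL p O L →+ BL p O E L where
  toFun a := (algebraMap O E ϖ.1 ^ k) ⊗ₜ a
  map_zero' := tmul_zero _ _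
  map_add' := tmul_add _

theorem algebraMap_ne_zero : algebraMap O E ϖ.1 ≠ 0 :=
  (map_ne_zero_iff _ (IsFractionRing.injective O E)).2 ϖ.2.ne_zero

theorem shiftB_mul (k l : ℤ) (a b : AL p O L) :
    shiftB E ϖ k a * shiftB E ϖ l b = shiftB E ϖ (k + l) (a * b) := by
  change (_ ⊗ₜ _) * (_ ⊗ₜ _) = _ ⊗ₜ _
  rw [Algebra.TensorProduct.tmul_mul_tmul, zpow_add₀ (algebraMap_ne_zero ϖ)]

theorem shiftB_smul (k : ℤ) (j : ℕ) (a : AL p O L) :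
    shiftB E ϖ k (ϖ.1 ^ j • a) = shiftB E ϖ (k + j) a := by
  change _ ⊗ₜ _ = _ ⊗ₜ _
  rw [← smul_tmul, zpow_add₀ (algebraMap_ne_zero ϖ), Algebra.smul_def, map_pow, zpow_natCast,
    mul_comm]

theorem pow_smul_shiftB (m : ℕ) (a : AL p O L) :
    ϖ.1 ^ m • shiftB E ϖ (-m) a = (1 : E) ⊗ₜ a := by
  change ϖ.1 ^ m • (_ ⊗ₜ _) = _
  rw [smul_tmul', Algebra.smul_def, map_pow, zpow_neg, zpow_natCast,
    mul_inv_cancel₀ (pow_ne_zero _ (algebraMap_ne_zero ϖ))]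

theorem exists_shiftB (z : BL p O E L) : ∃ (m : ℕ) (a : AL p O L), z = shiftB E ϖ (-m) a := by
  obtain ⟨m, a, h⟩ := BL_clear ϖ z
  refine ⟨m, a, ?_⟩
  change z = _ ⊗ₜ a
  have h1 := congrArg (fun y => (algebraMap O E ϖ.1 ^ (-(m : ℤ)) : E) • y) h
  have h2 : (algebraMap O E ϖ.1 ^ (-(m : ℤ)) : E) • (ϖ.1 ^ m • z) = z := by
    rw [← algebraMap_smul E (ϖ.1 ^ m), smul_smul, map_pow, zpow_neg, zpow_natCast,
      inv_mul_cancel₀ (pow_ne_zero _ (algebraMap_ne_zero ϖ)), one_smul]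
  simp only [h2, smul_tmul', smul_eq_mul, mul_one] at h1
  exact h1

theorem exists_shiftB₂ (z w : BL p O E L) : ∃ (m : ℕ) (a b : AL p O L),
    z = shiftB E ϖ (-m) a ∧ w = shiftB E ϖ (-m) b := by
  obtain ⟨m, a, rfl⟩ := exists_shiftB ϖ z
  obtain ⟨k, b, rfl⟩ := exists_shiftB ϖ w
  refine ⟨m + k, ϖ.1 ^ k • a, ϖ.1 ^ m • b, ?_, ?_⟩ <;> rw [shiftB_smul] <;> congr 1 <;>
    grind

theorem coeffB_shiftB (k : ℤ) (a : AL p O L) (n : ℤ) :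
    coeffB ϖ (shiftB E ϖ k a) n = if k ≤ n then digit ϖ a (n - k).toNat else 0 := by
  obtain ⟨m, j, rfl⟩ : ∃ m j : ℕ, k = -m + j := ⟨(-k).toNat, k.toNat, by omega⟩
  rw [← shiftB_smul, coeffB_eq ϖ (pow_smul_shiftB ϖ m _), digit_smul_pow]
  by_cases h1 : (0 : ℤ) ≤ n + m
  · by_cases h2 : -(m : ℤ) + j ≤ n
    · rw [if_pos h1, if_pos h2, if_neg (by omega)]
      congr 1; omega
    · rw [if_pos h1, if_neg h2, if_pos (by omega)]
  · rw [if_neg h1, if_neg (by omega)]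

variable (E) in
/-- The element `ϖ^k [x]` of `B_{L,E}`. -/
def termB (x : L) (k : ℤ) : BL p O E L := shiftB E ϖ k (T p O x)

theorem termB_zero (k : ℤ) : termB E ϖ (p := p) (0 : L) k = 0 := by
  rw [termB, T_zero, map_zero]

theorem termB_mul (x y : L) (k l : ℤ) :
    termB E ϖ (p := p) x k * termB E ϖ y l = termB E ϖ (x * y) (k + l) := by
  rw [termB, termB, shiftB_mul, ← map_mul]; rfl

theorem digit_T (x : L) (n : ℕ) : digit ϖ (T p O x) n = if n = 0 then x else 0 := by
  have h : T p O x = T p O x + ϖ.1 • 0 := by simp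
  obtain ⟨h1, h2⟩ := tail_unique ϖ h
  cases n with
  | zero => exact h1
  | succ n => rw [digit, h2, digit_zero, if_neg (by omega)]

theorem coeffB_zero (n : ℤ) : coeffB ϖ (0 : BL p O E L) n = 0 := by
  rw [← map_zero (shiftB E ϖ 0 : AL p O L →+ BL p O E L), coeffB_shiftB, digit_zero, ite_self]

theorem coeffB_sub_le (z w : BL p O E L) (n : ℤ) :
    coeffB ϖ (z - w) n = 0 ∨
      ∃ j ≤ n, ‖coeffB ϖ (z - w) n‖ ≤ max ‖coeffB ϖ z j‖ ‖coeffB ϖ w j‖ := by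
  obtain ⟨m, a, b, rfl, rfl⟩ := exists_shiftB₂ ϖ z w
  simp only [← map_sub, coeffB_shiftB]
  by_cases h : -(m : ℤ) ≤ n
  · right
    obtain ⟨i, hi, h'⟩ := digit_sub_le ϖ a b (n - -m).toNat
    refine ⟨i - m, by omega, ?_⟩
    rw [if_pos h, if_pos (by omega), if_pos (by omega)]
    rwa [show ((i : ℤ) - m - -m).toNat = i by omega]
  · exact Or.inl (if_neg h)

/-- The error term in the addition of Teichmüller elements. -/
theorem coeffB_termB_sub (x y : L) (k n : ℤ) :
    let z := termB E ϖ (p := p) x k - termB E ϖ y k - termB E ϖ (x - y) k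
    ‖coeffB ϖ z n‖ ≤ max ‖x‖ ‖y‖ ∧ (n ≤ k → coeffB ϖ z n = 0) := by
  intro z
  have hz : z = shiftB E ϖ k (T p O x - T p O y - T p O (x - y)) := by
    simp only [z, termB, map_sub]
  have hxy : ‖x - y‖ ≤ max ‖x‖ ‖y‖ := by
    simpa [sub_eq_add_neg] using IsUltrametricDist.norm_add_le_max x (-y)
  have hT : ∀ (u : L) i, ‖digit ϖ (T p O u) i‖ ≤ ‖u‖ := fun u i => by
    rw [digit_T]; split_ifs <;> simp
  constructor
  · rw [hz, coeffB_shiftB]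
    split_ifs
    · obtain ⟨i, -, h⟩ := digit_sub_le ϖ (T p O x - T p O y) (T p O (x - y)) (n - k).toNat
      obtain ⟨j, -, h'⟩ := digit_sub_le ϖ (T p O x) (T p O y) i
      exact h.trans (max_le (h'.trans (max_le_max (hT _ _) (hT _ _))) ((hT _ _).trans hxy))
    · simp
  · intro hn
    rw [hz, coeffB_shiftB]
    split_ifs with h
    -- The lowest coefficient is the reduction to `L`, which is additive, so carries start one power
    -- of `ϖ` later.
    · rw [show (n - k).toNat = 0 by omega]
      simp [digit, res_T]
    · rfl

/-- Truncation of the expansion. -/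
theorem coeffB_truncate (z : BL p O E L) : ∃ m : ℕ, ∀ N : ℕ, ∃ S : Finset ℤ, ∀ n,
    coeffB ϖ (z - ∑ k ∈ S, termB E ϖ (coeffB ϖ z k) k) n =
      if (N : ℤ) - m ≤ n then coeffB ϖ z n else 0 := by
  obtain ⟨m, a, rfl⟩ := exists_shiftB ϖ z
  refine ⟨m, fun N => ?_⟩
  obtain ⟨b, hb, hb'⟩ := digit_tail ϖ a N
  refine ⟨(Finset.range N).image fun i : ℕ => (i : ℤ) - m, fun n => ?_⟩
  have h1 : ∑ k ∈ (Finset.range N).image fun i : ℕ => (i : ℤ) - m,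
      termB E ϖ (coeffB ϖ (shiftB E ϖ (-m) a) k) k =
      shiftB E ϖ (-m) (∑ i ∈ Finset.range N, ϖ.1 ^ i • T p O (digit ϖ a i)) := by
    rw [Finset.sum_image (fun i _ j _ h => by simpa using h), map_sum]
    refine Finset.sum_congr rfl fun i _ => ?_
    rw [coeffB_shiftB, if_pos (by omega), shiftB_smul, termB,
      show ((i : ℤ) - m - -m).toNat = i by omega, show (i : ℤ) - m = -m + i by ring]
  rw [h1, ← map_sub]
  nth_rewrite 1 [hb]
  rw [add_sub_cancel_left, shiftB_smul, coeffB_shiftB, coeffB_shiftB]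
  by_cases h2 : (N : ℤ) - m ≤ n
  · rw [if_pos (by omega), if_pos h2, if_pos (by omega), hb']
    congr 1; omega
  · rw [if_neg (by omega), if_neg h2]

theorem coeffB_bounded (z : BL p O E L) : ∃ C, ∀ n, ‖coeffB ϖ z n‖ ≤ C := by
  obtain ⟨m, a, rfl⟩ := exists_shiftB ϖ z
  obtain ⟨C, hC⟩ := digit_bounded ϖ a
  refine ⟨C, fun n => ?_⟩
  rw [coeffB_shiftB]
  split_ifs
  · exact hC _
  · simpa using (norm_nonneg _).trans (hC 0)

theorem exists_nat_coeffB_sum (S : Finset ℤ) : ∃ m : ℕ, ∀ k ∈ S, -(m : ℤ) ≤ k := by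
  refine ⟨S.sup Int.natAbs, fun k hk => ?_⟩
  have := Finset.le_sup (f := Int.natAbs) hk
  omega

/-- The coefficients of a finite sum. -/
theorem coeffB_sum (S : Finset ℤ) (c : ℤ → L) (n : ℤ) :
    coeffB ϖ (∑ k ∈ S, termB E ϖ (p := p) (c k) k) n = if n ∈ S then c n else 0 := by
  obtain ⟨m, hm⟩ := exists_nat_coeffB_sum S
  have h1 : ∑ k ∈ S, termB E ϖ (p := p) (c k) k =
      shiftB E ϖ (-m) (∑ k ∈ S, ϖ.1 ^ (k + m).toNat • T p O (c k)) := by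
    rw [map_sum]
    refine Finset.sum_congr rfl fun k hk => ?_
    have := hm k hk
    rw [shiftB_smul, termB, show -(m : ℤ) + ((k + m).toNat : ℕ) = k by omega]
  rw [h1, coeffB_shiftB]
  have h2 : ∀ j, digit ϖ (∑ k ∈ S, ϖ.1 ^ (k + m).toNat • T p O (c k)) j =
      if (j : ℤ) - m ∈ S then c (j - m) else 0 := by
    -- Each power of `ϖ` occurs at most once, so no carries arise and the sum is already the
    -- expansion.
    refine digit_unique ϖ fun N => ?_
    refine ⟨∑ k ∈ S, if N ≤ (k + m).toNat then ϖ.1 ^ ((k + m).toNat - N) • T p O (c k) else 0, ?_⟩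
    have h3 : ∑ i ∈ Finset.range N,
        ϖ.1 ^ i • T p O (if (i : ℤ) - m ∈ S then c (i - m) else 0) =
        ∑ k ∈ S, if N ≤ (k + m).toNat then 0 else ϖ.1 ^ (k + m).toNat • T p O (c k) := by
      rw [Finset.sum_ite, Finset.sum_const_zero, zero_add, ← Finset.sum_filter_add_sum_filter_not (Finset.range N)
        (fun i : ℕ => (i : ℤ) - m ∈ S)]
      rw [Finset.sum_eq_zero (s := (Finset.range N).filter fun i : ℕ => ¬ (i : ℤ) - m ∈ S)
        (fun i hi => by rw [if_neg (Finset.mem_filter.1 hi).2, T_zero, smul_zero]), add_zero]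
      refine Finset.sum_bij' (fun i _ => (i : ℤ) - m) (fun k _ => (k + m).toNat) ?_ ?_ ?_ ?_ ?_
      · intro i hi
        simp only [Finset.mem_filter, Finset.mem_range] at hi ⊢
        refine ⟨hi.2, ?_⟩
        omega
      · intro k hk
        simp only [Finset.mem_filter, Finset.mem_range] at hk ⊢
        have := hm k hk.1
        refine ⟨by omega, ?_⟩
        rw [show (((k + m).toNat : ℤ) - m) = k by omega]
        exact hk.1
      · intro i hi; omega
      · intro k hk
        have := hm k (Finset.mem_filter.1 hk).1
        omega
      · intro i hi
        rw [if_pos (Finset.mem_filter.1 hi).2]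
        congr 2
        omega
    rw [h3, Finset.smul_sum, ← Finset.sum_add_distrib]
    refine Finset.sum_congr rfl fun k hk => ?_
    split_ifs with h4
    · rw [zero_add, smul_smul, ← pow_add, Nat.add_sub_cancel' h4]
    · rw [smul_zero, add_zero]
  split_ifs with h3 h4 h4
  · rw [h2, show (((n - -(m : ℤ)).toNat : ℤ) - m) = n by omega, if_pos h4]
  · rw [h2, show (((n - -(m : ℤ)).toNat : ℤ) - m) = n by omega, if_neg h4]
  · exact absurd (hm n h4) h3
  · rfl

end Expansion

end ExtRobba

/-! ### From expansions in a dense subgroup to term systems -/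

/-- A normed ring `R` with a dense subgroup, the image of `P`, whose elements have expansions
`∑ term (coef z m) m` that determine their size. -/
structure ExpansionSystem (n : ℕ) (L R P : Type*) [NormedField L] [NormedCommRing R]
    [AddCommGroup P] extends TermData n L R where
  mon : L → Mon n → P
  toR : P →+ R
  coef : P → Mon n → L
  term_eq : ∀ x m, term x m = toR (mon x m)
  τ₀_pos : 0 < τ₀
  τ_le : τ₀ ≤ τ₁
  u_pos : 0 < ν (1, 0)
  term_zero : ∀ m, term 0 m = 0
  term_mul : ∀ x y m k, term x m * term y k = term (x * y) (m + k)
  -- Carries only move upwards in `ν`; for monotone `s`, coefficient bounds by `s` therefore define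
  -- subgroups.
  coef_sub : ∀ z w m, coef (z - w) m = 0 ∨
    ∃ k, ν k ≤ ν m ∧ ‖coef (z - w) m‖ ≤ max ‖coef z k‖ ‖coef w k‖
  coef_sum : ∀ (S : Finset (Mon n)) (x : Mon n → L) m,
    coef (∑ k ∈ S, mon (x k) k) m = if m ∈ S then x m else 0
  coef_mon_sub : ∀ x y m k, coef (mon x m - mon y m - mon (x - y) m) k ≠ 0 →
    ∃ j : ℕ, ν k = ν m + (j + 1) * ν (1, 0) ∧
      ‖coef (mon x m - mon y m - mon (x - y) m) k‖ ≤ max ‖x‖ ‖y‖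
  truncate : ∀ z, ∀ ε : ℝ, 0 < ε → ∃ S : Finset (Mon n),
    ‖toR (z - ∑ m ∈ S, mon (coef z m) m)‖ < ε
  -- This condition and the next say that the norm topology and the coefficient bounds `o c` define
  -- the same notion of smallness.
  norm_le : ∀ ε : ℝ, 0 < ε → ∃ c : ℝ, 0 < c ∧
    ∀ z, (∀ m, ‖coef z m‖ ≤ toTermData.o c (ν m)) → ‖toR z‖ ≤ ε
  coef_le : ∀ c : ℝ, 0 < c → ∃ ε : ℝ, 0 < ε ∧
    ∀ z, ‖toR z‖ < ε → ∀ m, ‖coef z m‖ ≤ toTermData.o c (ν m)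
  exists_coef_le : ∀ z, ∃ c : ℝ, 0 < c ∧ ∀ m, ‖coef z m‖ ≤ toTermData.o c (ν m)
  dense : ∀ f, ∀ ε : ℝ, 0 < ε → ∃ z, ‖f - toR z‖ < ε

namespace ExpansionSystem

variable {n : ℕ} {L R P : Type*} [NormedField L] [NormedCommRing R] [AddCommGroup P]
  (X : ExpansionSystem n L R P)

theorem coef_zero (m : Mon n) : X.coef 0 m = 0 := by
  simpa using X.coef_sum ∅ 0 m

theorem coef_mon (x : L) (m k : Mon n) : X.coef (X.mon x m) k = if k = m then x else 0 := by
  have h := X.coef_sum {m} (fun _ => x) k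
  simpa using h

/-- The elements `z` with `‖coef z m‖ ≤ s (ν m)`. -/
def bounded {s : ℝ → ℝ} (hs : Monotone s) (h0 : ∀ v, 0 ≤ s v) : AddSubgroup P :=
  AddSubgroup.ofSub {z | ∀ m, ‖X.coef z m‖ ≤ s (X.ν m)}
    ⟨0, fun m => by simpa [X.coef_zero] using h0 _⟩ fun z hz w hw m => by
      rw [← sub_eq_add_neg]
      rcases X.coef_sub z w m with h | ⟨k, hk, h⟩
      · simpa [h] using h0 _
      · exact h.trans (max_le ((hz k).trans (hs hk)) ((hw k).trans (hs hk)))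

theorem toR_sum (S : Finset (Mon n)) (x : Mon n → L) :
    X.toR (∑ m ∈ S, X.mon (x m) m) = ∑ m ∈ S, X.term (x m) m := by
  simp only [map_sum, X.term_eq]

theorem o_monotone {c : ℝ} (hc : 0 ≤ c) : Monotone (X.o c) := fun v w h => by
  have h0 := X.τ₀_pos
  have h1 := h0.trans_le X.τ_le
  unfold TermData.o
  gcongr

theorem o_nonneg {c : ℝ} (hc : 0 ≤ c) (v : ℝ) : 0 ≤ X.o c v :=
  mul_nonneg hc (le_min (Real.exp_pos _).le (Real.exp_pos _).le)

theorem mem_U_iff {s : ℝ → ℝ} {f : R} :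
    f ∈ X.U s ↔ ∀ ε : ℝ, 0 < ε → ∃ g ∈ X.fin s, ‖f - g‖ < ε := by
  change f ∈ closure (X.fin s : Set R) ↔ _
  simp only [Metric.mem_closure_iff, dist_eq_norm, SetLike.mem_coe, gt_iff_lt]

theorem toR_mem_U {s : ℝ → ℝ} {z : P} (h : ∀ m, X.coef z m ≠ 0 → ‖X.coef z m‖ ≤ s (X.ν m)) :
    X.toR z ∈ X.U s := by
  refine X.mem_U_iff.2 fun ε hε => ?_
  obtain ⟨S, hS⟩ := X.truncate z ε hε
  refine ⟨_, ?_, by rwa [map_sub] at hS⟩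
  rw [X.toR_sum]
  refine sum_mem fun m _ => ?_
  by_cases hm : X.coef z m = 0
  · rw [hm, X.term_zero]; exact zero_mem _
  · exact AddSubgroup.subset_closure ⟨_, _, h m hm, rfl⟩

theorem exists_of_mem_fin {s : ℝ → ℝ} (hs : Monotone s) (h0 : ∀ v, 0 ≤ s v) {f : R}
    (hf : f ∈ X.fin s) : ∃ z ∈ X.bounded hs h0, X.toR z = f := by
  have : X.fin s ≤ (X.bounded hs h0).map X.toR := by
    refine (AddSubgroup.closure_le _).2 ?_
    rintro _ ⟨x, m, hx, rfl⟩
    refine ⟨X.mon x m, fun k => ?_, (X.term_eq x m).symm⟩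
    rw [X.coef_mon]
    split_ifs with h
    · rwa [h]
    · simpa using h0 _
  exact this hf

theorem exists_of_mem_U {s : ℝ → ℝ} (hs : Monotone s) (h0 : ∀ v, 0 ≤ s v) {f : R}
    (hf : f ∈ X.U s) {ε : ℝ} (hε : 0 < ε) : ∃ z ∈ X.bounded hs h0, ‖f - X.toR z‖ < ε := by
  obtain ⟨g, hg, hfg⟩ := X.mem_U_iff.1 hf ε hε
  obtain ⟨z, hz, rfl⟩ := X.exists_of_mem_fin hs h0 hg
  exact ⟨z, hz, hfg⟩

/-- An element of small norm is a limit of elements of the dense subgroup of small norm; these have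
small coefficients, and `U (o c)` is closed. -/
theorem exists_mem_U_of_norm_lt {c : ℝ} (hc : 0 < c) :
    ∃ ε : ℝ, 0 < ε ∧ ∀ f, ‖f‖ < ε → f ∈ X.U (X.o c) := by
  obtain ⟨ε, hε, h⟩ := X.coef_le c hc
  refine ⟨ε, hε, fun f hf => ?_⟩
  have hcl : f ∈ closure (X.U (X.o c) : Set R) := by
    refine Metric.mem_closure_iff.2 fun δ hδ => ?_
    obtain ⟨z, hz⟩ := X.dense f (min δ (ε - ‖f‖)) (lt_min hδ (sub_pos.2 hf))
    refine ⟨X.toR z, X.toR_mem_U fun m _ => h z ?_ m, ?_⟩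
    · have h1 := norm_sub_le f (f - X.toR z)
      rw [sub_sub_cancel] at h1
      have := hz.trans_le (min_le_right _ _)
      linarith
    · rw [dist_eq_norm]; exact hz.trans_le (min_le_left _ _)
  have h2 : IsClosed (X.U (X.o c) : Set R) := AddSubgroup.isClosed_topologicalClosure _
  rwa [h2.closure_eq] at hcl

theorem exists_U_le {ε : ℝ} (hε : 0 < ε) :
    ∃ c : ℝ, 0 < c ∧ ∀ f ∈ X.U (X.o c), ‖f‖ ≤ ε := by
  obtain ⟨c, hc, h⟩ := X.norm_le ε hε
  refine ⟨c, hc, fun f hf => le_of_forall_pos_lt_add fun δ hδ => ?_⟩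
  obtain ⟨z, hz, hfz⟩ := X.exists_of_mem_U (X.o_monotone hc.le) (X.o_nonneg hc.le) hf hδ
  calc ‖f‖ = ‖X.toR z + (f - X.toR z)‖ := by rw [add_sub_cancel]
    _ ≤ ‖X.toR z‖ + ‖f - X.toR z‖ := norm_add_le _ _
    _ < ε + δ := add_lt_add_of_le_of_lt (h z hz) hfz

/-- The terms of an expansion system have the properties that the division algorithm uses. -/
def termSystem : TermSystem n L R where
  toTermData := X.toTermData
  τ₀_pos := X.τ₀_pos
  τ_le := X.τ_le
  u_pos := X.u_pos
  term_zero := X.term_zero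
  term_mul := X.term_mul
  term_sub x y m s hs := by
    rw [X.term_eq, X.term_eq, X.term_eq, ← map_sub, ← map_sub]
    refine X.toR_mem_U fun k hk => ?_
    obtain ⟨j, hj, h⟩ := X.coef_mon_sub x y m k hk
    rw [hj]
    exact h.trans (hs j)
  U_mem_nhds c hc := by
    obtain ⟨ε, hε, h⟩ := X.exists_mem_U_of_norm_lt hc
    exact Metric.mem_nhds_iff.2 ⟨ε, hε, fun f hf => h f (by simpa using hf)⟩
  exists_U_subset V hV := by
    obtain ⟨ε, hε, h⟩ := Metric.mem_nhds_iff.1 hV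
    obtain ⟨c, hc, h'⟩ := X.exists_U_le (half_pos hε)
    exact ⟨c, hc, fun f hf => h (by simpa using (h' f hf).trans_lt (half_lt_self hε))⟩
  exists_mem_U h := by
    obtain ⟨ε, hε, hh⟩ := X.exists_mem_U_of_norm_lt one_pos
    obtain ⟨z, hz⟩ := X.dense h ε hε
    obtain ⟨c, hc, hz'⟩ := X.exists_coef_le z
    refine ⟨max 1 c, lt_max_of_lt_left one_pos, ?_⟩
    have mono : ∀ {a : ℝ}, a ≤ max 1 c → X.U (X.o a) ≤ X.U (X.o (max 1 c)) := fun {a} ha =>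
      AddSubgroup.topologicalClosure_mono <| AddSubgroup.closure_mono fun _ ⟨x, m, hx, hf⟩ =>
        ⟨x, m, hx.trans (mul_le_mul_of_nonneg_right ha
          (le_min (Real.exp_pos _).le (Real.exp_pos _).le)), hf⟩
    rw [← sub_add_cancel h (X.toR z)]
    exact add_mem (mono (le_max_left _ _) (hh _ hz))
      (mono (le_max_right _ _) (X.toR_mem_U fun m _ => hz' m))
  -- The sum differs from an element with coefficients bounded by `s` by something of small norm,
  -- whose coefficients are at most `o c ≤ s`. Elements bounded by `s` form a group, and the
  -- coefficients of the finite sum are the `x m`.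
  rep_bound s hs h x hx m := by
    obtain ⟨c, hc, ho⟩ := h
    have h0 : ∀ v, 0 ≤ s v := fun v => (X.o_nonneg hc.le v).trans (ho v)
    obtain ⟨ε, hε, hcoef⟩ := X.coef_le c hc
    obtain ⟨w, hw, hxw⟩ := X.exists_of_mem_U hs h0 hx hε
    have hrep : X.rep x = X.toR (∑ m ∈ x.support, X.mon (x m) m) := (X.toR_sum _ _).symm
    rw [hrep, ← map_sub] at hxw
    have h1 : ∑ m ∈ x.support, X.mon (x m) m - w ∈ X.bounded hs h0 :=
      fun k => (hcoef _ hxw k).trans (ho _)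
    have h2 := add_mem h1 hw
    rw [sub_add_cancel] at h2
    have h3 : ‖X.coef (∑ m ∈ x.support, X.mon (x m) m) m‖ ≤ s (X.ν m) := h2 m
    rw [X.coef_sum] at h3
    split_ifs at h3 with h4
    · exact h3
    · simpa [Finsupp.notMem_support_iff.1 h4] using h0 _
  rep_exists s hs h0 h hh c hc := by
    classical
    obtain ⟨ε, hε, hU⟩ := X.exists_mem_U_of_norm_lt hc
    obtain ⟨z, hz, hhz⟩ := X.exists_of_mem_U hs h0 hh hε
    obtain ⟨S, hS⟩ := X.truncate z ε hε
    let x : Mon n →₀ L := Finsupp.onFinset S (fun m => if m ∈ S then X.coef z m else 0)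
      fun m hm => by by_contra h; simp [h] at hm
    have hx : ∀ m, x m = if m ∈ S then X.coef z m else 0 := fun m => rfl
    refine ⟨x, fun m => ?_, ?_⟩
    · rw [hx]
      split_ifs
      · exact hz m
      · simpa using h0 _
    · have hrep : X.rep x = X.toR (∑ m ∈ S, X.mon (X.coef z m) m) := by
        rw [X.toR_sum, TermData.rep, Finsupp.sum_of_support_subset _
          Finsupp.support_onFinset_subset _ fun m _ => X.term_zero m]
        exact Finset.sum_congr rfl fun m hm => by rw [hx, if_pos hm]
      rw [map_sub, ← hrep] at hS
      rw [← sub_add_sub_cancel h (X.toR z)]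
      exact add_mem (hU _ hhz) (hU _ hS)

theorem isNoetherianRing [IsUltrametricDist L] [CompleteSpace R]
    (X : ExpansionSystem n L R P) : IsNoetherianRing R :=
  X.termSystem.isNoetherianRing

end ExpansionSystem

/-! ### Expansions in Tate algebras over the extended Robba ring -/

namespace ExtRobba

open IsLocalRing TensorProduct MvPowerSeries
open scoped NNReal

section Robba

variable {p : ℕ} [hp : Fact p.Prime] {O : Type*} [CommRing O] [IsDomain O]
  [IsDiscreteValuationRing O] [IsAdicComplete (maximalIdeal O) O]
  [Finite (ResidueField O)] [CharP (ResidueField O) p]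
  {E : Type*} [Field E] [Algebra O E] [IsFractionRing O E]
  {L : Type*} [NormedField L] [IsUltrametricDist L] [CharP L p] [PerfectRing L p]
  [Algebra (ResidueField O) L] {ϖ : {x : O // Irreducible x}} {s r : ℝ≥0}
  {n : ℕ} {ρ : Fin n → ℝ}

variable (p) in
/-- The size of the monomial `ϖ^k T^i` on a logarithmic scale. -/
def logSize (hρ : ∀ i, 0 < ρ i) : Mon n →+ ℝ where
  toFun m := m.1 * Real.log p - Real.log (weight ρ m.2)
  map_zero' := by simp [weight]
  map_add' m k := by
    rw [Prod.snd_add, weight_add, Real.log_mul (weight_pos hρ _).ne' (weight_pos hρ _).ne']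
    push_cast [Prod.fst_add]
    ring

theorem exp_neg_logSize (hρ : ∀ i, 0 < ρ i) (k : ℤ) (i : Fin n →₀ ℕ) :
    Real.exp (-logSize p hρ (k, i)) = (p : ℝ) ^ (-k) * weight ρ i := by
  change Real.exp (-(k * Real.log p - Real.log (weight ρ i))) = _
  rw [neg_sub, sub_eq_neg_add, Real.exp_add, Real.exp_log (weight_pos hρ i), ← neg_mul,
    mul_comm _ (Real.log _), Real.exp_mul, Real.exp_log p_pos]
  congr 1
  exact_mod_cast Real.rpow_intCast (p : ℝ) (-k)

/-- Taking `t`-th roots turns the size of a term under `λ_t` into a bound of slope `1 / t` for its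
coefficient on the scale `logSize`. -/
theorem gaussTerm_mul_weight_le_iff (hρ : ∀ i, 0 < ρ i) {t : ℝ≥0} (ht : 0 < t) {c : ℝ}
    (hc : 0 < c) (k : ℤ) (i : Fin n →₀ ℕ) (x : L) :
    gaussTerm p t k x * weight ρ i ≤ c ^ (t : ℝ) ↔
      ‖x‖ ≤ c * Real.exp ((t : ℝ)⁻¹ * logSize p hρ (k, i)) := by
  by_cases hx : x = 0
  · rw [hx, gaussTerm_zero, zero_mul, norm_zero]
    exact iff_of_true (by positivity) (by positivity)
  have ht' : (0 : ℝ) < t := ht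
  have h1 : gaussTerm p t k x * weight ρ i =
      (‖x‖ * Real.exp (-((t : ℝ)⁻¹ * logSize p hρ (k, i)))) ^ (t : ℝ) := by
    rw [gaussTerm, if_neg hx, Real.mul_rpow (norm_nonneg _) (Real.exp_pos _).le, ← Real.exp_mul,
      mul_right_comm, ← exp_neg_logSize hρ, mul_comm]
    congr 2
    field_simp
  rw [h1, Real.rpow_le_rpow_iff (by positivity) hc.le ht', Real.exp_neg, ← div_eq_mul_inv,
    div_le_iff₀ (Real.exp_pos _)]

variable (p E s r) in
/-- The element `ϖ^k [x]` of `B_{L,E}` with the norm `λ_I`. -/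
def normedTerm (ϖ : {x : O // Irreducible x}) (x : L) (k : ℤ) : NormedBL p E L ϖ s r :=
  termB E ϖ (p := p) x k

/-- The coefficients in the expansion of an element of `B_{L,E}` with the norm `λ_I`. -/
def normedCoeff (z : NormedBL p E L ϖ s r) (k : ℤ) : L := coeffB ϖ (p := p) (E := E) z k

theorem normedCoeff_sub_le (z w : NormedBL p E L ϖ s r) (k : ℤ) :
    normedCoeff (z - w) k = 0 ∨
      ∃ j ≤ k, ‖normedCoeff (z - w) k‖ ≤ max ‖normedCoeff z j‖ ‖normedCoeff w j‖ :=
  coeffB_sub_le ϖ (p := p) (E := E) z w k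

theorem normedCoeff_sum (S : Finset ℤ) (c : ℤ → L) (k : ℤ) :
    normedCoeff (∑ j ∈ S, normedTerm p E s r ϖ (c j) j) k = if k ∈ S then c k else 0 :=
  coeffB_sum ϖ (E := E) S c k

theorem norm_le_iff {z : NormedBL p E L ϖ s r} {C : ℝ} :
    ‖z‖ ≤ C ↔ ∀ k, gaussTerm p s k (normedCoeff z k) ≤ C ∧
      gaussTerm p r k (normedCoeff z k) ≤ C :=
  calc ‖z‖ ≤ C ↔ gaussNorm ϖ s (p := p) (E := E) z ≤ C ∧ gaussNorm ϖ r (p := p) (E := E) z ≤ C :=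
        max_le_iff
    _ ↔ _ := (and_congr (ciSup_le_iff (gauss_bdd ϖ s (p := p) (E := E) z))
        (ciSup_le_iff (gauss_bdd ϖ r (p := p) (E := E) z))).trans forall_and.symm

/-- Truncations of the expansion converge. -/
theorem exists_norm_sub_truncate_lt (z : NormedBL p E L ϖ s r) {ε : ℝ} (hε : 0 < ε) :
    ∃ S : Finset ℤ, ‖z - ∑ k ∈ S, normedTerm p E s r ϖ (normedCoeff z k) k‖ < ε := by
  obtain ⟨m, hm⟩ := coeffB_truncate ϖ (p := p) (E := E) z
  obtain ⟨C, hC⟩ : ∃ C, ∀ k, ‖normedCoeff z k‖ ≤ C := coeffB_bounded ϖ (p := p) (E := E) z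
  have hC0 : 0 ≤ C := (norm_nonneg _).trans (hC 0)
  have hp1 : (1 : ℝ) < p := Nat.one_lt_cast.2 hp.out.one_lt
  have := p_pos (p := p)
  set D := max (C ^ (s : ℝ)) (C ^ (r : ℝ)) + 1
  have hD : 0 < D := by positivity
  -- The coefficients are bounded and the expansion starts no lower than `-m`, so omitting the terms
  -- from `N - m` on costs at most `p ^ (m - N) * D`.
  obtain ⟨N, hN⟩ := exists_pow_lt_of_lt_one (show 0 < ε / (D * (p : ℝ) ^ m) by positivity)
    (inv_lt_one_of_one_lt₀ hp1)
  rw [lt_div_iff₀ (by positivity)] at hN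
  obtain ⟨S, hS⟩ := hm N
  refine ⟨S, lt_of_le_of_lt (norm_le_iff.2 ?_) hN⟩
  have key : ∀ (t : ℝ≥0), C ^ (t : ℝ) ≤ D → ∀ k, gaussTerm p t k (normedCoeff
      (z - ∑ k ∈ S, normedTerm p E s r ϖ (normedCoeff z k) k) k) ≤
      (p : ℝ)⁻¹ ^ N * (D * (p : ℝ) ^ m) := fun t ht k => by
    have hk : normedCoeff (z - ∑ k ∈ S, normedTerm p E s r ϖ (normedCoeff z k) k) k =
      if (N : ℤ) - m ≤ k then normedCoeff z k else 0 := hS k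
    rw [hk]
    split_ifs with h
    · rw [gaussTerm]
      split_ifs
      · positivity
      · calc (p : ℝ) ^ (-k) * ‖normedCoeff z k‖ ^ (t : ℝ)
            ≤ (p : ℝ) ^ (-((N : ℤ) - m)) * D := by
              exact mul_le_mul (zpow_le_zpow_right₀ one_le_p (by omega))
                ((Real.rpow_le_rpow (norm_nonneg _) (hC _) t.2).trans ht) (by positivity)
                (by positivity)
          _ = _ := by
            rw [neg_sub, sub_eq_add_neg, zpow_add₀ p_pos.ne', zpow_neg, zpow_natCast,
              zpow_natCast, inv_pow]
            ring
    · rw [gaussTerm_zero]; positivity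
  exact fun k => ⟨key s ((le_max_left _ _).trans (le_add_of_nonneg_right zero_le_one)) k,
    key r ((le_max_right _ _).trans (le_add_of_nonneg_right zero_le_one)) k⟩

variable (p E L ϖ s r n) in
/-- Polynomials over `B_{L,E}`. -/
abbrev Poly : Type _ := (Fin n →₀ ℕ) →₀ NormedBL p E L ϖ s r

variable (ρ) in
/-- The inclusion of the polynomials over `B_{L,E}` in the Tate algebra over its completion. -/
def toTate : Poly p E L ϖ s r n →+ TateAlgebra (BI p E L ϖ s r) ρ where
  toFun z := ⟨fun i => (z i : BI p E L ϖ s r), by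
    refine tendsto_const_nhds.congr' ?_
    filter_upwards [z.hasFiniteSupport.compl_mem_cofinite] with i hi
    have : z i = 0 := by simpa using hi
    change 0 = ‖(z i : BI p E L ϖ s r)‖ * _
    rw [this, UniformSpace.Completion.coe_zero, norm_zero, zero_mul]⟩
  map_zero' := by
    ext i
    exact UniformSpace.Completion.coe_zero
  map_add' z w := by
    ext i
    exact UniformSpace.Completion.coe_add _ _

theorem coeff_toTate (z : Poly p E L ϖ s r n) (i : Fin n →₀ ℕ) :
    coeff i (toTate ρ z).1 = (z i : BI p E L ϖ s r) := rfl

theorem tateNorm_toTate_le_iff {z : Poly p E L ϖ s r n} {C : ℝ} :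
    tateNorm (toTate ρ z) ≤ C ↔ ∀ i, ‖z i‖ * weight ρ i ≤ C := by
  rw [tateNorm, ciSup_le_iff (tate_bdd _)]
  simp only [coeff_toTate, UniformSpace.Completion.norm_coe]

theorem toTate_dense (hρ : ∀ i, 0 < ρ i) (f : TateAlgebra (BI p E L ϖ s r) ρ) {ε : ℝ}
    (hε : 0 < ε) : ∃ z : Poly p E L ϖ s r n, tateNorm (f - toTate ρ z) < ε := by
  classical
  have hf : Tendsto (fun i => ‖coeff i f.1‖ * weight ρ i) cofinite (𝓝 0) := f.2
  -- Only finitely many coefficients have to be approximated by elements of `B_{L,E}`; the others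
  -- are replaced by zero.
  have hfin : {i | ¬ ‖coeff i f.1‖ * weight ρ i < ε / 2}.Finite :=
    hf.eventually_lt_const (half_pos hε)
  have hz : ∀ i, ∃ z : NormedBL p E L ϖ s r,
      ‖coeff i f.1 - (z : BI p E L ϖ s r)‖ * weight ρ i ≤ ε / 2 := fun i => by
    have hw := weight_pos hρ i
    obtain ⟨z, hz⟩ := (UniformSpace.Completion.denseRange_coe
      (α := NormedBL p E L ϖ s r)).exists_dist_lt (coeff i f.1)
      (show 0 < ε / 2 / weight ρ i by positivity)
    rw [dist_eq_norm, lt_div_iff₀ hw] at hz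
    exact ⟨z, hz.le⟩
  choose z hz using hz
  refine ⟨Finsupp.onFinset hfin.toFinset (fun i => if i ∈ hfin.toFinset then z i else 0)
    fun i hi => (ite_ne_right_iff.1 hi).1, (tateNorm_le fun i => ?_).trans_lt (half_lt_self hε)⟩
  change ‖coeff i f.1 - ((if i ∈ hfin.toFinset then z i else 0 : NormedBL p E L ϖ s r) :
    BI p E L ϖ s r)‖ * weight ρ i ≤ ε / 2
  split_ifs with h
  · exact hz i
  · rw [UniformSpace.Completion.coe_zero, sub_zero]
    simp only [Set.Finite.mem_toFinset, Set.mem_ofPred_eq, not_not] at h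
    exact h.le

variable (p E s r) in
/-- The polynomial `[x] ϖ^k T^i` with `m = (k, i)`. -/
def monPoly (ϖ : {x : O // Irreducible x}) (x : L) (m : Mon n) : Poly p E L ϖ s r n :=
  Finsupp.single m.2 (normedTerm p E s r ϖ x m.1)

/-- The coefficients in the expansion of a polynomial over `B_{L,E}`. -/
def coefPoly (z : Poly p E L ϖ s r n) (m : Mon n) : L := normedCoeff (z m.2) m.1

theorem toTate_monPoly (x : L) (m : Mon n) :
    (toTate ρ (monPoly p E s r ϖ x m)).1 = monomial m.2
      (normedTerm p E s r ϖ x m.1 : BI p E L ϖ s r) := by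
  classical
  ext i
  rw [coeff_toTate, coeff_monomial, monPoly, Finsupp.single_apply]
  simp only [eq_comm (a := m.2)]
  split_ifs
  · rfl
  · exact UniformSpace.Completion.coe_zero

/-- The coefficients of a sum of monomials. -/
theorem sum_monPoly_apply {T : Finset (Mon n)} {S : Finset ℤ} {i : Fin n →₀ ℕ}
    (h : ∀ k, (k, i) ∈ T ↔ k ∈ S) (x : Mon n → L) :
    (∑ m ∈ T, monPoly p E s r ϖ (x m) m) i =
      ∑ k ∈ S, normedTerm p E s r ϖ (x (k, i)) k := by
  classical
  rw [Finsupp.finsetSum_apply]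
  simp only [monPoly, Finsupp.single_apply]
  rw [← Finset.sum_filter]
  refine Finset.sum_bij' (fun m _ => m.1) (fun k _ => (k, i)) ?_ ?_ ?_ ?_ ?_
  · rintro ⟨k, j⟩ hm
    obtain ⟨hT, rfl⟩ := Finset.mem_filter.1 hm
    exact (h k).1 hT
  · intro k hk
    exact Finset.mem_filter.2 ⟨(h k).2 hk, rfl⟩
  · rintro ⟨k, j⟩ hm
    obtain ⟨-, rfl⟩ := Finset.mem_filter.1 hm
    rfl
  · intro k hk; rfl
  · rintro ⟨k, j⟩ hm
    obtain ⟨-, rfl⟩ := Finset.mem_filter.1 hm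
    rfl

theorem coefPoly_sum (T : Finset (Mon n)) (x : Mon n → L) (m : Mon n) :
    coefPoly (∑ k ∈ T, monPoly p E s r ϖ (x k) k) m = if m ∈ T then x m else 0 := by
  classical
  obtain ⟨k, i⟩ := m
  have h : ∀ k, (k, i) ∈ T ↔ k ∈ (T.filter (·.2 = i)).image Prod.fst := fun k => by simp
  rw [coefPoly, sum_monPoly_apply h]
  rw [normedCoeff_sum]
  simp only [← h]

theorem exists_truncate (hρ : ∀ i, 0 < ρ i) (z : Poly p E L ϖ s r n) {ε : ℝ} (hε : 0 < ε) :
    ∃ T : Finset (Mon n),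
      tateNorm (toTate ρ (z - ∑ m ∈ T, monPoly p E s r ϖ (coefPoly z m) m)) < ε := by
  classical
  have hS : ∀ i, ∃ S : Finset ℤ, ‖z i - ∑ k ∈ S, normedTerm p E s r ϖ (normedCoeff (z i) k) k‖ *
      weight ρ i ≤ ε / 2 := fun i => by
    have hw := weight_pos hρ i
    obtain ⟨S, hS⟩ := exists_norm_sub_truncate_lt (z i) (show 0 < ε / 2 / weight ρ i by positivity)
    exact ⟨S, ((lt_div_iff₀ hw).1 hS).le⟩
  choose S hS using hS
  refine ⟨z.support.biUnion fun i => (S i).image fun k => (k, i),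
    (tateNorm_toTate_le_iff.2 fun i => ?_).trans_lt (half_lt_self hε)⟩
  by_cases hi : i ∈ z.support
  · rw [Finsupp.sub_apply, sum_monPoly_apply (S := S i) (by simp [Finsupp.mem_support_iff.1 hi])]
    exact hS i
  · rw [Finsupp.sub_apply, sum_monPoly_apply (S := ∅) (by simp [Finsupp.notMem_support_iff.1 hi]),
      Finsupp.notMem_support_iff.1 hi, Finset.sum_empty, sub_zero, norm_zero, zero_mul]
    positivity

end Robba

end ExtRobba

/-! ### The term system of the Tate algebra and the conclusion -/

namespace ExtRobba

open IsLocalRing TensorProduct MvPowerSeries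
open scoped NNReal

section Robba

variable {p : ℕ} [hp : Fact p.Prime] {O : Type*} [CommRing O] [IsDomain O]
  [IsDiscreteValuationRing O] [IsAdicComplete (maximalIdeal O) O]
  [Finite (ResidueField O)] [CharP (ResidueField O) p]
  {E : Type*} [Field E] [Algebra O E] [IsFractionRing O E]
  {L : Type*} [NormedField L] [IsUltrametricDist L] [CharP L p] [PerfectRing L p]
  [Algebra (ResidueField O) L] {ϖ : {x : O // Irreducible x}} {s r : ℝ≥0}
  {n : ℕ} {ρ : Fin n → ℝ}

variable (p E L ϖ s r ρ) in
/-- The terms `[x] ϖ^k T^i` in the Tate algebra. -/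
def robbaTermData (hρ : ∀ i, 0 < ρ i) : TermData n L (TateAlgebra (BI p E L ϖ s r) ρ) where
  term x m := toTate ρ (monPoly p E s r ϖ x m)
  ν := logSize p hρ
  τ₀ := (r : ℝ)⁻¹
  τ₁ := (s : ℝ)⁻¹

theorem tateNorm_toTate_le_iff_coefPoly {z : Poly p E L ϖ s r n} (hρ : ∀ i, 0 < ρ i) {C : ℝ} :
    tateNorm (toTate ρ z) ≤ C ↔ ∀ m, gaussTerm p s m.1 (coefPoly z m) * weight ρ m.2 ≤ C ∧
      gaussTerm p r m.1 (coefPoly z m) * weight ρ m.2 ≤ C := by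
  rw [tateNorm_toTate_le_iff]
  constructor
  · rintro h ⟨k, i⟩
    have h1 := h i
    rw [← le_div_iff₀ (weight_pos hρ i), norm_le_iff] at h1
    rw [← le_div_iff₀ (weight_pos hρ i), ← le_div_iff₀ (weight_pos hρ i)]
    exact h1 k
  · intro h i
    rw [← le_div_iff₀ (weight_pos hρ i), norm_le_iff]
    intro k
    rw [le_div_iff₀ (weight_pos hρ i), le_div_iff₀ (weight_pos hρ i)]
    exact h (k, i)

theorem norm_le_o_iff (hρ : ∀ i, 0 < ρ i) (hs : 0 < s) (hr : 0 < r) {c : ℝ} (hc : 0 < c)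
    (x : L) (m : Mon n) : ‖x‖ ≤ (robbaTermData p E L ϖ s r ρ hρ).o c (logSize p hρ m) ↔
      gaussTerm p s m.1 x * weight ρ m.2 ≤ c ^ (s : ℝ) ∧
      gaussTerm p r m.1 x * weight ρ m.2 ≤ c ^ (r : ℝ) := by
  rw [gaussTerm_mul_weight_le_iff hρ hs hc, gaussTerm_mul_weight_le_iff hρ hr hc, TermData.o,
    mul_min_of_nonneg _ _ hc.le, le_min_iff, and_comm]
  rfl

theorem coefPoly_le_of_norm_lt (hρ : ∀ i, 0 < ρ i) (hs : 0 < s) (hr : 0 < r) {c : ℝ} (hc : 0 < c)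
    {z : Poly p E L ϖ s r n} (h : tateNorm (toTate ρ z) < min (c ^ (s : ℝ)) (c ^ (r : ℝ)))
    (m : Mon n) : ‖coefPoly z m‖ ≤ (robbaTermData p E L ϖ s r ρ hρ).o c (logSize p hρ m) := by
  have h1 := (tateNorm_toTate_le_iff_coefPoly hρ).1 h.le m
  exact (norm_le_o_iff hρ hs hr hc _ m).2
    ⟨h1.1.trans (min_le_left _ _), h1.2.trans (min_le_right _ _)⟩

theorem toTate_monPoly_mul (x y : L) (m k : Mon n) :
    toTate ρ (monPoly p E s r ϖ x m) * toTate ρ (monPoly p E s r ϖ y k) =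
      toTate ρ (monPoly p E s r ϖ (x * y) (m + k)) := by
  refine Subtype.ext ?_
  change (toTate ρ (monPoly p E s r ϖ x m)).1 * (toTate ρ (monPoly p E s r ϖ y k)).1 = _
  rw [toTate_monPoly, toTate_monPoly, toTate_monPoly, monomial_mul_monomial,
    ← UniformSpace.Completion.coe_mul]
  congr 2
  exact termB_mul ϖ x y m.1 k.1

theorem coefPoly_sub_le (hρ : ∀ i, 0 < ρ i) (z w : Poly p E L ϖ s r n) (m : Mon n) :
    coefPoly (z - w) m = 0 ∨ ∃ k, logSize p hρ k ≤ logSize p hρ m ∧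
      ‖coefPoly (z - w) m‖ ≤ max ‖coefPoly z k‖ ‖coefPoly w k‖ := by
  obtain ⟨k, i⟩ := m
  refine (normedCoeff_sub_le (z i) (w i) k).imp id fun ⟨j, hj, h⟩ => ⟨(j, i), ?_, h⟩
  change j * Real.log p - _ ≤ k * Real.log p - _
  have := Real.log_nonneg (one_le_p (p := p))
  gcongr

theorem coefPoly_monPoly_sub (hρ : ∀ i, 0 < ρ i) (x y : L) (m k : Mon n)
    (h : coefPoly (monPoly p E s r ϖ x m - monPoly p E s r ϖ y m - monPoly p E s r ϖ (x - y) m) k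
      ≠ 0) :
    ∃ j : ℕ, logSize p hρ k = logSize p hρ m + (j + 1) * logSize p hρ (1, 0) ∧
      ‖coefPoly (monPoly p E s r ϖ x m - monPoly p E s r ϖ y m - monPoly p E s r ϖ (x - y) m) k‖ ≤
        max ‖x‖ ‖y‖ := by
  obtain ⟨k, i⟩ := k
  obtain ⟨l, j⟩ := m
  by_cases hij : j = i
  · subst hij
    have e : coefPoly (monPoly p E s r ϖ x (l, j) - monPoly p E s r ϖ y (l, j) -
        monPoly p E s r ϖ (x - y) (l, j)) (k, j) =
        coeffB ϖ (termB E ϖ (p := p) x l - termB E ϖ y l - termB E ϖ (x - y) l) k := by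
      simp only [coefPoly, monPoly, Finsupp.sub_apply, Finsupp.single_eq_same]
      rfl
    rw [e] at h ⊢
    obtain ⟨h1, h2⟩ := coeffB_termB_sub ϖ (E := E) x y l k
    have hlk : l < k := by
      by_contra! hk
      exact h (h2 hk)
    refine ⟨(k - l - 1).toNat, ?_, h1⟩
    have hk : (k : ℝ) = l + ((k - l - 1).toNat + 1) := by
      have : k = l + ((k - l - 1).toNat + 1) := by omega
      exact_mod_cast this
    change (k : ℝ) * Real.log p - _ = l * Real.log p - _ + _ * ((1 : ℤ) * Real.log p - _)
    conv_lhs => rw [hk]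
    simp [weight]
    ring
  · refine absurd ?_ h
    simp only [coefPoly, monPoly, Finsupp.sub_apply, Finsupp.single_eq_of_ne' hij, sub_zero]
    exact coeffB_zero ϖ (p := p) (E := E) k

theorem toTate_monPoly_zero (m : Mon n) :
    toTate ρ (monPoly p E s r ϖ (0 : L) m) = 0 := by
  rw [monPoly, show normedTerm p E s r ϖ (0 : L) m.1 = 0 from termB_zero ϖ m.1,
    Finsupp.single_zero, map_zero]

theorem exists_tateNorm_le (hρ : ∀ i, 0 < ρ i) (hs : 0 < s) (hsr : s ≤ r) {ε : ℝ} (hε : 0 < ε) :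
    ∃ c : ℝ, 0 < c ∧ ∀ z : Poly p E L ϖ s r n,
      (∀ m, ‖coefPoly z m‖ ≤ (robbaTermData p E L ϖ s r ρ hρ).o c (logSize p hρ m)) →
        tateNorm (toTate ρ z) ≤ ε := by
  have hs' : (0 : ℝ) < s := hs
  -- The cap at `1` gives `c ^ r ≤ c ^ s`, so one choice of `c` serves both norms.
  have hc : 0 < min 1 (ε ^ (s : ℝ)⁻¹) := lt_min one_pos (by positivity)
  refine ⟨min 1 (ε ^ (s : ℝ)⁻¹), hc, fun z hz => ?_⟩
  have h1 : min 1 (ε ^ (s : ℝ)⁻¹) ^ (s : ℝ) ≤ ε := by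
    refine (Real.rpow_le_rpow hc.le (min_le_right _ _) hs'.le).trans ?_
    rw [Real.rpow_inv_rpow hε.le hs'.ne']
  have h2 : min 1 (ε ^ (s : ℝ)⁻¹) ^ (r : ℝ) ≤ ε :=
    (Real.rpow_le_rpow_of_exponent_ge hc (min_le_left _ _) hsr).trans h1
  refine (tateNorm_toTate_le_iff_coefPoly hρ).2 fun m => ?_
  have h3 := (norm_le_o_iff hρ hs (hs.trans_le hsr) hc _ m).1 (hz m)
  exact ⟨h3.1.trans h1, h3.2.trans h2⟩

theorem exists_coefPoly_le (hρ : ∀ i, 0 < ρ i) (hs : 0 < s) (hsr : s ≤ r)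
    (z : Poly p E L ϖ s r n) : ∃ c : ℝ, 0 < c ∧
      ∀ m, ‖coefPoly z m‖ ≤ (robbaTermData p E L ϖ s r ρ hρ).o c (logSize p hρ m) := by
  have hs' : (0 : ℝ) < s := hs
  have h0 := tateNorm_nonneg hρ (toTate ρ z)
  -- Adding `1` makes the base at least `1`, so that `c ^ s ≤ c ^ r` and only the exponent `s`
  -- matters; it also makes the inequality strict.
  have h1 : (1 : ℝ) ≤ (tateNorm (toTate ρ z) + 1) ^ (s : ℝ)⁻¹ :=
    Real.one_le_rpow (by linarith) (by positivity)
  have hc : 0 < (tateNorm (toTate ρ z) + 1) ^ (s : ℝ)⁻¹ := one_pos.trans_le h1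
  refine ⟨_, hc, coefPoly_le_of_norm_lt hρ hs (hs.trans_le hsr) hc ?_⟩
  have h2 : ((tateNorm (toTate ρ z) + 1) ^ (s : ℝ)⁻¹) ^ (s : ℝ) = tateNorm (toTate ρ z) + 1 :=
    Real.rpow_inv_rpow (by linarith) hs'.ne'
  have h3 := Real.rpow_le_rpow_of_exponent_le h1 (show (s : ℝ) ≤ r from hsr)
  rw [min_eq_left h3, h2]
  exact lt_add_one _

theorem logSize_one_zero_pos (hρ : ∀ i, 0 < ρ i) : 0 < logSize p hρ (1, 0) := by
  change 0 < ((1 : ℤ) : ℝ) * Real.log p - Real.log (weight ρ 0)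
  simpa [weight] using Real.log_pos (Nat.one_lt_cast.2 hp.out.one_lt)

variable (p E L ϖ s r ρ) in
/-- The expansions of the elements of the Tate algebra. -/
def robbaExpansionSystem (hρ : ∀ i, 0 < ρ i) (hs : 0 < s) (hsr : s ≤ r) :
    letI := tateNormedCommRing (A := BI p E L ϖ s r) hρ
    ExpansionSystem n L (TateAlgebra (BI p E L ϖ s r) ρ) (Poly p E L ϖ s r n) :=
  letI := tateNormedCommRing (A := BI p E L ϖ s r) hρ
  have hr : 0 < r := hs.trans_le hsr
  { robbaTermData p E L ϖ s r ρ hρ with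
    mon := monPoly p E s r ϖ
    toR := toTate ρ
    coef := coefPoly
    term_eq := fun _ _ => rfl
    τ₀_pos := inv_pos.2 hr
    τ_le := inv_anti₀ hs hsr
    u_pos := logSize_one_zero_pos hρ
    term_zero := toTate_monPoly_zero
    term_mul := toTate_monPoly_mul
    coef_sub := coefPoly_sub_le hρ
    coef_sum := coefPoly_sum
    coef_mon_sub := coefPoly_monPoly_sub hρ
    truncate := fun z _ hε => exists_truncate hρ z hε
    norm_le := fun _ hε => exists_tateNorm_le hρ hs hsr hε
    coef_le := fun c hc => ⟨min (c ^ (s : ℝ)) (c ^ (r : ℝ)), by positivity,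
      fun _ hz m => coefPoly_le_of_norm_lt hρ hs hr hc hz m⟩
    exists_coef_le := exists_coefPoly_le hρ hs hsr
    dense := fun f _ hε => toTate_dense hρ f hε }

/-- The Tate algebras over the extended Robba ring are noetherian. -/
theorem isNoetherianRing_tateAlgebra (hρ : ∀ i, 0 < ρ i) (hs : 0 < s) (hsr : s ≤ r) :
    IsNoetherianRing (TateAlgebra (BI p E L ϖ s r) ρ) := by
  let := tateNormedCommRing (A := BI p E L ϖ s r) hρ
  have := tate_complete (A := BI p E L ϖ s r) hρ
  exact (robbaExpansionSystem p E L ϖ s r ρ hρ hs hsr).isNoetherianRing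

end Robba

end ExtRobba

end

/-- Here `E` is a complete discretely valued field with valuation ring `O`, uniformizer `ϖ` and
finite residue field `ResidueField O` of characteristic `p`, and `L` is a perfect complete
nonarchimedean field, with nontrivial norm, containing that residue field. -/
theorem theoremT (p : ℕ) [Fact p.Prime]
    {E : Type*} [Field E] (O : ValuationSubring E) [IsDiscreteValuationRing O]
    [IsAdicComplete (IsLocalRing.maximalIdeal O) O]
    [Finite (IsLocalRing.ResidueField O)] [CharP (IsLocalRing.ResidueField O) p]
    (ϖ : {x : O // Irreducible x})
    {L : Type*} [NontriviallyNormedField L] [IsUltrametricDist L] [CompleteSpace L]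
    [CharP L p] [PerfectRing L p] [Algebra (IsLocalRing.ResidueField O) L]
    (s r : NNReal) (hs : 0 < s) (hsr : s ≤ r) :
    (∀ (n : ℕ) (ρ : Fin n → ℝ), (∀ i, 0 < ρ i) →
      IsNoetherianRing (ExtRobba.TateAlgebra (ExtRobba.BI p E L ϖ s r) ρ)) ∧
    ExtRobba.IsStronglyNoetherian (ExtRobba.BI p E L ϖ s r) := by
  have h := fun (n : ℕ) (ρ : Fin n → ℝ) (hρ : ∀ i, 0 < ρ i) =>
    ExtRobba.isNoetherianRing_tateAlgebra (p := p) (E := E) (L := L) (ϖ := ϖ) hρ hs hsr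
  exact ⟨h, fun n => h n _ fun _ => one_pos⟩
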